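/- Let $\Omega=B_1\subset\mathbb R^2$ be the open unit disc, let $L>0$ and $\beta>0$, and attach to $\overline{B_1}$ at $x_0=(1,0)$ the needle $\mathcal L=\{(x,0):1\le x\le L+1\}$. Put $\overline\Omega:=\overline{B_1}\cup\mathcal L$ and $\Sigma:=\partial B_1\cup\mathcal L$. Let $\lambda_\Omega$ be the normalized Lebesgue measure on $B_1$, let $\lambda_\partial$ and $\lambda_{\mathcal L}$ be the normalized one-dimensional Hausdorff measures on $\partial B_1$ and $\mathcal L$, and put $$\lambda_\Sigma=\frac{2\pi}{2\pi+L}\lambda_\partial+\frac{L}{2\pi+L}\lambda_{\mathcal L},\qquad \lambda_\alpha=\alpha\lambda_\Omega+(1-\alpha)\lambda_\Sigma\qquad(0\le\alpha\le1).$$ Let $\mathcal D_0$ be the set of functions $f$ that are continuous on $\overline\Omega$, of class $C^1$ on $\overline\Omega\setminus\{x_0\}$, and whose one-sided derivatives at $x_0$ along the three branches of $\Sigma$ leaving $x_0$ (the two arcs of the circle and the needle, parametrized by arc length) exist and have sum $0$. With $\nabla^\tau$ the tangential gradient on $\Sigma\setminus\{x_0\}$, let $$\mathcal E_\alpha(f)=\alpha\int_\Omega\|\nabla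 f\|^2\,d\lambda_\Omega+(1-\alpha)\int_\Sigma\beta\|\nabla^\tau f\|^2\,d\lambda_\Sigma\in[0,\infty],\qquad C_\alpha=\sup_{f\in\mathcal D_0,\ \mathcal E_\alpha(f)>0}\frac{\operatorname{Var}_{\lambda_\alpha}f}{\mathcal E_\alpha(f)},$$ where the quotient is read as $0$ if $\mathcal E_\alpha(f)=\infty$. Let $\sigma_\Omega$ be the smallest positive eigenvalue of $-\Delta$ on $B_1$ with Neumann boundary condition, that is, the smallest $\mu>0$ for which there is a function $u\not\equiv0$, of class $C^2$ up to the boundary, with $\Delta u=-\mu u$ in $B_1$ and $\partial u/\partial\nu=0$ on $\partial B_1$. Let $\gamma_L$ be the smallest positive solution $\gamma$ of $$2\cos(\sqrt\gamma L)\bigl(1-\cos(2\pi\sqrt\gamma)\bigr)+\sin(\sqrt\gamma L)\sin(2\pi\sqrt\gamma)=0 .$$ Then $\sigma_\Omega$ and $\gamma_L$ exist (both minima are attained), and for all $L>0$, $\beta>0$ and $\alpha\in[0,1]$ $$C_\alpha\le\max\left(\frac1{\sigma_\Omega}+\frac38(1-\alpha),\ \frac1{\beta\gamma_L}+\alpha\,\frac{L^2(\pi+L)}{\beta(2\pi+L)}\right).$$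 Moreover $\gamma_L\le1$ for every $L>0$, and $\gamma_{2\pi}=\left(\frac{\arccos(-1/3)}{2\pi}\right)^2\approx0.0925$, with error less than $5\cdot10^{-5}$. -/

import Mathlib

open MeasureTheory ProbabilityTheory Real Set
open scoped ENNReal

noncomputable section

namespace BallNeedle

/-- The Euclidean plane. -/
abbrev Plane : Type := EuclideanSpace ℝ (Fin 2)

/-- The open unit disc `Ω = B₁`. -/
def disc : Set Plane := Metric.ball 0 1

/-- The closed unit disc. -/
def closedDisc : Set Plane := Metric.closedBall 0 1

/-- The unit circle `∂B₁`. -/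
def circle : Set Plane := Metric.sphere 0 1

/-- The needle `{(x, 0) : 1 ≤ x ≤ L + 1}`. -/
def needle (L : ℝ) : Set Plane := {x | 1 ≤ x 0 ∧ x 0 ≤ L + 1 ∧ x 1 = 0}

/-- The attachment point `x₀ = (1, 0)`. -/
def attach : Plane := !₂[1, 0]

/-- The closed disc together with the needle. -/
def fullSet (L : ℝ) : Set Plane := closedDisc ∪ needle L

/-! ### The measures -/

/-- Normalized Lebesgue measure on the disc. -/
def discMeasure : Measure Plane := cond volume disc

/-- Normalized one-dimensional Hausdorff measure on the circle. -/
def circleMeasure : Measure Plane := cond (Measure.hausdorffMeasure 1) circle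

/-- Normalized one-dimensional Hausdorff measure on the needle. -/
def needleMeasure (L : ℝ) : Measure Plane := cond (Measure.hausdorffMeasure 1) (needle L)

/-- The measure `2π/(2π+L) λ_∂ + L/(2π+L) λ_𝓛` on `Σ = ∂B₁ ∪ 𝓛`. -/
def sigmaMeasure (L : ℝ) : Measure Plane :=
  ENNReal.ofReal (2 * π / (2 * π + L)) • circleMeasure
    + ENNReal.ofReal (L / (2 * π + L)) • needleMeasure L

/-- The measure `λ_α = α λ_Ω + (1 - α) λ_Σ`. -/
def mixedMeasure (L α : ℝ) : Measure Plane :=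
  ENNReal.ofReal α • discMeasure + ENNReal.ofReal (1 - α) • sigmaMeasure L

/-! ### The energy form -/

/-- The unit tangent vector to the circle at `x`, obtained by a rotation of `x` by `π / 2`. -/
def circleTangent (x : Plane) : Plane := !₂[-x 1, x 0]

open Classical in
/-- The tangential gradient `∇^τ f` along `Σ`. At a point `x` of the circle it is the derivative
of `f` along the unit speed parametrization `s ↦ cos s • x + sin s • circleTangent x` of the
circle, times the unit tangent vector; at the other points it is the derivative of `f` in the
direction `(1, 0)` of the needle, times `(1, 0)`. (The points `x₀` and `x_L` are null sets.) -/
def tangentialGradient (f : Plane → ℝ) (x : Plane) : Plane :=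
  if x ∈ circle then
    deriv (fun s : ℝ => f (cos s • x + sin s • circleTangent x)) 0 • circleTangent x
  else
    deriv (fun s : ℝ => f (x + s • (!₂[1, 0] : Plane))) 0 • (!₂[1, 0] : Plane)

/-- The energy `α ∫_Ω ‖∇f‖² dλ_Ω + (1 - α) ∫_Σ ‖√β ∇^τ f‖² dλ_Σ`, as a number in `[0, ∞]`. -/
def energy (L β α : ℝ) (f : Plane → ℝ) : ℝ≥0∞ :=
  ENNReal.ofReal α * ∫⁻ x, ‖gradient f x‖ₑ ^ 2 ∂discMeasure
    + ENNReal.ofReal (1 - α) * ∫⁻ x, ‖√β • tangentialGradient f x‖ₑ ^ 2 ∂(sigmaMeasure L)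

/-- The domain `𝓓₀`: functions that are continuous on the closed disc with its needle, `C¹` there
except at the attachment point `x₀`, and whose one-sided derivatives at `x₀` along the three
branches of `Σ` (the two arcs of the circle and the needle, all parametrized by arc length and
leaving `x₀`) exist and add up to `0`. The values of `f` outside the disc with needle play no
role. -/
def domain (L : ℝ) : Set (Plane → ℝ) :=
  {f | ContinuousOn f (fullSet L) ∧ ContDiffOn ℝ 1 f (fullSet L \ {attach}) ∧
    ∃ d₁ d₂ d₃ : ℝ,
      HasDerivWithinAt (fun s : ℝ => f !₂[cos s, sin s]) d₁ (Ici 0) 0 ∧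
      HasDerivWithinAt (fun s : ℝ => f !₂[cos s, -sin s]) d₂ (Ici 0) 0 ∧
      HasDerivWithinAt (fun s : ℝ => f !₂[1 + s, 0]) d₃ (Icc 0 L) 0 ∧
      d₁ + d₂ + d₃ = 0}

/-- The optimal Poincaré constant `C_α`, the supremum of `Var_{λ_α} f / 𝓔_α(f)` over all `f ∈ 𝓓₀`
with `𝓔_α(f) > 0`, as an element of `[0, ∞]`. A function with infinite energy contributes the
value `0`, so only functions of finite energy matter. -/
def poincareConstant (L β α : ℝ) : ℝ≥0∞ :=
  ⨆ f ∈ {f ∈ domain L | 0 < energy L β α f},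
    evariance f (mixedMeasure L α) / energy L β α f

/-! ### The two spectral quantities -/

/-- `μ` is an eigenvalue of `-Δ` on the unit disc with Neumann boundary condition: there is a
function `u` of class `C²` up to the boundary that does not vanish identically and satisfies
`Δu = -μ u` in the disc and has zero normal derivative on the circle. -/
def IsNeumannEigenvalue (μ : ℝ) : Prop :=
  ∃ u : Plane → ℝ, ContDiffOn ℝ 2 u closedDisc ∧ (∃ x ∈ disc, u x ≠ 0) ∧
    (∀ x ∈ disc, Laplacian.laplacian u x = -μ * u x) ∧
    ∀ x ∈ circle, fderivWithin ℝ u closedDisc x x = 0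

/-- `σ_Ω`, the smallest positive Neumann eigenvalue of the unit disc. -/
def sigmaDisc : ℝ := sInf {μ : ℝ | 0 < μ ∧ IsNeumannEigenvalue μ}

/-- The equation that determines `γ_L`. -/
def NeedleEquation (L γ : ℝ) : Prop :=
  2 * cos (√γ * L) * (1 - cos (√γ * (2 * π))) + sin (√γ * L) * sin (√γ * (2 * π)) = 0

/-- `γ_L`, the smallest positive solution of the equation above. -/
def gammaNeedle (L : ℝ) : ℝ := sInf {γ : ℝ | 0 < γ ∧ NeedleEquation L γ}

end BallNeedle

end

/-! The measure `λ_α` is a mixture, so the variance of f is α Var_Ω + (1-α) Var_Σ + α(1-α)(m_Ω -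
m_Σ)², where m_Ω and m_Σ are the two means. With x = ∫ ‖∇f‖² dλ_Ω and y = ∫ ‖∇^τ f‖² dλ_Σ, three
separate inequalities suffice: Var_Ω ≤ x/σ, Var_Σ ≤ y/γ_L and (m_Ω - m_Σ)² ≤ 3x/8 + L²(π+L)/(2π+L)
y. Collecting the coefficients of αx and of β(1-α)y produces the two entries of the maximum
(`mixed_variance_bound`).

No spectral theorem is used. Each inequality comes from a calibration: a function g of arc length or
radius such that φ - g' is a sum of squares, whence g(b) - g(a) ≤ ∫ φ. For the two spectral bounds
the multiplier in g is a logarithmic derivative of an eigenfunction, which solves a Riccati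
equation.

On Σ the calibration is applied to primitives, with multiplier s cot(st). The circle is folded at
the point opposite to the vertex: the odd part has Dirichlet ends, and the even part is a segment of
length π with a free end (`circle_bound`). When the bounds for circle and needle are added, the
vertex terms cancel by continuity and zero total integral, and the quadratic terms cancel because s
= √γ_L solves the needle equation (`cotPhase_lasso`, `IsLassoPair.poincare`).

On the disc, σ is the square of the first positive zero of J₁', and the multiplier is r v'/v with v
= J₁(√σ r). The deviation of f from its angular means is handled by Wirtinger's inequality and this
multiplier (`angular_part_bound`), the angular means themselves through their primitive
(`radial_bound`). The result holds on radii ρ < 1 and passes to ρ = 1. That σ is the smallest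
positive Neumann eigenvalue follows from the explicit eigenfunction `discMode` and, in the other
direction, from Green's formula and the same Poincaré inequality.

For the difference of means, both are compared with the mean over the circle, by testing against
explicit fields of piecewise constant divergence (`affine_test_bound`, `polar_mean_sub_mean_sq_le`).
-/

noncomputable section

namespace BallNeedle

/-! ### One-dimensional inequalities of Riccati type -/

/-- A solution `s cot (s t + d)` of the Riccati equation `q' = -s² - q²`. -/
def cotPhase (s d t : ℝ) : ℝ := s * (cos (s * t + d) / sin (s * t + d))

lemma hasDerivAt_cotPhase {s d t : ℝ} (h : sin (s * t + d) ≠ 0) :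
    HasDerivAt (cotPhase s d) (-s ^ 2 - cotPhase s d t ^ 2) t := by
  have h0 : HasDerivAt (fun t : ℝ => s * t + d) s t := by
    simpa using ((hasDerivAt_id t).const_mul s).add_const d
  have := ((h0.cos.div h0.sin h).const_mul s)
  refine this.congr_deriv ?_
  unfold cotPhase
  field_simp

lemma sin_phase_pos {s d a b t : ℝ} (hs : 0 < s) (ha : 0 < s * a + d) (hb : s * b + d < π)
    (ht : t ∈ Icc a b) : 0 < sin (s * t + d) := by
  apply sin_pos_of_pos_of_lt_pi
  · nlinarith [ht.1]
  · nlinarith [ht.2]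

lemma hasDerivAt_primitive {w : ℝ → ℝ} {a b t : ℝ} (hw : ContinuousOn w (Icc a b))
    (ht : t ∈ Ioo a b) : HasDerivAt (fun t => ∫ x in a..t, w x) (w t) t := by
  have hab : a ≤ b := (ht.1.trans ht.2).le
  apply intervalIntegral.integral_hasDerivAt_right
  · apply ContinuousOn.intervalIntegrable
    apply hw.mono
    rw [uIcc_of_le ht.1.le]
    exact Icc_subset_Icc_right ht.2.le
  · exact (hw.mono Ioo_subset_Icc_self).stronglyMeasurableAtFilter isOpen_Ioo t ht
  · exact hw.continuousAt (Icc_mem_nhds ht.1 ht.2)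

lemma continuousOn_primitive {w : ℝ → ℝ} {a b : ℝ} (hab : a ≤ b) (hw : ContinuousOn w (Icc a b)) :
    ContinuousOn (fun t => ∫ x in a..t, w x) (Icc a b) := by
  have := intervalIntegral.continuousOn_primitive_interval (μ := volume) (f := w) (a := a) (b := b)
    (by rw [uIcc_of_le hab]; exact hw.integrableOn_Icc)
  rwa [uIcc_of_le hab] at this

/-- With G the primitive of w vanishing at a, the integrand minus (q G² - 2 G w)' equals (w'/s + s
G)² + (w - q G)². Passing to G turns a free end, where w is unconstrained, into a zero of G. -/
lemma neumann_riccati {a b s : ℝ} (hs : 0 < s) (hab : a ≤ b) {w w' q : ℝ → ℝ}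
    (hw : ContinuousOn w (Icc a b)) (hw' : ∀ t ∈ Ioo a b, HasDerivAt w (w' t) t)
    (hi : IntegrableOn (fun t => w' t ^ 2) (Icc a b)) (hq : ContinuousOn q (Icc a b))
    (hq' : ∀ t ∈ Ioo a b, HasDerivAt q (-s ^ 2 - q t ^ 2) t) :
    q b * (∫ t in a..b, w t) ^ 2 - 2 * (∫ t in a..b, w t) * w b
      ≤ ∫ t in a..b, (w' t ^ 2 / s ^ 2 - w t ^ 2) := by
  set G : ℝ → ℝ := fun t => ∫ x in a..t, w x with hG
  have hGc : ContinuousOn G (Icc a b) := continuousOn_primitive hab hw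
  have key := intervalIntegral.sub_le_integral_of_hasDeriv_right_of_le hab
    (g := fun t => q t * G t ^ 2 - 2 * G t * w t)
    (g' := fun t => (-s ^ 2 - q t ^ 2) * G t ^ 2 + q t * (2 * G t * w t)
      - (2 * w t * w t + 2 * G t * w' t))
    (φ := fun t => w' t ^ 2 / s ^ 2 - w t ^ 2)
    (by fun_prop) ?_ ?_ ?_
  · simpa [hG] using key
  · intro t ht
    have h1 := hasDerivAt_primitive hw ht
    have h2 := (((hq' t ht).mul (h1.pow 2)).sub ((h1.const_mul 2).mul (hw' t ht)))
    refine (h2.congr_deriv ?_).hasDerivWithinAt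
    simp [hG]
  · exact (hi.div_const _).sub (hw.pow 2).integrableOn_Icc
  · intro t ht
    have h1 : 0 ≤ (w t - q t * G t) ^ 2 := sq_nonneg _
    have h2 : 0 ≤ (w' t / s + s * G t) ^ 2 := sq_nonneg _
    have h3 : (w' t / s + s * G t) ^ 2 = w' t ^ 2 / s ^ 2 + 2 * w' t * G t + s ^ 2 * G t ^ 2 := by
      field_simp
      ring
    nlinarith

/-- The integrand minus (q w²)' is (w' - q w)², and the Dirichlet values remove the boundary terms.
-/
lemma dirichlet_riccati {a b s : ℝ} (hab : a ≤ b) {w w' q : ℝ → ℝ}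
    (hw : ContinuousOn w (Icc a b)) (hw' : ∀ t ∈ Ioo a b, HasDerivAt w (w' t) t)
    (hi : IntegrableOn (fun t => w' t ^ 2) (Icc a b)) (hq : ContinuousOn q (Icc a b))
    (hq' : ∀ t ∈ Ioo a b, HasDerivAt q (-s ^ 2 - q t ^ 2) t) (ha : w a = 0) (hb : w b = 0) :
    0 ≤ ∫ t in a..b, (w' t ^ 2 - s ^ 2 * w t ^ 2) := by
  have key := intervalIntegral.sub_le_integral_of_hasDeriv_right_of_le hab
    (g := fun t => q t * w t ^ 2)
    (g' := fun t => (-s ^ 2 - q t ^ 2) * w t ^ 2 + q t * (2 * w t * w' t))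
    (φ := fun t => w' t ^ 2 - s ^ 2 * w t ^ 2)
    (by fun_prop) ?_ ?_ ?_
  · simpa [ha, hb] using key
  · intro t ht
    have h2 := (hq' t ht).mul ((hw' t ht).pow 2)
    refine (h2.congr_deriv ?_).hasDerivWithinAt
    simp
  · exact hi.sub ((hw.pow 2).const_smul (s ^ 2)).integrableOn_Icc
  · intro t ht
    nlinarith [sq_nonneg (w' t - q t * w t)]

/-- The bound for a segment of length `b` with a free end at `0`. -/
lemma segment_bound {b s : ℝ} (hs : 0 < s) (hb : 0 < b) (hsb : s * b < π) {w w' : ℝ → ℝ}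
    (hw : ContinuousOn w (Icc 0 b)) (hw' : ∀ t ∈ Ioo 0 b, HasDerivAt w (w' t) t)
    (hi : IntegrableOn (fun t => w' t ^ 2) (Icc 0 b)) :
    cotPhase s 0 b * (∫ t in 0..b, w t) ^ 2 - 2 * (∫ t in 0..b, w t) * w b
      ≤ ∫ t in 0..b, (w' t ^ 2 / s ^ 2 - w t ^ 2) := by
  -- The multiplier s cot(st) has a pole at the free end t = 0, so the phase is shifted by d > 0 and
  -- d then tends to 0 from the right.
  have hlim : Filter.Tendsto (fun d => cotPhase s d b * (∫ t in 0..b, w t) ^ 2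
      - 2 * (∫ t in 0..b, w t) * w b) (nhdsWithin 0 (Ioi 0))
      (nhds (cotPhase s 0 b * (∫ t in 0..b, w t) ^ 2 - 2 * (∫ t in 0..b, w t) * w b)) := by
    have hne : sin (s * b + 0) ≠ 0 := by
      rw [add_zero]
      exact (sin_pos_of_pos_of_lt_pi (mul_pos hs hb) hsb).ne'
    have hc : ContinuousAt (fun d => cotPhase s d b) 0 := by
      unfold cotPhase
      refine continuousAt_const.mul (ContinuousAt.div ?_ ?_ hne) <;> fun_prop
    exact (((hc.mul continuousAt_const).sub continuousAt_const).tendsto).mono_left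
      nhdsWithin_le_nhds
  refine le_of_tendsto hlim ?_
  have hmem : Ioo (0 : ℝ) (π - s * b) ∈ nhdsWithin (0 : ℝ) (Ioi 0) :=
    Ioo_mem_nhdsGT (by linarith)
  filter_upwards [hmem] with d hd
  have hsin : ∀ t ∈ Icc 0 b, sin (s * t + d) ≠ 0 := fun t ht =>
    (sin_phase_pos hs (by linarith [hd.1]) (by linarith [hd.2]) ht).ne'
  exact neumann_riccati hs hb.le hw hw' hi
    (fun t ht => (hasDerivAt_cotPhase (hsin t ht)).continuousAt.continuousWithinAt)
    (fun t ht => hasDerivAt_cotPhase (hsin t (Ioo_subset_Icc_self ht)))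

lemma dirichlet_bound {s : ℝ} (hs : 0 < s) (hs1 : s < 1) {w w' : ℝ → ℝ}
    (hw : ContinuousOn w (Icc 0 π)) (hw' : ∀ t ∈ Ioo 0 π, HasDerivAt w (w' t) t)
    (hi : IntegrableOn (fun t => w' t ^ 2) (Icc 0 π)) (ha : w 0 = 0) (hb : w π = 0) :
    0 ≤ ∫ t in 0..π, (w' t ^ 2 / s ^ 2 - w t ^ 2) := by
  -- The shift (1 - s)π/2 centres the range of the phase, an interval of length sπ < π, inside (0,
  -- π).
  have hsin : ∀ t ∈ Icc 0 π, sin (s * t + (1 - s) * π / 2) ≠ 0 := fun t ht =>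
    (sin_phase_pos hs (by nlinarith [pi_pos]) (by nlinarith [pi_pos]) ht).ne'
  have h := dirichlet_riccati (s := s) pi_pos.le hw hw' hi
    (fun t ht => (hasDerivAt_cotPhase (hsin t ht)).continuousAt.continuousWithinAt)
    (fun t ht => hasDerivAt_cotPhase (hsin t (Ioo_subset_Icc_self ht))) ha hb
  have e : ∀ t, w' t ^ 2 / s ^ 2 - w t ^ 2 = (1 / s ^ 2) * (w' t ^ 2 - s ^ 2 * w t ^ 2) := by
    intro t
    field_simp
  simp_rw [e]
  rw [intervalIntegral.integral_const_mul]
  positivity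

lemma integral_circle_fold {f : ℝ → ℝ} (hf : IntegrableOn f (Icc 0 (2 * π))) :
    ∫ t in 0..(2 * π), f t = ∫ t in 0..π, (f (π + t) + f (π - t)) := by
  have hp := pi_pos
  have hi : ∀ a b, 0 ≤ a → a ≤ b → b ≤ 2 * π → IntervalIntegrable f volume a b := by
    intro a b ha hab hb
    rw [intervalIntegrable_iff_integrableOn_Icc_of_le hab]
    exact hf.mono_set (Icc_subset_Icc ha hb)
  have h1 := hi 0 π le_rfl hp.le (by linarith)
  have h2 := hi π (2 * π) hp.le (by linarith) le_rfl
  rw [intervalIntegral.integral_add, ← intervalIntegral.integral_add_adjacent_intervals h1 h2,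
    intervalIntegral.integral_comp_add_left, intervalIntegral.integral_comp_sub_left]
  · rw [sub_self, sub_zero, add_zero, ← two_mul, add_comm]
  · have := h2.comp_add_left π
    simpa [two_mul] using this
  · have := (h1.comp_sub_left π).symm
    simpa using this

/-- The bound for a circle of length `2π` with a distinguished point. -/
lemma circle_bound {s : ℝ} (hs : 0 < s) (hs1 : s < 1) {w w' : ℝ → ℝ} (hm : Measurable w')
    (hw : ContinuousOn w (Icc 0 (2 * π))) (hw' : ∀ t ∈ Ioo 0 (2 * π), HasDerivAt w (w' t) t)
    (hi : IntegrableOn (fun t => w' t ^ 2) (Icc 0 (2 * π))) (hper : w 0 = w (2 * π)) :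
    cotPhase s 0 π * (∫ t in 0..(2 * π), w t) ^ 2 / 2 - 2 * (∫ t in 0..(2 * π), w t) * w 0
      ≤ ∫ t in 0..(2 * π), (w' t ^ 2 / s ^ 2 - w t ^ 2) := by
  have hp := pi_pos
  have hmp : MapsTo (fun t => π + t) (Icc 0 π) (Icc 0 (2 * π)) := fun t ht =>
    ⟨by simp only; linarith [ht.1], by simp only; linarith [ht.2]⟩
  have hmm : MapsTo (fun t => π - t) (Icc 0 π) (Icc 0 (2 * π)) := fun t ht =>
    ⟨by simp only; linarith [ht.2], by simp only; linarith [ht.1]⟩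
  have hcp : ContinuousOn (fun t => w (π + t)) (Icc 0 π) := hw.comp (by fun_prop) hmp
  have hcm : ContinuousOn (fun t => w (π - t)) (Icc 0 π) := hw.comp (by fun_prop) hmm
  have hdp : ∀ t ∈ Ioo 0 π, HasDerivAt (fun t => w (π + t)) (w' (π + t)) t := fun t ht =>
    (hw' (π + t) ⟨by linarith [ht.1], by linarith [ht.2]⟩).comp_const_add π t
  have hdm : ∀ t ∈ Ioo 0 π, HasDerivAt (fun t => w (π - t)) (-w' (π - t)) t := fun t ht =>
    (hw' (π - t) ⟨by linarith [ht.2], by linarith [ht.1]⟩).comp_const_sub π t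
  have hip : IntegrableOn (fun t => w' (π + t) ^ 2) (Icc 0 π) := by
    rw [← intervalIntegrable_iff_integrableOn_Icc_of_le hp.le]
    have h : IntervalIntegrable (fun t => w' t ^ 2) volume π (2 * π) := by
      rw [intervalIntegrable_iff_integrableOn_Icc_of_le (by linarith)]
      exact hi.mono_set (Icc_subset_Icc hp.le le_rfl)
    simpa [two_mul] using h.comp_add_left π
  have him : IntegrableOn (fun t => w' (π - t) ^ 2) (Icc 0 π) := by
    rw [← intervalIntegrable_iff_integrableOn_Icc_of_le hp.le]
    have h : IntervalIntegrable (fun t => w' t ^ 2) volume 0 π := by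
      rw [intervalIntegrable_iff_integrableOn_Icc_of_le hp.le]
      exact hi.mono_set (Icc_subset_Icc le_rfl (by linarith))
    simpa using (h.comp_sub_left π).symm
  have hie : IntegrableOn (fun t => ((w' (π + t) + -w' (π - t)) / 2) ^ 2) (Icc 0 π) := by
    refine Integrable.mono' (hip.add him) (by fun_prop) (Filter.Eventually.of_forall fun t => ?_)
    rw [Real.norm_of_nonneg (sq_nonneg _)]
    simp only [Pi.add_apply]
    nlinarith [sq_nonneg (w' (π + t) + w' (π - t)), sq_nonneg (w' (π + t) - w' (π - t))]
  have hio : IntegrableOn (fun t => ((w' (π + t) - -w' (π - t)) / 2) ^ 2) (Icc 0 π) := by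
    refine Integrable.mono' (hip.add him) (by fun_prop) (Filter.Eventually.of_forall fun t => ?_)
    rw [Real.norm_of_nonneg (sq_nonneg _)]
    simp only [Pi.add_apply]
    nlinarith [sq_nonneg (w' (π + t) + w' (π - t)), sq_nonneg (w' (π + t) - w' (π - t))]
  -- The fold is at t = π, opposite to the distinguished point t = 0. The even part has a free end
  -- at 0, takes the value w 0 at π and carries half of the integral of w; the odd part vanishes at
  -- both ends by periodicity.
  have hE := segment_bound hs hp (by nlinarith) ((hcp.add hcm).div_const 2)
    (fun t ht => ((hdp t ht).add (hdm t ht)).div_const 2) hie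
  have hO := dirichlet_bound hs hs1 ((hcp.sub hcm).div_const 2)
    (fun t ht => ((hdp t ht).sub (hdm t ht)).div_const 2) hio (by simp)
    (by simp [← two_mul, hper])
  have hce : ContinuousOn (fun t => ((w (π + t) + w (π - t)) / 2) ^ 2) (Icc 0 π) := by fun_prop
  have hco : ContinuousOn (fun t => ((w (π + t) - w (π - t)) / 2) ^ 2) (Icc 0 π) := by fun_prop
  have hint : IntegrableOn (fun t => w' t ^ 2 / s ^ 2 - w t ^ 2) (Icc 0 (2 * π)) :=
    (hi.div_const _).sub (hw.pow 2).integrableOn_Icc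
  rw [integral_circle_fold hw.integrableOn_Icc, integral_circle_fold hint]
  have e1 : ∫ t in 0..π, (w (π + t) + w (π - t)) / 2
      = (∫ t in 0..π, (w (π + t) + w (π - t))) / 2 := intervalIntegral.integral_div _ _
  have e2 : ∫ t in 0..π, (w' (π + t) ^ 2 / s ^ 2 - w (π + t) ^ 2
        + (w' (π - t) ^ 2 / s ^ 2 - w (π - t) ^ 2))
      = 2 * (∫ t in 0..π, (((w' (π + t) + -w' (π - t)) / 2) ^ 2 / s ^ 2
          - ((w (π + t) + w (π - t)) / 2) ^ 2))
        + 2 * ∫ t in 0..π, (((w' (π + t) - -w' (π - t)) / 2) ^ 2 / s ^ 2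
          - ((w (π + t) - w (π - t)) / 2) ^ 2) := by
    rw [← intervalIntegral.integral_const_mul, ← intervalIntegral.integral_const_mul,
      ← intervalIntegral.integral_add]
    · congr 1
      ext t
      ring
    · rw [intervalIntegrable_iff_integrableOn_Icc_of_le hp.le]
      exact ((hie.div_const _).sub hce.integrableOn_Icc).const_mul 2
    · rw [intervalIntegrable_iff_integrableOn_Icc_of_le hp.le]
      exact ((hio.div_const _).sub hco.integrableOn_Icc).const_mul 2
  have e3 : π + π = 2 * π := by ring
  simp only [Pi.add_apply, Pi.sub_apply, sub_self, e3, ← hper] at hE hO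
  rw [e1] at hE
  rw [e2]
  linarith

/-- Wirtinger's inequality. -/
lemma wirtinger {w w' : ℝ → ℝ} (hw : ∀ t, HasDerivAt w (w' t) t) (hc : Continuous w')
    (hper : w 0 = w (2 * π)) (h0 : ∫ t in 0..(2 * π), w t = 0) :
    ∫ t in 0..(2 * π), w t ^ 2 ≤ ∫ t in 0..(2 * π), w' t ^ 2 := by
  have hwc : Continuous w := continuous_iff_continuousAt.2 fun t => (hw t).continuousAt
  -- `circle_bound` requires s < 1. For mean zero its left side vanishes, and the constant 1 is
  -- reached as s tends to 1 from below.
  have hlim : Filter.Tendsto (fun s : ℝ => s ^ 2 * ∫ t in 0..(2 * π), w t ^ 2)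
      (nhdsWithin 1 (Iio 1)) (nhds (1 ^ 2 * ∫ t in 0..(2 * π), w t ^ 2)) := by
    refine Filter.Tendsto.mono_left ?_ nhdsWithin_le_nhds
    exact Continuous.tendsto (by fun_prop) 1
  rw [one_pow, one_mul] at hlim
  refine le_of_tendsto hlim ?_
  filter_upwards [Ioo_mem_nhdsLT (zero_lt_one' ℝ)] with s hs
  have h := circle_bound hs.1 hs.2 hc.measurable hwc.continuousOn (fun t _ => hw t)
    (hc.pow 2).continuousOn.integrableOn_Icc hper
  rw [h0, intervalIntegral.integral_sub ((Continuous.intervalIntegrable (by fun_prop)) _ _)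
    ((Continuous.intervalIntegrable (by fun_prop)) _ _), intervalIntegral.integral_div] at h
  have hs2 : 0 < s ^ 2 := pow_pos hs.1 2
  have h' : ∫ t in 0..(2 * π), w t ^ 2 ≤ (∫ t in 0..(2 * π), w' t ^ 2) / s ^ 2 := by linarith
  rw [le_div_iff₀ hs2] at h'
  linarith

/-! ### The needle equation -/

/-- The factor of the left hand side of the needle equation that carries the small zeros. -/
def lassoFunction (L s : ℝ) : ℝ := 2 * cos (s * L) * sin (s * π) + sin (s * L) * cos (s * π)

/-- By the double angle formulas the left side of the equation is 2 sin(√γ π) times `lassoFunction`.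
The first factor does not vanish for 0 < √γ < 1, so the smallest solution comes from the second. -/
lemma needleEquation_iff (L γ : ℝ) :
    NeedleEquation L γ ↔ sin (√γ * π) = 0 ∨ lassoFunction L √γ = 0 := by
  have h1 : cos (√γ * (2 * π)) = 1 - 2 * sin (√γ * π) ^ 2 := by
    rw [show √γ * (2 * π) = 2 * (√γ * π) by ring, cos_two_mul, cos_sq']
    ring
  have h2 : sin (√γ * (2 * π)) = 2 * sin (√γ * π) * cos (√γ * π) := by
    rw [show √γ * (2 * π) = 2 * (√γ * π) by ring, sin_two_mul]
  have h3 : NeedleEquation L γ ↔ (2 * sin (√γ * π)) * lassoFunction L √γ = 0 := by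
    unfold NeedleEquation lassoFunction
    rw [h1, h2]
    constructor <;> intro h <;> linarith
  rw [h3, mul_eq_zero]
  simp

lemma continuous_lassoFunction (L : ℝ) : Continuous (lassoFunction L) := by
  unfold lassoFunction
  fun_prop

lemma lassoFunction_pos {L s : ℝ} (hL : 0 < L) (hs : 0 < s) (h1 : s < 1 / 2)
    (h2 : s * L < π / 2) : 0 < lassoFunction L s := by
  have hp := pi_pos
  have hsL := mul_pos hs hL
  unfold lassoFunction
  have c1 : 0 < cos (s * L) := cos_pos_of_mem_Ioo ⟨by linarith, h2⟩
  have c2 : 0 < sin (s * π) := sin_pos_of_pos_of_lt_pi (by positivity) (by nlinarith)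
  have c3 : 0 < sin (s * L) := sin_pos_of_pos_of_lt_pi (by positivity) (by linarith)
  have c4 : 0 < cos (s * π) := cos_pos_of_mem_Ioo ⟨by nlinarith, by nlinarith⟩
  positivity

lemma exists_lassoFunction_pos {L : ℝ} (hL : 0 < L) :
    ∃ δ, 0 < δ ∧ δ < 1 / 2 ∧ δ * L < π / 2 ∧ ∀ s, 0 < s → s ≤ δ → 0 < lassoFunction L s := by
  have hp := pi_pos
  refine ⟨min (1 / 4) (π / (4 * L)), by positivity, (min_le_left _ _).trans_lt (by norm_num),
    ?_, ?_⟩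
  · have : min (1 / 4) (π / (4 * L)) * L ≤ π / (4 * L) * L :=
      mul_le_mul_of_nonneg_right (min_le_right _ _) hL.le
    have e : π / (4 * L) * L = π / 4 := by field_simp
    linarith
  · intro s hs hsd
    have h1 := hsd.trans (min_le_left _ _)
    have h2 := mul_le_mul_of_nonneg_right (hsd.trans (min_le_right _ _)) hL.le
    have e : π / (4 * L) * L = π / 4 := by field_simp
    exact lassoFunction_pos hL hs (by linarith) (by linarith)

/-- The function is positive near 0. At s = 1 (for L < π) it equals -sin L < 0, and at s = π/L (for
L > π) it equals -2 sin(π²/L) < 0. For L = π both values degenerate to 0, and s = 1/2 is a zero by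
inspection. The bounds s < 1 and sL < π keep the cotangents of the Riccati argument free of poles.
-/
lemma exists_lassoFunction_zero {L : ℝ} (hL : 0 < L) :
    ∃ s, 0 < s ∧ s < 1 ∧ s * L < π ∧ lassoFunction L s = 0 := by
  have hp := pi_pos
  obtain ⟨δ, hδ, hδ1, hδ2, hδp⟩ := exists_lassoFunction_pos hL
  have key : ∀ t, δ ≤ t → lassoFunction L t < 0 → ∃ s, 0 < s ∧ s < t ∧ lassoFunction L s = 0 := by
    intro t hδt ht
    obtain ⟨s, hs, hs0⟩ := intermediate_value_Icc' hδt (continuous_lassoFunction L).continuousOn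
      ⟨ht.le, (hδp δ hδ le_rfl).le⟩
    refine ⟨s, hδ.trans_le hs.1, lt_of_le_of_ne hs.2 ?_, hs0⟩
    rintro rfl
    exact ht.ne hs0
  rcases lt_trichotomy L π with h | h | h
  · have h1 : lassoFunction L 1 < 0 := by
      have := sin_pos_of_pos_of_lt_pi hL h
      simpa [lassoFunction] using this
    obtain ⟨s, hs, hs1, hs0⟩ := key 1 (by linarith) h1
    exact ⟨s, hs, hs1, by nlinarith, hs0⟩
  · subst h
    refine ⟨1 / 2, by norm_num, by norm_num, by linarith, ?_⟩
    have e : (1 : ℝ) / 2 * π = π / 2 := by ring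
    rw [lassoFunction, e, cos_pi_div_two]
    ring
  · have e : π / L * L = π := by field_simp
    have hπL : π / L < 1 := (div_lt_one hL).2 h
    have h1 : lassoFunction L (π / L) < 0 := by
      have : 0 < sin (π / L * π) :=
        sin_pos_of_pos_of_lt_pi (by positivity) (by nlinarith)
      unfold lassoFunction
      rw [e, cos_pi, sin_pi]
      linarith
    have hδ3 : δ ≤ π / L := by
      rw [le_div_iff₀ hL]
      linarith
    obtain ⟨s, hs, hs1, hs0⟩ := key (π / L) hδ3 h1
    refine ⟨s, hs, hs1.trans hπL, ?_, hs0⟩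
    calc s * L < π / L * L := by gcongr
      _ = π := e

lemma isLeast_gammaNeedle {L : ℝ} (hL : 0 < L) :
    IsLeast {γ : ℝ | 0 < γ ∧ NeedleEquation L γ} (gammaNeedle L) := by
  obtain ⟨δ, hδ, hδ1, -, hδp⟩ := exists_lassoFunction_pos hL
  have hp := pi_pos
  -- The equation also holds at γ = 0, so the solution set has to be kept away from 0 before it can
  -- be seen to be closed.
  have hset : {γ : ℝ | 0 < γ ∧ NeedleEquation L γ} = {γ : ℝ | δ ^ 2 ≤ γ ∧ NeedleEquation L γ} := by
    ext γ
    refine and_congr_left fun hγ => ⟨fun h => ?_, fun h => lt_of_lt_of_le (by positivity) h⟩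
    by_contra! hlt
    have h1 : √γ < δ := (sqrt_lt' hδ).2 hlt
    have h2 : 0 < √γ := sqrt_pos.2 h
    rcases (needleEquation_iff L γ).1 hγ with h0 | h0
    · exact (sin_pos_of_pos_of_lt_pi (by positivity) (by nlinarith)).ne' h0
    · exact (hδp _ h2 h1.le).ne' h0
  obtain ⟨s, hs, -, -, hs0⟩ := exists_lassoFunction_zero hL
  have hne : {γ : ℝ | 0 < γ ∧ NeedleEquation L γ}.Nonempty :=
    ⟨s ^ 2, by positivity, (needleEquation_iff L _).2 (by rw [sqrt_sq hs.le]; exact Or.inr hs0)⟩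
  have hclosed : IsClosed {γ : ℝ | 0 < γ ∧ NeedleEquation L γ} := by
    rw [hset]
    refine (isClosed_le continuous_const continuous_id).inter ?_
    exact isClosed_eq (by fun_prop) continuous_const
  have hbdd : BddBelow {γ : ℝ | 0 < γ ∧ NeedleEquation L γ} := ⟨0, fun γ h => h.1.le⟩
  exact ⟨hclosed.csInf_mem hne hbdd, fun γ h => csInf_le hbdd h⟩

lemma sqrt_gammaNeedle_spec {L : ℝ} (hL : 0 < L) :
    0 < √(gammaNeedle L) ∧ √(gammaNeedle L) < 1 ∧ √(gammaNeedle L) * L < π ∧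
      lassoFunction L √(gammaNeedle L) = 0 := by
  have hp := pi_pos
  obtain ⟨s, hs, hs1, hsL, hs0⟩ := exists_lassoFunction_zero hL
  have hleast := isLeast_gammaNeedle hL
  have h1 : gammaNeedle L ≤ s ^ 2 := hleast.2
    ⟨by positivity, (needleEquation_iff L _).2 (by rw [sqrt_sq hs.le]; exact Or.inr hs0)⟩
  have h2 : √(gammaNeedle L) ≤ s := (sqrt_le_left hs.le).2 h1
  have h3 : 0 < √(gammaNeedle L) := sqrt_pos.2 hleast.1.1
  refine ⟨h3, h2.trans_lt hs1, by nlinarith, ?_⟩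
  rcases (needleEquation_iff L _).1 hleast.1.2 with h0 | h0
  · exact absurd h0 (sin_pos_of_pos_of_lt_pi (by positivity) (by nlinarith)).ne'
  · exact h0

lemma gammaNeedle_le_one {L : ℝ} (hL : 0 < L) : gammaNeedle L ≤ 1 := by
  obtain ⟨-, h, -⟩ := sqrt_gammaNeedle_spec hL
  simpa using (sqrt_le_left zero_le_one).1 h.le

/-- For L = 2π, `lassoFunction` factors as sin(sπ)(3 cos(2πs) + 1). Since 2πs lies in (0, π),
`arccos` recovers it from its cosine. -/
lemma gammaNeedle_two_pi : gammaNeedle (2 * π) = (arccos (-1 / 3) / (2 * π)) ^ 2 := by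
  have hp := pi_pos
  obtain ⟨h0, h1, h2, h3⟩ := sqrt_gammaNeedle_spec (L := 2 * π) (by positivity)
  have hpos : 0 ≤ gammaNeedle (2 * π) := (isLeast_gammaNeedle (by positivity)).1.1.le
  set s := √(gammaNeedle (2 * π)) with hs
  have e : s * (2 * π) = 2 * (s * π) := by ring
  have hsin : 0 < sin (s * π) := sin_pos_of_pos_of_lt_pi (by positivity) (by nlinarith)
  have hcos : cos (s * (2 * π)) = -1 / 3 := by
    have h4 : sin (s * π) * (3 * cos (s * (2 * π)) + 1) = 0 := by
      rw [← h3, lassoFunction, e, sin_two_mul, cos_two_mul]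
      ring
    have := (mul_eq_zero.1 h4).resolve_left hsin.ne'
    linarith
  rw [← hcos, arccos_cos (by positivity) h2.le, mul_div_assoc, div_self (by positivity), mul_one,
    hs, sq_sqrt hpos]

/-- These bounds serve arccos(-1/3) = π/2 + arcsin(1/3). The sine is controlled at the two endpoints
by its cubic Taylor polynomial. -/
lemma arcsin_third_bounds : 0.3397 < arcsin (1 / 3) ∧ arcsin (1 / 3) < 0.3402 := by
  have hp := pi_gt_three
  constructor
  · rw [lt_arcsin_iff_sin_lt ⟨by linarith, by linarith⟩ ⟨by norm_num, by norm_num⟩]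
    have h := (abs_le.1 (sin_bound (x := 0.3397) (by norm_num [abs_of_pos]))).2
    rw [abs_of_pos (by norm_num)] at h
    norm_num at h ⊢
    linarith
  · rw [arcsin_lt_iff_lt_sin ⟨by norm_num, by norm_num⟩ ⟨by linarith, by linarith⟩]
    have h := (abs_le.1 (sin_bound (x := 0.3402) (by norm_num [abs_of_pos]))).1
    rw [abs_of_pos (by norm_num)] at h
    norm_num at h ⊢
    linarith

lemma gammaNeedle_two_pi_approx : |gammaNeedle (2 * π) - 0.0925| < 0.00005 := by
  have h1 := pi_gt_d4
  have h2 := pi_lt_d4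
  obtain ⟨h3, h4⟩ := arcsin_third_bounds
  have e : arccos (-1 / 3) = π / 2 + arcsin (1 / 3) := by
    rw [arccos, show (-1 : ℝ) / 3 = -(1 / 3) by norm_num, arcsin_neg]
    ring
  have hl : 0.30406 < arccos (-1 / 3) / (2 * π) := by
    rw [lt_div_iff₀ (by linarith), e]
    linarith
  have hu : arccos (-1 / 3) / (2 * π) < 0.3042 := by
    rw [div_lt_iff₀ (by linarith), e]
    linarith
  rw [gammaNeedle_two_pi, abs_lt]
  constructor <;> nlinarith

/-! ### The circle with a needle as a metric graph -/

/-- Multiplied by sin(sL) sin(sπ), the sum of cotangents becomes `lassoFunction` up to a constant.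
This is the exact cancellation of the quadratic terms in `needle_bound` and `circle_bound`. -/
lemma cotPhase_lasso {L s : ℝ} (h1 : 0 < s) (h2 : s < 1) (hL : 0 < L) (h3 : s * L < π)
    (h : lassoFunction L s = 0) : cotPhase s 0 L + cotPhase s 0 π / 2 = 0 := by
  have hp := pi_pos
  have c2 : sin (s * π) ≠ 0 := (sin_pos_of_pos_of_lt_pi (by positivity) (by nlinarith)).ne'
  have c3 : sin (s * L) ≠ 0 := (sin_pos_of_pos_of_lt_pi (by positivity) (by linarith)).ne'
  unfold cotPhase
  rw [add_zero, add_zero]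
  field_simp
  unfold lassoFunction at h
  linear_combination s * h

/-- A continuous function on the circle with its needle, given by its values on the two parts in
arc length, that is differentiable with square integrable derivative. -/
structure IsLassoPair (L : ℝ) (φ φ' ψ ψ' : ℝ → ℝ) : Prop where
  measurable_left : Measurable φ'
  continuousOn_left : ContinuousOn φ (Icc 0 (2 * π))
  hasDerivAt_left : ∀ t ∈ Ioo 0 (2 * π), HasDerivAt φ (φ' t) t
  integrableOn_left : IntegrableOn (fun t => φ' t ^ 2) (Icc 0 (2 * π))
  continuousOn_right : ContinuousOn ψ (Icc 0 L)
  hasDerivAt_right : ∀ t ∈ Ioo 0 L, HasDerivAt ψ (ψ' t) t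
  integrableOn_right : IntegrableOn (fun t => ψ' t ^ 2) (Icc 0 L)
  periodic : φ 0 = φ (2 * π)
  glue : φ 0 = ψ 0

/-- This is `segment_bound` run backwards, so that the free end is the tip t = L and the vertex is t
= 0. -/
lemma needle_bound {L s : ℝ} (hs : 0 < s) (hL : 0 < L) (hsL : s * L < π) {w w' : ℝ → ℝ}
    (hw : ContinuousOn w (Icc 0 L)) (hw' : ∀ t ∈ Ioo 0 L, HasDerivAt w (w' t) t)
    (hi : IntegrableOn (fun t => w' t ^ 2) (Icc 0 L)) :
    cotPhase s 0 L * (∫ t in 0..L, w t) ^ 2 - 2 * (∫ t in 0..L, w t) * w 0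
      ≤ ∫ t in 0..L, (w' t ^ 2 / s ^ 2 - w t ^ 2) := by
  have hm : MapsTo (fun t => L - t) (Icc 0 L) (Icc 0 L) := fun t ht =>
    ⟨by simp only; linarith [ht.2], by simp only; linarith [ht.1]⟩
  have h := segment_bound (w := fun t => w (L - t)) (w' := fun t => -w' (L - t)) hs hL hsL
    (hw.comp (by fun_prop) hm)
    (fun t ht => (hw' (L - t) ⟨by linarith [ht.2], by linarith [ht.1]⟩).comp_const_sub L t) (by
      rw [← intervalIntegrable_iff_integrableOn_Icc_of_le hL.le] at hi ⊢
      simpa using (hi.comp_sub_left L).symm)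
  simpa [intervalIntegral.integral_comp_sub_left (fun t => w' t ^ 2 / s ^ 2 - w t ^ 2)] using h

/-- After the common mean c is subtracted, the integrals over circle and needle are opposite
numbers. The two vertex terms then cancel by continuity at the vertex, and the two quadratic terms
by `cotPhase_lasso`. -/
lemma IsLassoPair.poincare {L : ℝ} (hL : 0 < L) {φ φ' ψ ψ' : ℝ → ℝ}
    (h : IsLassoPair L φ φ' ψ ψ') :
    (∫ t in 0..(2 * π), φ t ^ 2) + (∫ t in 0..L, ψ t ^ 2)
        - ((∫ t in 0..(2 * π), φ t) + ∫ t in 0..L, ψ t) ^ 2 / (2 * π + L)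
      ≤ 1 / gammaNeedle L * ((∫ t in 0..(2 * π), φ' t ^ 2) + ∫ t in 0..L, ψ' t ^ 2) := by
  have hp := pi_pos
  have hγ : 0 ≤ gammaNeedle L := (isLeast_gammaNeedle hL).1.1.le
  obtain ⟨h1, h2, h3, h4⟩ := sqrt_gammaNeedle_spec hL
  set s := √(gammaNeedle L) with hs
  have hs2 : s ^ 2 = gammaNeedle L := by rw [hs, sq_sqrt hγ]
  have hcot := cotPhase_lasso h1 h2 hL h3 h4
  have iφ : IntervalIntegrable φ volume 0 (2 * π) := by
    apply ContinuousOn.intervalIntegrable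
    rw [uIcc_of_le (by positivity)]
    exact h.continuousOn_left
  have iφ2 : IntervalIntegrable (fun t => φ t ^ 2) volume 0 (2 * π) := by
    apply ContinuousOn.intervalIntegrable
    rw [uIcc_of_le (by positivity)]
    exact h.continuousOn_left.pow 2
  have iψ : IntervalIntegrable ψ volume 0 L := by
    apply ContinuousOn.intervalIntegrable
    rw [uIcc_of_le (by positivity)]
    exact h.continuousOn_right
  have iψ2 : IntervalIntegrable (fun t => ψ t ^ 2) volume 0 L := by
    apply ContinuousOn.intervalIntegrable
    rw [uIcc_of_le (by positivity)]
    exact h.continuousOn_right.pow 2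
  have iφ' : IntervalIntegrable (fun t => φ' t ^ 2 / s ^ 2) volume 0 (2 * π) := by
    rw [intervalIntegrable_iff_integrableOn_Icc_of_le (by positivity)]
    exact h.integrableOn_left.div_const _
  have iψ' : IntervalIntegrable (fun t => ψ' t ^ 2 / s ^ 2) volume 0 L := by
    rw [intervalIntegrable_iff_integrableOn_Icc_of_le (by positivity)]
    exact h.integrableOn_right.div_const _
  set S := ∫ t in 0..(2 * π), φ t with hS
  set N := ∫ t in 0..L, ψ t with hN
  set c := (S + N) / (2 * π + L) with hc
  have expand : ∀ (f : ℝ → ℝ) (b : ℝ), IntervalIntegrable f volume 0 b →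
      IntervalIntegrable (fun t => f t ^ 2) volume 0 b →
      (∫ t in 0..b, (f t - c) = (∫ t in 0..b, f t) - b * c) ∧
      (IntervalIntegrable (fun t => (f t - c) ^ 2) volume 0 b) ∧
      ∫ t in 0..b, (f t - c) ^ 2
        = (∫ t in 0..b, f t ^ 2) - 2 * c * (∫ t in 0..b, f t) + b * c ^ 2 := by
    intro f b i1 i2
    have e : ∀ t, (f t - c) ^ 2 = f t ^ 2 - 2 * c * f t + c ^ 2 := fun t => by ring
    have i3 := (i2.sub (i1.const_mul (2 * c)))
    have i4 : IntervalIntegrable (fun _ => c ^ 2) volume 0 b := intervalIntegrable_const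
    refine ⟨?_, ?_, ?_⟩
    · rw [intervalIntegral.integral_sub i1 intervalIntegrable_const]
      simp
    · simp_rw [e]
      exact i3.add i4
    · simp_rw [e]
      rw [intervalIntegral.integral_add i3 i4,
        intervalIntegral.integral_sub i2 (i1.const_mul (2 * c)),
        intervalIntegral.integral_const_mul]
      simp
  obtain ⟨eφ, jφ, eφ2⟩ := expand φ (2 * π) iφ iφ2
  obtain ⟨eψ, jψ, eψ2⟩ := expand ψ L iψ iψ2
  have hC := circle_bound (w := fun t => φ t - c) h1 h2 h.measurable_left
    (h.continuousOn_left.sub continuousOn_const) (fun t ht => (h.hasDerivAt_left t ht).sub_const c)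
    h.integrableOn_left (by simp [h.periodic])
  have hNd := needle_bound (w := fun t => ψ t - c) h1 hL h3
    (h.continuousOn_right.sub continuousOn_const)
    (fun t ht => (h.hasDerivAt_right t ht).sub_const c) h.integrableOn_right
  rw [intervalIntegral.integral_sub iφ' jφ, eφ, eφ2, intervalIntegral.integral_div, ← hS, h.glue]
    at hC
  rw [intervalIntegral.integral_sub iψ' jψ, eψ, eψ2, intervalIntegral.integral_div, ← hN] at hNd
  have hsum : N - L * c = -(S - 2 * π * c) := by
    rw [hc]
    field_simp
    ring
  rw [hsum] at hNd
  have hcot' : cotPhase s 0 L * (-(S - 2 * π * c)) ^ 2 + cotPhase s 0 π * (S - 2 * π * c) ^ 2 / 2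
      = 0 := by linear_combination (S - 2 * π * c) ^ 2 * hcot
  have hfin : (S + N) ^ 2 / (2 * π + L) = 2 * c * (S + N) - (2 * π + L) * c ^ 2 := by
    rw [hc]
    field_simp
    ring
  rw [hfin, ← hs2]
  have : 1 / s ^ 2 * ((∫ t in 0..(2 * π), φ' t ^ 2) + ∫ t in 0..L, ψ' t ^ 2)
    = (∫ t in 0..(2 * π), φ' t ^ 2) / s ^ 2 + (∫ t in 0..L, ψ' t ^ 2) / s ^ 2 := by ring
  rw [this]
  linarith

/-- Pointwise 2kw' ≤ w'² + k² for the affine field k = k₀ + k₁t. Integration by parts turns the left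
side into end values and the integral of w, since k' is constant. -/
lemma affine_test_bound {b : ℝ} (hb : 0 ≤ b) (k₀ k₁ : ℝ) {w w' : ℝ → ℝ}
    (hw : ContinuousOn w (Icc 0 b)) (hw' : ∀ t ∈ Ioo 0 b, HasDerivAt w (w' t) t)
    (hi : IntegrableOn (fun t => w' t ^ 2) (Icc 0 b)) :
    2 * ((k₀ + k₁ * b) * w b - k₀ * w 0 - k₁ * ∫ t in 0..b, w t)
      ≤ (∫ t in 0..b, w' t ^ 2) + (k₀ ^ 2 * b + k₀ * k₁ * b ^ 2 + k₁ ^ 2 * b ^ 3 / 3) := by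
  have hG := continuousOn_primitive hb hw
  have hk : Continuous (fun t : ℝ => (k₀ + k₁ * t) ^ 2) := by fun_prop
  have key := intervalIntegral.sub_le_integral_of_hasDeriv_right_of_le hb
    (g := fun t => 2 * ((k₀ + k₁ * t) * w t - k₁ * ∫ x in 0..t, w x))
    (g' := fun t => 2 * (k₀ + k₁ * t) * w' t)
    (φ := fun t => w' t ^ 2 + (k₀ + k₁ * t) ^ 2)
    (by fun_prop) ?_ (hi.add hk.continuousOn.integrableOn_Icc) ?_
  · have e : ∫ t in 0..b, (k₀ + k₁ * t) ^ 2
        = k₀ ^ 2 * b + k₀ * k₁ * b ^ 2 + k₁ ^ 2 * b ^ 3 / 3 := by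
      have hd : ∀ t ∈ uIcc 0 b, HasDerivAt
          (fun t : ℝ => k₀ ^ 2 * t + k₀ * k₁ * t ^ 2 + k₁ ^ 2 * t ^ 3 / 3) ((k₀ + k₁ * t) ^ 2) t := by
        intro t _
        have := (((hasDerivAt_id t).const_mul (k₀ ^ 2)).add
          (((hasDerivAt_id t).pow 2).const_mul (k₀ * k₁))).add
          ((((hasDerivAt_id t).pow 3).const_mul (k₁ ^ 2)).div_const 3)
        refine this.congr_deriv ?_
        simp
        ring
      rw [intervalIntegral.integral_eq_sub_of_hasDerivAt hd (hk.intervalIntegrable _ _)]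
      simp
    rw [intervalIntegral.integral_add _ (hk.intervalIntegrable _ _), e] at key
    · simp only [intervalIntegral.integral_same, mul_zero, add_zero, sub_zero] at key
      linarith
    · rwa [intervalIntegrable_iff_integrableOn_Icc_of_le hb]
  · intro t ht
    have h1 : HasDerivAt (fun t : ℝ => k₀ + k₁ * t) k₁ t := by
      simpa using ((hasDerivAt_id t).const_mul k₁).const_add k₀
    have h2 := ((h1.mul (hw' t ht)).sub ((hasDerivAt_primitive hw ht).const_mul k₁)).const_mul 2
    refine (h2.congr_deriv ?_).hasDerivWithinAt
    ring
  · intro t _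
    nlinarith [sq_nonneg (w' t - (k₀ + k₁ * t))]

lemma IsLassoPair.mean_sub_mean_sq_le {L : ℝ} (hL : 0 < L) {φ φ' ψ ψ' : ℝ → ℝ}
    (h : IsLassoPair L φ φ' ψ ψ') :
    ((∫ t in 0..(2 * π), φ t) / (2 * π) - (∫ t in 0..L, ψ t) / L) ^ 2
      ≤ (π / 6 + L / 3) * ((∫ t in 0..(2 * π), φ' t ^ 2) + ∫ t in 0..L, ψ' t ^ 2) := by
  have hp := pi_pos
  set Δ := (∫ t in 0..(2 * π), φ t) / (2 * π) - (∫ t in 0..L, ψ t) / L with hΔ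
  set K := π / 6 + L / 3 with hK
  have hKp : 0 < K := by positivity
  -- The field is c(1/2 - t/(2π)) on the circle and -c(1 - t/L) on the needle. Its vertex
  -- contributions cancel, it vanishes at the tip, and its square integrates to c²K. The value c =
  -- Δ/K maximizes 2cΔ - c²K.
  set c := Δ / K with hc
  have h1 := affine_test_bound (by positivity) (c / 2) (-c / (2 * π)) h.continuousOn_left
    h.hasDerivAt_left h.integrableOn_left
  have h2 := affine_test_bound hL.le (-c) (c / L) h.continuousOn_right
    h.hasDerivAt_right h.integrableOn_right
  rw [← h.periodic, h.glue] at h1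
  have e1 : 2 * ((c / 2 + -c / (2 * π) * (2 * π)) * ψ 0 - c / 2 * ψ 0
      - -c / (2 * π) * ∫ t in 0..(2 * π), φ t)
      = 2 * (c * ((∫ t in 0..(2 * π), φ t) / (2 * π))) - 2 * c * ψ 0 := by
    field_simp
    ring
  have e2 : 2 * ((-c + c / L * L) * ψ L - -c * ψ 0 - c / L * ∫ t in 0..L, ψ t)
      = 2 * c * ψ 0 - 2 * (c * ((∫ t in 0..L, ψ t) / L)) := by
    field_simp
    ring
  have e3 : (c / 2) ^ 2 * (2 * π) + c / 2 * (-c / (2 * π)) * (2 * π) ^ 2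
      + (-c / (2 * π)) ^ 2 * (2 * π) ^ 3 / 3 = c ^ 2 * (π / 6) := by
    field_simp
    ring
  have e4 : (-c) ^ 2 * L + -c * (c / L) * L ^ 2 + (c / L) ^ 2 * L ^ 3 / 3 = c ^ 2 * (L / 3) := by
    field_simp
    ring
  rw [e1, e3] at h1
  rw [e2, e4] at h2
  have h5 : 2 * (c * Δ) ≤ ((∫ t in 0..(2 * π), φ' t ^ 2) + ∫ t in 0..L, ψ' t ^ 2) + c ^ 2 * K := by
    rw [hΔ, hK]
    linarith
  have h6 : Δ = c * K := by rw [hc]; field_simp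
  have h7 : c ^ 2 * K ≤ (∫ t in 0..(2 * π), φ' t ^ 2) + ∫ t in 0..L, ψ' t ^ 2 := by
    have : 2 * (c * Δ) = 2 * (c ^ 2 * K) := by rw [h6]; ring
    linarith
  calc Δ ^ 2 = K * (c ^ 2 * K) := by rw [h6]; ring
    _ ≤ _ := mul_le_mul_of_nonneg_left h7 hKp.le

/-! ### A Bessel function -/

/-- The coefficients are dominated by those of the exponential series. -/
def ExpBounded (c : ℕ → ℝ) : Prop := ∀ k, |c k| ≤ 1 / (k.factorial : ℝ)

/-- The function with power series coefficients `c`. -/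
def powerSum (c : ℕ → ℝ) (t : ℝ) : ℝ := ∑' k, c k * t ^ k

/-- The power series coefficients of the derivative. -/
def derivCoeff (c : ℕ → ℝ) (k : ℕ) : ℝ := (k + 1) * c (k + 1)

/-- The factorial bound is stable under formal differentiation, so the same lemmas apply to
derivatives of every order. -/
lemma ExpBounded.derivCoeff {c : ℕ → ℝ} (h : ExpBounded c) : ExpBounded (derivCoeff c) := by
  intro k
  have h1 := h (k + 1)
  rw [BallNeedle.derivCoeff, abs_mul, abs_of_nonneg (by positivity)]
  calc ((k : ℝ) + 1) * |c (k + 1)| ≤ (k + 1) * (1 / ((k + 1).factorial : ℝ)) := by gcongr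
    _ = 1 / (k.factorial : ℝ) := by
      rw [Nat.factorial_succ]
      push_cast
      field_simp

lemma ExpBounded.abs_mul_pow_le {c : ℕ → ℝ} (h : ExpBounded c) {t R : ℝ} (ht : |t| ≤ R) (k : ℕ) :
    ‖c k * t ^ k‖ ≤ R ^ k / (k.factorial : ℝ) := by
  rw [norm_mul, norm_pow, Real.norm_eq_abs, Real.norm_eq_abs]
  calc |c k| * |t| ^ k ≤ 1 / (k.factorial : ℝ) * R ^ k := by
        gcongr
        exact h k
    _ = R ^ k / (k.factorial : ℝ) := by ring

lemma ExpBounded.summable {c : ℕ → ℝ} (h : ExpBounded c) (t : ℝ) :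
    Summable fun k => c k * t ^ k :=
  Summable.of_norm_bounded (Real.summable_pow_div_factorial |t|) (h.abs_mul_pow_le le_rfl)

lemma ExpBounded.powerSum_eq {c : ℕ → ℝ} (h : ExpBounded c) (t : ℝ) :
    powerSum c t = c 0 + ∑' k, c (k + 1) * t ^ (k + 1) := by
  rw [powerSum, (h.summable t).tsum_eq_zero_add]
  simp

lemma ExpBounded.hasDerivAt {c : ℕ → ℝ} (h : ExpBounded c) (t : ℝ) :
    HasDerivAt (powerSum c) (powerSum (BallNeedle.derivCoeff c) t) t := by
  set R := |t| + 1 with hR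
  have hmem : t ∈ Ioo (-R) R := abs_lt.1 (by simp [hR])
  have h1 : HasDerivAt (fun z => ∑' k, c (k + 1) * z ^ (k + 1))
      (∑' k, BallNeedle.derivCoeff c k * t ^ k) t := by
    have hd : ∀ k : ℕ, ∀ y ∈ Ioo (-R) R, HasDerivAt (fun z : ℝ => c (k + 1) * z ^ (k + 1))
        (BallNeedle.derivCoeff c k * y ^ k) y := by
      intro k y _
      refine ((hasDerivAt_pow (k + 1) y).const_mul (c (k + 1))).congr_deriv ?_
      rw [BallNeedle.derivCoeff]
      push_cast
      ring
    have hb : ∀ k : ℕ, ∀ y ∈ Ioo (-R) R, ‖BallNeedle.derivCoeff c k * y ^ k‖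
        ≤ R ^ k / (k.factorial : ℝ) :=
      fun k y hy => h.derivCoeff.abs_mul_pow_le (abs_lt.2 hy).le k
    have hs : Summable fun k : ℕ => c (k + 1) * t ^ (k + 1) :=
      (summable_nat_add_iff 1).2 (h.summable t)
    exact hasDerivAt_tsum_of_isPreconnected
      (g := fun (k : ℕ) (z : ℝ) => c (k + 1) * z ^ (k + 1))
      (g' := fun (k : ℕ) (z : ℝ) => BallNeedle.derivCoeff c k * z ^ k)
      (Real.summable_pow_div_factorial R) isOpen_Ioo isPreconnected_Ioo hd hb hmem hs hmem
  have h2 : powerSum c = fun z => c 0 + ∑' k, c (k + 1) * z ^ (k + 1) := funext h.powerSum_eq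
  rw [h2]
  exact h1.const_add _

lemma ExpBounded.contDiff (n : ℕ) {c : ℕ → ℝ} (h : ExpBounded c) :
    ContDiff ℝ n (powerSum c) := by
  induction n generalizing c with
  | zero =>
    exact contDiff_zero.2 (continuous_iff_continuousAt.2 fun t => (h.hasDerivAt t).continuousAt)
  | succ n ih =>
    have hd : deriv (powerSum c) = powerSum (BallNeedle.derivCoeff c) :=
      funext fun t => (h.hasDerivAt t).deriv
    push_cast
    rw [contDiff_succ_iff_deriv, hd]
    exact ⟨fun t => (h.hasDerivAt t).differentiableAt, by simp, ih h.derivCoeff⟩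

/-- The coefficients of `2 J₁(√t) / √t`. -/
def besselCoeff (k : ℕ) : ℝ := (-1 / 4) ^ k / (k.factorial * (k + 1).factorial)

lemma expBounded_besselCoeff : ExpBounded besselCoeff := by
  intro k
  rw [besselCoeff, abs_div, abs_pow, abs_of_pos (a := (k.factorial * (k + 1).factorial : ℝ))
    (by positivity)]
  have h1 : |(-1 / 4 : ℝ)| ^ k ≤ 1 := pow_le_one₀ (abs_nonneg _) (by norm_num [abs_div])
  have h2 : (1 : ℝ) ≤ (k + 1).factorial := by exact_mod_cast Nat.factorial_pos _
  have h3 : (0 : ℝ) < k.factorial := by positivity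
  apply div_le_div₀ zero_le_one h1 h3
  nlinarith

lemma besselCoeff_succ (k : ℕ) :
    4 * ((k : ℝ) + 1) * (k + 2) * besselCoeff (k + 1) = -besselCoeff k := by
  rw [besselCoeff, besselCoeff, Nat.factorial_succ (k + 1), Nat.factorial_succ k]
  push_cast
  field_simp
  ring

/-- The entire function `2 J₁(√t) / √t`. -/
def bessel : ℝ → ℝ := powerSum besselCoeff

/-- The derivative of `bessel`. -/
def besselD : ℝ → ℝ := powerSum (derivCoeff besselCoeff)

/-- The second derivative of `bessel`. -/
def besselDD : ℝ → ℝ := powerSum (derivCoeff (derivCoeff besselCoeff))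

lemma hasDerivAt_bessel (t : ℝ) : HasDerivAt bessel (besselD t) t :=
  expBounded_besselCoeff.hasDerivAt t

lemma hasDerivAt_besselD (t : ℝ) : HasDerivAt besselD (besselDD t) t :=
  expBounded_besselCoeff.derivCoeff.hasDerivAt t

lemma contDiff_bessel : ContDiff ℝ 2 bessel := by
  exact_mod_cast expBounded_besselCoeff.contDiff 2

lemma bessel_zero : bessel 0 = 1 := by
  rw [bessel, expBounded_besselCoeff.powerSum_eq]
  simp [besselCoeff]

lemma bessel_ode (t : ℝ) : 4 * t * besselDD t + 8 * besselD t + bessel t = 0 := by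
  have hc := expBounded_besselCoeff
  have s0 := (summable_nat_add_iff 1).2 (hc.summable t)
  have s1 := (summable_nat_add_iff 1).2 (hc.derivCoeff.summable t)
  have s2 := hc.derivCoeff.derivCoeff.summable t
  have h0 : bessel t = _ := hc.powerSum_eq t
  have h1 : besselD t = _ := hc.derivCoeff.powerSum_eq t
  have h2 : 4 * t * besselDD t
      = ∑' k, 4 * t * (derivCoeff (derivCoeff besselCoeff) k * t ^ k) := by
    rw [tsum_mul_left]
    rfl
  have h3 : (4 * t * besselDD t + 8 * ∑' k, derivCoeff besselCoeff (k + 1) * t ^ (k + 1))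
      + ∑' k, besselCoeff (k + 1) * t ^ (k + 1) = 0 := by
    rw [h2, ← tsum_mul_left, ← (s2.mul_left _).tsum_add (s1.mul_left 8),
      ← ((s2.mul_left _).add (s1.mul_left 8)).tsum_add s0]
    rw [← tsum_zero (α := ℝ) (β := ℕ)]
    congr 1
    ext k
    have := besselCoeff_succ (k + 1)
    simp only [derivCoeff]
    push_cast at this ⊢
    linear_combination t ^ (k + 1) * this
  have h4 : 8 * derivCoeff besselCoeff 0 + besselCoeff 0 = 0 := by
    have := besselCoeff_succ 0
    simp only [derivCoeff]
    push_cast at this ⊢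
    linear_combination this
  rw [h0, h1]
  linear_combination h3 + h4

/-! ### The first positive zero of J₁'. -/

/-- The function `2 J₁'(√t)`. -/
def besselPsi (t : ℝ) : ℝ := bessel t + 2 * t * besselD t

lemma hasDerivAt_besselPsi (t : ℝ) : HasDerivAt besselPsi (-besselD t - bessel t / 2) t := by
  have := (hasDerivAt_bessel t).add (((hasDerivAt_id t).const_mul 2).mul (hasDerivAt_besselD t))
  refine this.congr_deriv ?_
  simp only [id]
  linear_combination bessel_ode t / 2

lemma continuous_besselPsi : Continuous besselPsi :=
  continuous_iff_continuousAt.2 fun t => (hasDerivAt_besselPsi t).continuousAt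

lemma continuous_bessel : Continuous bessel :=
  continuous_iff_continuousAt.2 fun t => (hasDerivAt_bessel t).continuousAt

lemma besselPsi_zero : besselPsi 0 = 1 := by simp [besselPsi, bessel_zero]

/-- Here r Φ(r²) = 2 J₁(r), with Φ = `bessel`, so the derivative is 2 J₁'(r). -/
lemma hasDerivAt_mul_bessel_sq (r : ℝ) :
    HasDerivAt (fun r => r * bessel (r ^ 2)) (besselPsi (r ^ 2)) r := by
  have h1 : HasDerivAt (fun r : ℝ => r ^ 2) (2 * r) r := by simpa using hasDerivAt_pow 2 r
  have h2 := (hasDerivAt_id r).mul ((hasDerivAt_bessel (r ^ 2)).comp r h1)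
  refine h2.congr_deriv ?_
  simp only [besselPsi, id, Function.comp]
  ring

/-- This is Bessel's equation in the form (r J₁')' = (1/r - r) J₁. -/
lemma hasDerivAt_mul_besselPsi_sq (r : ℝ) :
    HasDerivAt (fun r => r * besselPsi (r ^ 2)) ((1 - r ^ 2) * bessel (r ^ 2)) r := by
  have h1 : HasDerivAt (fun r : ℝ => r ^ 2) (2 * r) r := by simpa using hasDerivAt_pow 2 r
  have h2 := (hasDerivAt_id r).mul ((hasDerivAt_besselPsi (r ^ 2)).comp r h1)
  refine h2.congr_deriv ?_
  simp only [besselPsi, id, Function.comp]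
  ring

lemma bessel_pos_of_besselPsi_pos {T : ℝ} (h : ∀ t ∈ Ico 0 T, 0 < besselPsi t) {t : ℝ}
    (ht : t ∈ Icc 0 T) : 0 < bessel t := by
  rcases ht.1.eq_or_lt with h0 | h0
  · rw [← h0, bessel_zero]
    exact zero_lt_one
  have hr : 0 < √t := sqrt_pos.2 h0
  have hmono : StrictMonoOn (fun r => r * bessel (r ^ 2)) (Icc 0 √t) := by
    refine strictMonoOn_of_deriv_pos (convex_Icc _ _)
      (fun r _ => (hasDerivAt_mul_bessel_sq r).continuousAt.continuousWithinAt) fun r hr' => ?_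
    rw [interior_Icc] at hr'
    rw [(hasDerivAt_mul_bessel_sq r).deriv]
    refine h _ ⟨sq_nonneg r, ?_⟩
    calc r ^ 2 < √t ^ 2 := by
          have := hr'.1
          gcongr
          exact hr'.2
      _ = t := sq_sqrt h0.le
      _ ≤ T := ht.2
  have := hmono ⟨le_rfl, hr.le⟩ ⟨hr.le, le_rfl⟩ hr
  simp only [zero_mul, sq_sqrt h0.le] at this
  exact pos_of_mul_pos_right this hr.le

/-- If J₁' stayed positive, J₁ would be positive and increasing. Then (r J₁')' = (1/r - r) J₁ would
stay below a negative constant for r ≥ 2, which drives r J₁' to 0 at a finite radius. -/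
lemma exists_besselPsi_nonpos : ∃ t, 0 ≤ t ∧ besselPsi t ≤ 0 := by
  by_contra! hcon
  have hpos : ∀ t, 0 ≤ t → 0 < bessel t := fun t ht =>
    bessel_pos_of_besselPsi_pos (T := t) (fun s hs => hcon s hs.1) ⟨ht, le_rfl⟩
  have hmono : MonotoneOn (fun r => r * bessel (r ^ 2)) (Ici 0) := by
    refine monotoneOn_of_deriv_nonneg (convex_Ici _)
      (fun r _ => (hasDerivAt_mul_bessel_sq r).continuousAt.continuousWithinAt)
      (fun r _ => (hasDerivAt_mul_bessel_sq r).differentiableAt.differentiableWithinAt)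
      fun r _ => ?_
    rw [(hasDerivAt_mul_bessel_sq r).deriv]
    exact (hcon _ (sq_nonneg r)).le
  set v := 2 * bessel (2 ^ 2) with hv
  have hvpos : 0 < v := mul_pos two_pos (hpos _ (by norm_num))
  -- For r ≥ 2 one has r² - 1 ≥ r, hence (r² - 1)Φ(r²) ≥ rΦ(r²) ≥ v. A function starting at w and
  -- falling at rate at least v is no longer positive at 2 + w/v.
  have hanti : AntitoneOn (fun r => r * besselPsi (r ^ 2) + v * r) (Ici 2) := by
    have hd : ∀ r, HasDerivAt (fun r => r * besselPsi (r ^ 2) + v * r)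
        ((1 - r ^ 2) * bessel (r ^ 2) + v) r := fun r => by
      refine ((hasDerivAt_mul_besselPsi_sq r).add ((hasDerivAt_id r).const_mul v)).congr_deriv ?_
      rw [mul_one]
    refine antitoneOn_of_deriv_nonpos (convex_Ici _)
      (fun r _ => (hd r).continuousAt.continuousWithinAt)
      (fun r _ => (hd r).differentiableAt.differentiableWithinAt) fun r hr => ?_
    rw [interior_Ici, mem_Ioi] at hr
    rw [(hd r).deriv]
    have h1 : v ≤ r * bessel (r ^ 2) :=
      hmono (mem_Ici.2 zero_le_two) (mem_Ici.2 (by linarith)) hr.le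
    have h2 := hpos _ (sq_nonneg r)
    nlinarith
  set w := 2 * besselPsi (2 ^ 2) with hw
  have hwpos : 0 < w := mul_pos two_pos (hcon _ (by norm_num))
  have hr : 2 ≤ 2 + w / v := by
    have : 0 < w / v := by positivity
    linarith
  have h1 := hanti (mem_Ici.2 le_rfl) (mem_Ici.2 hr) hr
  have h2 := hcon ((2 + w / v) ^ 2) (sq_nonneg _)
  have h3 : v * (2 + w / v) = v * 2 + w := by field_simp
  simp only [h3, ← hw] at h1
  have h4 : 0 < (2 + w / v) * besselPsi ((2 + w / v) ^ 2) := mul_pos (by linarith) h2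
  linarith

lemma exists_besselPsi_first_zero :
    ∃ σ, 0 < σ ∧ besselPsi σ = 0 ∧ (∀ t ∈ Icc 0 σ, 0 ≤ besselPsi t) ∧
      ∀ t ∈ Icc 0 σ, 0 < bessel t := by
  set Z : Set ℝ := {t | 0 ≤ t ∧ besselPsi t ≤ 0} with hZ
  have hclosed : IsClosed Z :=
    (isClosed_le continuous_const continuous_id).inter
      (isClosed_le continuous_besselPsi continuous_const)
  have hbdd : BddBelow Z := ⟨0, fun t ht => ht.1⟩
  have hmem : sInf Z ∈ Z := hclosed.csInf_mem exists_besselPsi_nonpos hbdd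
  have hlt : ∀ t ∈ Ico 0 (sInf Z), 0 < besselPsi t := by
    intro t ht
    by_contra! h
    exact (csInf_le hbdd ⟨ht.1, h⟩).not_gt ht.2
  have hpos : 0 < sInf Z := by
    refine lt_of_le_of_ne hmem.1 fun h => ?_
    have := hmem.2
    rw [← h, besselPsi_zero] at this
    linarith
  have hzero : besselPsi (sInf Z) = 0 := by
    refine le_antisymm hmem.2 ?_
    have hcl : sInf Z ∈ closure (Ico 0 (sInf Z)) := by
      rw [closure_Ico hpos.ne]
      exact ⟨hpos.le, le_rfl⟩
    exact closure_minimal (fun t ht => (hlt t ht).le)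
      (isClosed_le continuous_const continuous_besselPsi) hcl
  refine ⟨sInf Z, hpos, hzero, fun t ht => ?_, fun t ht => bessel_pos_of_besselPsi_pos hlt ht⟩
  rcases ht.2.eq_or_lt with h | h
  · rw [h, hzero]
  · exact (hlt t ⟨ht.1, h⟩).le

/-- The square of the first positive zero of `J₁'`. -/
def sigmaBessel : ℝ := exists_besselPsi_first_zero.choose

lemma sigmaBessel_pos : 0 < sigmaBessel := exists_besselPsi_first_zero.choose_spec.1

lemma besselPsi_sigmaBessel : besselPsi sigmaBessel = 0 :=
  exists_besselPsi_first_zero.choose_spec.2.1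

lemma besselPsi_nonneg {t : ℝ} (ht : t ∈ Icc 0 sigmaBessel) : 0 ≤ besselPsi t :=
  exists_besselPsi_first_zero.choose_spec.2.2.1 t ht

lemma bessel_pos {t : ℝ} (ht : t ∈ Icc 0 sigmaBessel) : 0 < bessel t :=
  exists_besselPsi_first_zero.choose_spec.2.2.2 t ht

lemma sigmaBessel_mul_sq_mem {r : ℝ} (hr : r ∈ Icc 0 1) :
    sigmaBessel * r ^ 2 ∈ Icc 0 sigmaBessel := by
  have h := sigmaBessel_pos
  have h1 : r ^ 2 ≤ 1 := pow_le_one₀ hr.1 hr.2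
  exact ⟨by positivity, by nlinarith⟩

/-- The function `r v' / v` for `v(r) = J₁(√σ r)`. -/
def besselRatio (r : ℝ) : ℝ := besselPsi (sigmaBessel * r ^ 2) / bessel (sigmaBessel * r ^ 2)

lemma besselRatio_nonneg {r : ℝ} (hr : r ∈ Icc 0 1) : 0 ≤ besselRatio r :=
  div_nonneg (besselPsi_nonneg (sigmaBessel_mul_sq_mem hr))
    (bessel_pos (sigmaBessel_mul_sq_mem hr)).le

lemma continuousOn_besselRatio : ContinuousOn besselRatio (Icc 0 1) := by
  refine ContinuousOn.div ?_ ?_ fun r hr => (bessel_pos (sigmaBessel_mul_sq_mem hr)).ne'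
  · exact (continuous_besselPsi.comp (by fun_prop)).continuousOn
  · exact (continuous_bessel.comp (by fun_prop)).continuousOn

/-- Bessel's equation of order one in Riccati form. The quotient is regular on the whole unit
interval because J₁(√σ r) has no zero in (0, 1]. -/
lemma hasDerivAt_besselRatio {r : ℝ} (hr : r ∈ Ioc 0 1) :
    HasDerivAt besselRatio ((1 - sigmaBessel * r ^ 2 - besselRatio r ^ 2) / r) r := by
  have h0 := (bessel_pos (sigmaBessel_mul_sq_mem (Ioc_subset_Icc_self hr))).ne'
  have hr0 := hr.1.ne'
  have h1 : HasDerivAt (fun r : ℝ => sigmaBessel * r ^ 2) (sigmaBessel * (2 * r)) r := by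
    simpa using (hasDerivAt_pow 2 r).const_mul sigmaBessel
  have h2 := ((hasDerivAt_besselPsi _).comp r h1).div ((hasDerivAt_bessel _).comp r h1) h0
  refine h2.congr_deriv ?_
  have h3 : besselPsi (sigmaBessel * r ^ 2) = bessel (sigmaBessel * r ^ 2)
    + 2 * (sigmaBessel * r ^ 2) * besselD (sigmaBessel * r ^ 2) := rfl
  simp only [besselRatio, Function.comp, h3]
  field_simp
  ring

/-! ### The first eigenfunction of the disc -/

/-- The function `x₀ Φ(σ |x|²)`, a multiple of `J₁(√σ r) cos θ`. -/
def discMode (x : Plane) : ℝ := x 0 * bessel (sigmaBessel * ‖x‖ ^ 2)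

/-- The derivative of `discMode` at `x` in the direction `v`. -/
def discModeD (v x : Plane) : ℝ :=
  v 0 * bessel (sigmaBessel * ‖x‖ ^ 2)
    + 2 * sigmaBessel * x 0 * besselD (sigmaBessel * ‖x‖ ^ 2) * inner ℝ x v

lemma hasDerivAt_line_radial {g : ℝ → ℝ} {g' : ℝ} (c : ℝ) (x v : Plane)
    (hg : HasDerivAt g g' (c * ‖x‖ ^ 2)) :
    HasDerivAt (fun s : ℝ => g (c * ‖x + s • v‖ ^ 2)) (2 * c * g' * inner ℝ x v) 0 := by
  have h0 : HasDerivAt (fun s : ℝ => x + s • v) v 0 := by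
    simpa using ((hasDerivAt_id (0 : ℝ)).smul_const v).const_add x
  have h1 := (h0.norm_sq.const_mul c)
  have h2 := HasDerivAt.comp (0 : ℝ) (h₂ := g) (h₂' := g') (by simpa using hg) h1
  refine h2.congr_deriv ?_
  simp
  ring

lemma hasDerivAt_line_coord (x v : Plane) (i : Fin 2) :
    HasDerivAt (fun s : ℝ => (x + s • v) i) (v i) 0 := by
  have := ((hasDerivAt_id (0 : ℝ)).mul_const (v i)).const_add (x i)
  simpa using this

lemma hasDerivAt_line_inner (x v : Plane) :
    HasDerivAt (fun s : ℝ => inner ℝ (x + s • v) v) (‖v‖ ^ 2) 0 := by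
  have := ((hasDerivAt_id (0 : ℝ)).mul_const (‖v‖ ^ 2)).const_add (inner ℝ x v)
  simpa [inner_add_left, inner_smul_left] using this

lemma contDiff_discMode : ContDiff ℝ 2 discMode := by
  unfold discMode
  refine ContDiff.mul ?_ (contDiff_bessel.comp (contDiff_const.mul (contDiff_norm_sq ℝ)))
  exact (EuclideanSpace.proj (𝕜 := ℝ) (0 : Fin 2)).contDiff

lemma fderiv_discMode (x v : Plane) : fderiv ℝ discMode x v = discModeD v x := by
  have hd : DifferentiableAt ℝ discMode x := contDiff_discMode.differentiable (by simp) x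
  have h1 := (hd.hasFDerivAt.hasLineDerivAt v)
  have h2 : HasLineDerivAt ℝ discMode (discModeD v x) x v := by
    unfold HasLineDerivAt discMode
    have := (hasDerivAt_line_coord x v 0).mul
      (hasDerivAt_line_radial sigmaBessel x v (hasDerivAt_bessel _))
    refine this.congr_deriv ?_
    simp [discModeD]
    ring
  exact h1.unique h2

lemma laplacian_eq_sum_fderiv {u : Plane → ℝ} (b : OrthonormalBasis (Fin 2) ℝ Plane) (x : Plane) :
    Laplacian.laplacian u x = fderiv ℝ (fderiv ℝ u) x (b 0) (b 0)
      + fderiv ℝ (fderiv ℝ u) x (b 1) (b 1) := by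
  rw [InnerProductSpace.laplacian_eq_iteratedFDeriv_orthonormalBasis u b]
  simp [iteratedFDeriv_two_apply]

lemma fderiv_fderiv_discMode (x v : Plane) :
    fderiv ℝ (fderiv ℝ discMode) x v v
      = 4 * sigmaBessel * v 0 * besselD (sigmaBessel * ‖x‖ ^ 2) * inner ℝ x v
        + 4 * sigmaBessel ^ 2 * x 0 * besselDD (sigmaBessel * ‖x‖ ^ 2) * inner ℝ x v ^ 2
        + 2 * sigmaBessel * x 0 * besselD (sigmaBessel * ‖x‖ ^ 2) * ‖v‖ ^ 2 := by
  have hd : DifferentiableAt ℝ (fderiv ℝ discMode) x :=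
    (contDiff_discMode.fderiv_right (m := 1) (by norm_num)).differentiable (by simp) x
  have h1 := (hd.hasFDerivAt.hasLineDerivAt v)
  have h3 : HasDerivAt (fun s : ℝ => fderiv ℝ discMode (x + s • v) v)
      (fderiv ℝ (fderiv ℝ discMode) x v v) 0 := by
    simpa using HasDerivAt.clm_apply h1 (hasDerivAt_const (0 : ℝ) v)
  have h2 : HasDerivAt (fun s : ℝ => discModeD v (x + s • v)) _ 0 :=
    ((hasDerivAt_line_radial sigmaBessel x v (hasDerivAt_bessel _)).const_mul (v 0)).add
      ((((hasDerivAt_line_coord x v 0).const_mul (2 * sigmaBessel)).mul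
        (hasDerivAt_line_radial sigmaBessel x v (hasDerivAt_besselD _))).mul
        (hasDerivAt_line_inner x v))
  simp_rw [fderiv_discMode] at h3
  rw [h3.unique h2]
  simp
  ring

/-- The eigenfunction is `discMode`. The ODE for `bessel` gives the equation in the disc, and on the
unit circle the normal derivative is `x 0 * besselPsi sigmaBessel`, which is 0. -/
lemma isNeumannEigenvalue_sigmaBessel : IsNeumannEigenvalue sigmaBessel := by
  refine ⟨discMode, contDiff_discMode.contDiffOn, ⟨!₂[1 / 2, 0], ?_, ?_⟩, fun x _ => ?_,
    fun x hx => ?_⟩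
  · simp [disc, EuclideanSpace.norm_eq]
    norm_num
  · have h := bessel_pos (sigmaBessel_mul_sq_mem (r := 1 / 2) ⟨by norm_num, by norm_num⟩)
    have e : ‖(!₂[1 / 2, 0] : Plane)‖ ^ 2 = (1 / 2) ^ 2 := by
      simp [EuclideanSpace.norm_sq_eq]
    rw [discMode, e]
    simpa using h.ne'
  · rw [laplacian_eq_sum_fderiv (EuclideanSpace.basisFun (Fin 2) ℝ), fderiv_fderiv_discMode,
      fderiv_fderiv_discMode]
    have h := bessel_ode (sigmaBessel * ‖x‖ ^ 2)
    have e : ‖x‖ ^ 2 = x 0 ^ 2 + x 1 ^ 2 := by simp [EuclideanSpace.norm_sq_eq, Fin.sum_univ_two]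
    simp [discMode, PiLp.inner_apply] at h ⊢
    linear_combination (sigmaBessel * x 0) * h
      - (4 * sigmaBessel ^ 2 * x 0 * besselDD (sigmaBessel * ‖x‖ ^ 2)) * e
  · have hx1 : ‖x‖ = 1 := by simpa [circle] using hx
    have hu : UniqueDiffWithinAt ℝ closedDisc x :=
      (uniqueDiffOn_convex (convex_closedBall _ _) (by
        rw [interior_closedBall _ one_ne_zero]
        exact ⟨0, by simp⟩)) x (by simp [hx1])
    rw [fderivWithin_eq_fderiv hu (contDiff_discMode.differentiable (by simp) x),
      fderiv_discMode, discModeD, real_inner_self_eq_norm_sq, hx1]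
    have := besselPsi_sigmaBessel
    rw [besselPsi] at this
    simp only [one_pow, mul_one]
    linear_combination x 0 * this

/-! ### Polar coordinates -/

/-- The unit vector with angle `θ`. -/
def polarDir (θ : ℝ) : Plane := !₂[cos θ, sin θ]

/-- The unit vector with angle `θ + π / 2`. -/
def polarTan (θ : ℝ) : Plane := !₂[-sin θ, cos θ]

lemma polarDir_eq (θ : ℝ) :
    polarDir θ = cos θ • (!₂[1, 0] : Plane) + sin θ • (!₂[0, 1] : Plane) := by
  ext i
  fin_cases i <;> simp [polarDir]

lemma polarTan_eq (θ : ℝ) :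
    polarTan θ = -sin θ • (!₂[1, 0] : Plane) + cos θ • (!₂[0, 1] : Plane) := by
  ext i
  fin_cases i <;> simp [polarTan]

lemma hasDerivAt_polarDir (θ : ℝ) : HasDerivAt polarDir (polarTan θ) θ := by
  rw [funext polarDir_eq, polarTan_eq]
  exact ((hasDerivAt_cos θ).smul_const _).add ((hasDerivAt_sin θ).smul_const _)

lemma hasDerivAt_polarTan (θ : ℝ) : HasDerivAt polarTan (-polarDir θ) θ := by
  rw [funext polarTan_eq, polarDir_eq]
  refine (((hasDerivAt_sin θ).neg.smul_const _).add
    ((hasDerivAt_cos θ).smul_const _)).congr_deriv ?_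
  module

lemma contDiff_polarDir : ContDiff ℝ 1 polarDir := by
  rw [funext polarDir_eq]
  fun_prop

lemma continuous_polarDir : Continuous polarDir := contDiff_polarDir.continuous

lemma continuous_polarTan : Continuous polarTan :=
  continuous_iff_continuousAt.2 fun t => (hasDerivAt_polarTan t).continuousAt

lemma norm_polarDir (θ : ℝ) : ‖polarDir θ‖ = 1 := by
  simp [polarDir, EuclideanSpace.norm_eq]

lemma norm_polarTan (θ : ℝ) : ‖polarTan θ‖ = 1 := by
  simp [polarTan, EuclideanSpace.norm_eq]

lemma inner_polarDir_polarTan (θ : ℝ) : inner ℝ (polarDir θ) (polarTan θ) = 0 := by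
  simp [polarDir, polarTan, PiLp.inner_apply]
  ring

lemma polarDir_zero_eq : polarDir 0 = polarDir (2 * π) := by simp [polarDir]

lemma polarTan_zero_eq : polarTan 0 = polarTan (2 * π) := by simp [polarTan]

lemma smul_polarDir_mem_disc {r : ℝ} (hr : r ∈ Ioo (-1) 1) (θ : ℝ) : r • polarDir θ ∈ disc := by
  rw [disc, mem_ball_zero_iff, norm_smul, norm_polarDir, mul_one]
  exact abs_lt.2 hr

lemma smul_polarDir_mem_closedDisc {r : ℝ} (hr : r ∈ Icc 0 1) (θ : ℝ) :
    r • polarDir θ ∈ closedDisc := by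
  rw [closedDisc, mem_closedBall_zero_iff, norm_smul, norm_polarDir, mul_one]
  exact abs_le.2 ⟨by linarith [hr.1], hr.2⟩

lemma orthonormal_polar (θ : ℝ) : Orthonormal ℝ ![polarDir θ, polarTan θ] := by
  refine orthonormal_vecCons_iff.2 ⟨norm_polarDir θ, fun i => ?_, ?_⟩
  · fin_cases i
    exact inner_polarDir_polarTan θ
  · exact orthonormal_vecCons_iff.2 ⟨norm_polarTan θ, fun i => i.elim0,
      ⟨fun i => i.elim0, fun i => i.elim0⟩⟩

/-- The orthonormal basis of the radial and the angular direction. -/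
def polarBasis (θ : ℝ) : OrthonormalBasis (Fin 2) ℝ Plane :=
  (basisOfOrthonormalOfCardEqFinrank (orthonormal_polar θ) (by simp)).toOrthonormalBasis (by
    rw [coe_basisOfOrthonormalOfCardEqFinrank]
    exact orthonormal_polar θ)

lemma polarBasis_zero (θ : ℝ) : polarBasis θ 0 = polarDir θ := by simp [polarBasis]

lemma polarBasis_one (θ : ℝ) : polarBasis θ 1 = polarTan θ := by simp [polarBasis]

/-! ### Integrals with a parameter -/

lemma continuousOn_parametric {K : ℝ → ℝ → ℝ} {S : Set ℝ}
    (hK : ContinuousOn (Function.uncurry K) (S ×ˢ univ)) (b : ℝ) :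
    ContinuousOn (fun r => ∫ θ in 0..b, K r θ) S := by
  rw [continuousOn_iff_continuous_domRestrict]
  have : Continuous (Function.uncurry fun (r : S) θ => K r θ) := by
    have h : Continuous fun p : S × ℝ => ((p.1 : ℝ), p.2) := by fun_prop
    exact hK.comp_continuous h fun p => ⟨p.1.2, mem_univ _⟩
  exact intervalIntegral.continuous_parametric_intervalIntegral_of_continuous this
    continuous_const

lemma continuous_slice {K : ℝ → ℝ → ℝ} {S : Set ℝ}
    (hK : ContinuousOn (Function.uncurry K) (S ×ˢ univ)) {r : ℝ} (hr : r ∈ S) :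
    Continuous (K r) :=
  hK.comp_continuous (f := fun θ : ℝ => (r, θ)) (by fun_prop) fun θ => ⟨hr, mem_univ _⟩

lemma hasDerivAt_parametric {K K' : ℝ → ℝ → ℝ} {a b : ℝ}
    (hK : ∀ r ∈ Ioo a b, ∀ θ, HasDerivAt (fun r => K r θ) (K' r θ) r)
    (hKc : ContinuousOn (Function.uncurry K) (Ioo a b ×ˢ univ))
    (hK'c : ContinuousOn (Function.uncurry K') (Ioo a b ×ˢ univ)) (T : ℝ) {r : ℝ}
    (hr : r ∈ Ioo a b) :
    HasDerivAt (fun r => ∫ θ in 0..T, K r θ) (∫ θ in 0..T, K' r θ) r := by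
  obtain ⟨ε, hε, hball⟩ := Metric.isOpen_iff.1 isOpen_Ioo r hr
  have hcb : Metric.closedBall r (ε / 2) ⊆ Ioo a b :=
    (Metric.closedBall_subset_ball (by linarith)).trans hball
  have hcompact : IsCompact (Metric.closedBall r (ε / 2) ×ˢ uIcc 0 T) :=
    (isCompact_closedBall _ _).prod isCompact_uIcc
  obtain ⟨C, hC⟩ := hcompact.exists_bound_of_continuousOn
    (hK'c.mono (prod_mono hcb (subset_univ _)))
  have hnhds : Metric.closedBall r (ε / 2) ∈ nhds r := Metric.closedBall_mem_nhds _ (by linarith)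
  refine (intervalIntegral.hasDerivAt_integral_of_dominated_loc_of_deriv_le (F := K) (F' := K')
    (bound := fun _ => C) hnhds ?_ ((continuous_slice hKc hr).intervalIntegrable _ _)
    (continuous_slice hK'c hr).aestronglyMeasurable ?_ intervalIntegrable_const ?_).2
  · filter_upwards [isOpen_Ioo.mem_nhds hr] with x hx
    exact (continuous_slice hKc hx).aestronglyMeasurable
  · exact Filter.Eventually.of_forall fun θ hθ x hx => hC (x, θ) ⟨hx, uIoc_subset_uIcc hθ⟩
  · exact Filter.Eventually.of_forall fun θ _ x hx => hK x (hcb hx) θ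

lemma hasDerivAt_primitive_zero {k : ℝ → ℝ} (hk : ContinuousOn k (Ioo (-1) 1)) {r : ℝ}
    (hr : r ∈ Ioo (-1) 1) : HasDerivAt (fun r => ∫ x in 0..r, k x) (k r) r := by
  apply intervalIntegral.integral_hasDerivAt_right
  · apply ContinuousOn.intervalIntegrable
    refine hk.mono fun x hx => ?_
    rw [uIcc_eq_union] at hx
    rcases hx with hx | hx
    · exact ⟨by linarith [hx.1], hx.2.trans_lt hr.2⟩
    · exact ⟨hr.1.trans_le hx.1, by linarith [hx.2]⟩
  · exact hk.stronglyMeasurableAtFilter isOpen_Ioo r hr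
  · exact hk.continuousAt (Ioo_mem_nhds hr.1 hr.2)

/-! ### Functions on the disc in polar coordinates -/

/-- The function `f` in polar coordinates. -/
def polarVal (f : Plane → ℝ) (r θ : ℝ) : ℝ := f (r • polarDir θ)

/-- The radial derivative of `f` in polar coordinates. -/
def polarRad (f : Plane → ℝ) (r θ : ℝ) : ℝ := fderiv ℝ f (r • polarDir θ) (polarDir θ)

/-- The angular derivative of `f` in polar coordinates. -/
def polarAng (f : Plane → ℝ) (r θ : ℝ) : ℝ := fderiv ℝ f (r • polarDir θ) (polarTan θ)

lemma isOpen_disc : IsOpen disc := Metric.isOpen_ball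

lemma continuous_polar : Continuous fun p : ℝ × ℝ => p.1 • polarDir p.2 := by
  have := continuous_polarDir
  fun_prop

lemma mapsTo_polar : MapsTo (fun p : ℝ × ℝ => p.1 • polarDir p.2) (Ioo (-1) 1 ×ˢ univ) disc :=
  fun p hp => smul_polarDir_mem_disc hp.1 p.2

lemma mapsTo_polar_closed :
    MapsTo (fun p : ℝ × ℝ => p.1 • polarDir p.2) (Icc 0 1 ×ˢ univ) closedDisc :=
  fun p hp => smul_polarDir_mem_closedDisc hp.1 p.2

lemma hasFDerivAt_of_mem_disc {f : Plane → ℝ} (hf : ContDiffOn ℝ 1 f disc) {x : Plane}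
    (hx : x ∈ disc) : HasFDerivAt f (fderiv ℝ f x) x :=
  ((hf.differentiableOn (by simp)).differentiableAt (isOpen_disc.mem_nhds hx)).hasFDerivAt

/-- Negative radii are admitted so that r = 0 is an interior point and no one-sided derivative
occurs at the centre. -/
lemma hasDerivAt_polarVal_rad {f : Plane → ℝ} (hf : ContDiffOn ℝ 1 f disc) {r : ℝ}
    (hr : r ∈ Ioo (-1) 1) (θ : ℝ) :
    HasDerivAt (fun r => polarVal f r θ) (polarRad f r θ) r := by
  have h1 : HasDerivAt (fun r : ℝ => r • polarDir θ) (polarDir θ) r := by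
    simpa using (hasDerivAt_id r).smul_const (polarDir θ)
  exact (hasFDerivAt_of_mem_disc hf (smul_polarDir_mem_disc hr θ)).comp_hasDerivAt r h1

lemma hasDerivAt_polarVal_ang {f : Plane → ℝ} (hf : ContDiffOn ℝ 1 f disc) {r : ℝ}
    (hr : r ∈ Ioo (-1) 1) (θ : ℝ) :
    HasDerivAt (polarVal f r) (r * polarAng f r θ) θ := by
  have h1 := (hasDerivAt_polarDir θ).const_smul r
  refine ((hasFDerivAt_of_mem_disc hf (smul_polarDir_mem_disc hr θ)).comp_hasDerivAt θ
    h1).congr_deriv ?_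
  simp [polarAng]

lemma continuousOn_polarVal {f : Plane → ℝ} (hf : ContinuousOn f disc) :
    ContinuousOn (Function.uncurry (polarVal f)) (Ioo (-1) 1 ×ˢ univ) :=
  hf.comp continuous_polar.continuousOn mapsTo_polar

lemma continuousOn_polarVal_closed {f : Plane → ℝ} (hf : ContinuousOn f closedDisc) :
    ContinuousOn (Function.uncurry (polarVal f)) (Icc 0 1 ×ˢ univ) :=
  hf.comp continuous_polar.continuousOn mapsTo_polar_closed

lemma continuousOn_polarRad {f : Plane → ℝ} (hf : ContDiffOn ℝ 1 f disc) :
    ContinuousOn (Function.uncurry (polarRad f)) (Ioo (-1) 1 ×ˢ univ) :=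
  ((hf.continuousOn_fderiv_of_isOpen isOpen_disc (by simp)).comp continuous_polar.continuousOn
    mapsTo_polar).clm_apply (continuous_polarDir.comp continuous_snd).continuousOn

lemma continuousOn_polarAng {f : Plane → ℝ} (hf : ContDiffOn ℝ 1 f disc) :
    ContinuousOn (Function.uncurry (polarAng f)) (Ioo (-1) 1 ×ˢ univ) :=
  ((hf.continuousOn_fderiv_of_isOpen isOpen_disc (by simp)).comp continuous_polar.continuousOn
    mapsTo_polar).clm_apply (continuous_polarTan.comp continuous_snd).continuousOn

/-! ### The Poincaré inequality and the comparison of means on discs of radius ρ < 1. -/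

/-- The integral over the circle of radius `r` with respect to the angle. -/
def circleInt (K : ℝ → ℝ → ℝ) (r : ℝ) : ℝ := ∫ θ in 0..(2 * π), K r θ

/-- The integral over the disc of radius `ρ` in polar coordinates. -/
def polarInt (K : ℝ → ℝ → ℝ) (ρ : ℝ) : ℝ := ∫ r in 0..ρ, r * circleInt K r

/-- When k is the angular mean of x A - y F, nonnegativity of the left side is an inequality between
deviations from angular means. This is its main use. -/
lemma integral_sq_expand {F A : ℝ → ℝ} (hF : Continuous F) (hA : Continuous A) (x y k : ℝ) :
    ∫ θ in 0..(2 * π), (x * A θ - y * F θ - k) ^ 2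
      = x ^ 2 * (∫ θ in 0..(2 * π), A θ ^ 2) + y ^ 2 * (∫ θ in 0..(2 * π), F θ ^ 2)
        + 2 * π * k ^ 2 - 2 * x * y * (∫ θ in 0..(2 * π), F θ * A θ)
        - 2 * x * k * (∫ θ in 0..(2 * π), A θ) + 2 * y * k * (∫ θ in 0..(2 * π), F θ) := by
  have i : ∀ {g : ℝ → ℝ}, Continuous g → IntervalIntegrable g volume 0 (2 * π) :=
    fun hg => hg.intervalIntegrable _ _
  have e : ∀ θ, (x * A θ - y * F θ - k) ^ 2 = x ^ 2 * A θ ^ 2 + y ^ 2 * F θ ^ 2 + k ^ 2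
      - 2 * x * y * (F θ * A θ) - 2 * x * k * A θ + 2 * y * k * F θ := fun θ => by ring
  simp_rw [e]
  rw [intervalIntegral.integral_add (i (by fun_prop)) (i (by fun_prop)),
    intervalIntegral.integral_sub (i (by fun_prop)) (i (by fun_prop)),
    intervalIntegral.integral_sub (i (by fun_prop)) (i (by fun_prop)),
    intervalIntegral.integral_add (i (by fun_prop)) (i (by fun_prop)),
    intervalIntegral.integral_add (i (by fun_prop)) (i (by fun_prop))]
  simp only [intervalIntegral.integral_const_mul, intervalIntegral.integral_const, smul_eq_mul]
  ring

/-- The Poincaré inequality for radial functions. -/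
lemma radial_bound {ρ : ℝ} (hρ : 0 < ρ) (hρ1 : ρ < 1) {w w' : ℝ → ℝ}
    (hw : ∀ r ∈ Ioo (-1) 1, HasDerivAt w (w' r) r) (hw' : ContinuousOn w' (Ioo (-1) 1))
    (h0 : ∫ r in 0..ρ, r * w r = 0) :
    sigmaBessel * (∫ r in 0..ρ, r * w r ^ 2) ≤ ∫ r in 0..ρ, r * w' r ^ 2 := by
  have hσ := sigmaBessel_pos
  have hsub : Icc 0 ρ ⊆ Ioo (-1) 1 := fun r hr => ⟨by linarith [hr.1], hr.2.trans_lt hρ1⟩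
  have hwc : ContinuousOn w (Ioo (-1) 1) := fun r hr => (hw r hr).continuousAt.continuousWithinAt
  have hrw : ContinuousOn (fun r => r * w r) (Ioo (-1) 1) := by fun_prop
  set G : ℝ → ℝ := fun r => ∫ x in 0..r, x * w x with hG
  have hGd : ∀ r ∈ Ioo (-1) 1, HasDerivAt G (r * w r) r := fun r hr =>
    hasDerivAt_primitive_zero hrw hr
  have hG0 : G 0 = 0 := by simp [hG]
  have hGc : ContinuousOn G (Ioo (-1) 1) := fun r hr => (hGd r hr).continuousAt.continuousWithinAt
  -- H = G/r, extended by 0 at the centre, is the radial field with divergence w: H' + H/r = w. It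
  -- vanishes at 0 and, since the weighted integral of w is zero, at ρ. These are Dirichlet
  -- conditions, so the order-one ratio `besselRatio` calibrates H although w itself is radial.
  set H : ℝ → ℝ := dslope G 0 with hH
  have hHne : ∀ r, r ≠ 0 → H r = G r / r := fun r hr => by
    rw [hH, dslope_of_ne _ hr, slope_def_field, hG0, sub_zero, sub_zero]
  have hHc : ContinuousOn H (Icc 0 ρ) := by
    intro r hr
    refine ContinuousAt.continuousWithinAt ?_
    rcases eq_or_ne r 0 with rfl | hr0
    · exact continuousAt_dslope_same.2 (hGd 0 (hsub hr)).differentiableAt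
    · exact (continuousAt_dslope_of_ne hr0).2 (hGd r (hsub hr)).continuousAt
  have hH0 : H 0 = 0 := by
    rw [hH, dslope_same, (hGd 0 ⟨by norm_num, by norm_num⟩).deriv, zero_mul]
  have hHd : ∀ r ∈ Ioo 0 ρ, HasDerivAt H (w r - H r / r) r := by
    intro r hr
    have hr0 := hr.1.ne'
    have h1 := (hGd r (hsub (Ioo_subset_Icc_self hr))).div (hasDerivAt_id r) hr0
    have h2 : H =ᶠ[nhds r] fun y => G y / id y := by
      filter_upwards [isOpen_ne.mem_nhds hr0] with y hy using hHne y hy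
    refine (h1.congr_of_eventuallyEq h2).congr_deriv ?_
    rw [hHne r hr0]
    simp only [id]
    field_simp
  have hpc : ContinuousOn besselRatio (Icc 0 ρ) :=
    continuousOn_besselRatio.mono (Icc_subset_Icc le_rfl hρ1.le)
  have hwc' := hwc.mono hsub
  have hGc' := hGc.mono hsub
  have hw'c := hw'.mono hsub
  have key := intervalIntegral.sub_le_integral_of_hasDeriv_right_of_le hρ.le
    (g := fun r => (besselRatio r + 1) * H r ^ 2 - 2 * (G r * w r))
    (g' := fun r => (1 - sigmaBessel * r ^ 2 - besselRatio r ^ 2) / r * H r ^ 2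
      + (besselRatio r + 1) * (2 * H r * (w r - H r / r))
      - 2 * (r * w r * w r + G r * w' r))
    (φ := fun r => r * w' r ^ 2 / sigmaBessel - r * w r ^ 2)
    (by fun_prop) ?_ (by
      apply ContinuousOn.integrableOn_Icc
      fun_prop) ?_
  · have hGρ : G ρ = 0 := h0
    have hHρ : H ρ = 0 := by rw [hHne ρ hρ.ne', hGρ, zero_div]
    have huIcc : uIcc 0 ρ = Icc 0 ρ := uIcc_of_le hρ.le
    rw [hG0, hH0, hGρ, hHρ, intervalIntegral.integral_sub,
      intervalIntegral.integral_div] at key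
    · have h1 : ∫ r in 0..ρ, r * w r ^ 2 ≤ (∫ r in 0..ρ, r * w' r ^ 2) / sigmaBessel := by
        linarith
      rw [le_div_iff₀ hσ] at h1
      linarith
    · apply ContinuousOn.intervalIntegrable
      rw [huIcc]
      fun_prop
    · apply ContinuousOn.intervalIntegrable
      rw [huIcc]
      fun_prop
  · intro r hr
    have hr' := hsub (Ioo_subset_Icc_self hr)
    have h1 := (((hasDerivAt_besselRatio ⟨hr.1, (hr.2.trans hρ1).le⟩).add_const 1).mul
      ((hHd r hr).pow 2)).sub (((hGd r hr').mul (hw r hr')).const_mul 2)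
    refine (h1.congr_deriv ?_).hasDerivWithinAt
    simp
  · intro r hr
    have hr0 := hr.1
    have hGr : G r = r * H r := by
      rw [hHne r hr0.ne']
      field_simp
    have e : r * w' r ^ 2 / sigmaBessel - r * w r ^ 2
        - ((1 - sigmaBessel * r ^ 2 - besselRatio r ^ 2) / r * H r ^ 2
          + (besselRatio r + 1) * (2 * H r * (w r - H r / r))
          - 2 * (r * w r * w r + G r * w' r))
        = r / sigmaBessel * (w' r + sigmaBessel * H r) ^ 2
          + 1 / r * (r * w r - (besselRatio r + 1) * H r) ^ 2 := by
      rw [hGr]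
      field_simp
      ring
    have h1 : 0 ≤ r / sigmaBessel * (w' r + sigmaBessel * H r) ^ 2
          + 1 / r * (r * w r - (besselRatio r + 1) * H r) ^ 2 := by positivity
    linarith

/-- The angular integrals of a function on the circle of radius `r` and of its derivatives. -/
lemma angular_bound {f : Plane → ℝ} (hf : ContDiffOn ℝ 1 f disc) {r : ℝ} (hr : r ∈ Ioo (-1) 1) :
    circleInt (fun r θ => polarVal f r θ ^ 2) r - circleInt (polarVal f) r ^ 2 / (2 * π)
      ≤ r ^ 2 * circleInt (fun r θ => polarAng f r θ ^ 2) r := by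
  have hp := pi_pos
  have hFc : Continuous (polarVal f r) := continuous_slice (continuousOn_polarVal hf.continuousOn) hr
  have hTc : Continuous (polarAng f r) := continuous_slice (continuousOn_polarAng hf) hr
  set m := circleInt (polarVal f) r / (2 * π) with hm
  have hint : ∫ θ in 0..(2 * π), (polarVal f r θ - m) = 0 := by
    rw [intervalIntegral.integral_sub (hFc.intervalIntegrable _ _) intervalIntegrable_const]
    have : ∫ θ in 0..(2 * π), polarVal f r θ = circleInt (polarVal f) r := rfl
    rw [this, hm]
    simp only [intervalIntegral.integral_const, smul_eq_mul, sub_zero]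
    field_simp
    ring
  have h := wirtinger (w := fun θ => polarVal f r θ - m) (w' := fun θ => r * polarAng f r θ)
    (fun θ => (hasDerivAt_polarVal_ang hf hr θ).sub_const m) (by fun_prop)
    (by simp [polarVal, polarDir_zero_eq]) hint
  have e := integral_sq_expand hFc hFc 1 0 m
  simp only [one_mul, zero_mul, sub_zero] at e
  rw [e] at h
  simp only [mul_pow, intervalIntegral.integral_const_mul] at h
  have e2 : ∫ θ in 0..(2 * π), polarVal f r θ = 2 * π * m := by
    rw [hm]
    simp only [circleInt]
    field_simp
  rw [e2] at h
  have e3 : circleInt (polarVal f) r = 2 * π * m := e2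
  rw [e3]
  have e4 : (2 * π * m) ^ 2 / (2 * π) = 2 * π * m ^ 2 := by field_simp
  rw [e4]
  simp only [circleInt]
  linarith

/-- The density `‖∇f‖²` in polar coordinates. -/
def polarEnergy (f : Plane → ℝ) (r θ : ℝ) : ℝ := polarRad f r θ ^ 2 + polarAng f r θ ^ 2

lemma continuousOn_polarEnergy {f : Plane → ℝ} (hf : ContDiffOn ℝ 1 f disc) :
    ContinuousOn (Function.uncurry (polarEnergy f)) (Ioo (-1) 1 ×ˢ univ) :=
  ((continuousOn_polarRad hf).pow 2).add ((continuousOn_polarAng hf).pow 2)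

lemma continuousOn_uncurry_sq {K : ℝ → ℝ → ℝ} {S : Set (ℝ × ℝ)}
    (hK : ContinuousOn (Function.uncurry K) S) :
    ContinuousOn (Function.uncurry fun r θ => K r θ ^ 2) S := hK.pow 2

lemma circleInt_polarEnergy {f : Plane → ℝ} (hf : ContDiffOn ℝ 1 f disc) {r : ℝ}
    (hr : r ∈ Ioo (-1) 1) : circleInt (polarEnergy f) r
      = circleInt (fun r θ => polarRad f r θ ^ 2) r
        + circleInt (fun r θ => polarAng f r θ ^ 2) r := by
  have hA := continuous_slice (continuousOn_polarRad hf) hr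
  have hT := continuous_slice (continuousOn_polarAng hf) hr
  exact intervalIntegral.integral_add ((hA.pow 2).intervalIntegrable _ _)
    ((hT.pow 2).intervalIntegrable _ _)

lemma continuousOn_circleInt {K : ℝ → ℝ → ℝ} {S : Set ℝ}
    (hK : ContinuousOn (Function.uncurry K) (S ×ˢ univ)) : ContinuousOn (circleInt K) S :=
  continuousOn_parametric hK _

lemma circleInt_sq_nonneg (K : ℝ → ℝ → ℝ) (r : ℝ) : 0 ≤ circleInt (fun r θ => K r θ ^ 2) r :=
  intervalIntegral.integral_nonneg (by positivity) fun _ _ => sq_nonneg _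

lemma hasDerivAt_circleInt_polarVal {f : Plane → ℝ} (hf : ContDiffOn ℝ 1 f disc) {r : ℝ}
    (hr : r ∈ Ioo (-1) 1) :
    HasDerivAt (circleInt (polarVal f)) (circleInt (polarRad f) r) r :=
  hasDerivAt_parametric (fun _ hr θ => hasDerivAt_polarVal_rad hf hr θ)
    (continuousOn_polarVal hf.continuousOn) (continuousOn_polarRad hf) _ hr

lemma hasDerivAt_circleInt_polarVal_sq {f : Plane → ℝ} (hf : ContDiffOn ℝ 1 f disc) {r : ℝ}
    (hr : r ∈ Ioo (-1) 1) :
    HasDerivAt (circleInt fun r θ => polarVal f r θ ^ 2)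
      (2 * circleInt (fun r θ => polarVal f r θ * polarRad f r θ) r) r := by
  have hF := continuousOn_polarVal hf.continuousOn
  have hA := continuousOn_polarRad hf
  have h := hasDerivAt_parametric (K := fun r θ => polarVal f r θ ^ 2)
    (K' := fun r θ => 2 * (polarVal f r θ * polarRad f r θ))
    (fun r hr θ => ((hasDerivAt_polarVal_rad hf hr θ).pow 2).congr_deriv (by simp; ring))
    (continuousOn_uncurry_sq hF) ((hF.mul hA).const_smul (2 : ℝ)) (2 * π) hr
  rw [intervalIntegral.integral_const_mul] at h
  exact h

/-- The radial derivative dominates the derivative of the angular mean. -/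
lemma circleInt_polarRad_sq_le {f : Plane → ℝ} (hf : ContDiffOn ℝ 1 f disc) {r : ℝ}
    (hr : r ∈ Ioo (-1) 1) :
    circleInt (polarRad f) r ^ 2 / (2 * π) ≤ circleInt (fun r θ => polarRad f r θ ^ 2) r := by
  have hp := pi_pos
  have hA := continuous_slice (continuousOn_polarRad hf) hr
  have e := integral_sq_expand hA hA 1 0 (circleInt (polarRad f) r / (2 * π))
  have h : 0 ≤ ∫ θ in 0..(2 * π), (1 * polarRad f r θ - 0 * polarRad f r θ
      - circleInt (polarRad f) r / (2 * π)) ^ 2 :=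
    intervalIntegral.integral_nonneg (by positivity) fun _ _ => sq_nonneg _
  rw [e] at h
  change 0 ≤ 1 ^ 2 * circleInt (fun r θ => polarRad f r θ ^ 2) r
    + 0 ^ 2 * circleInt (fun r θ => polarRad f r θ ^ 2) r
    + 2 * π * (circleInt (polarRad f) r / (2 * π)) ^ 2
    - 2 * 1 * 0 * _ - 2 * 1 * (circleInt (polarRad f) r / (2 * π)) * circleInt (polarRad f) r
    + 2 * 0 * _ * _ at h
  have e2 : 2 * π * (circleInt (polarRad f) r / (2 * π)) ^ 2
    = circleInt (polarRad f) r ^ 2 / (2 * π) := by field_simp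
  have e3 : 2 * 1 * (circleInt (polarRad f) r / (2 * π)) * circleInt (polarRad f) r
    = 2 * (circleInt (polarRad f) r ^ 2 / (2 * π)) := by ring
  rw [e2, e3] at h
  linarith

/-- Here B and T are the radial and angular energies of the deviation from the angular mean. The
difference of the two sides is 1/r times the completed square plus the Wirtinger defect r²T - N,
both nonnegative. -/
lemma radial_riccati_step {r σ p N X B T : ℝ} (hr : 0 < r)
    (h : 0 ≤ r ^ 2 * B + p ^ 2 * N - 2 * r * p * X) (hT : N ≤ r ^ 2 * T) :
    (1 - σ * r ^ 2 - p ^ 2) / r * N + p * (2 * X) ≤ r * (B + T) - σ * (r * N) := by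
  have e : r * (B + T) - σ * (r * N) - ((1 - σ * r ^ 2 - p ^ 2) / r * N + p * (2 * X))
      = (r ^ 2 * B + p ^ 2 * N - 2 * r * p * X + (r ^ 2 * T - N)) / r := by
    field_simp
    ring
  have : 0 ≤ (r ^ 2 * B + p ^ 2 * N - 2 * r * p * X + (r ^ 2 * T - N)) / r :=
    div_nonneg (by linarith) hr.le
  linarith

/-- The Poincaré inequality on a disc of radius `ρ < 1` for functions with vanishing angular
means. -/
lemma angular_part_bound {f : Plane → ℝ} (hf : ContDiffOn ℝ 1 f disc) {ρ : ℝ} (hρ : 0 < ρ)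
    (hρ1 : ρ < 1) :
    sigmaBessel * (∫ r in 0..ρ, r * (circleInt (fun r θ => polarVal f r θ ^ 2) r
        - circleInt (polarVal f) r ^ 2 / (2 * π)))
      ≤ polarInt (polarEnergy f) ρ
        - ∫ r in 0..ρ, r * (circleInt (polarRad f) r ^ 2 / (2 * π)) := by
  have hp := pi_pos
  have hsub : Icc 0 ρ ⊆ Ioo (-1) 1 := fun r hr => ⟨by linarith [hr.1], hr.2.trans_lt hρ1⟩
  have hF := continuousOn_polarVal hf.continuousOn
  have hA := continuousOn_polarRad hf
  have c1 := (continuousOn_circleInt hF).mono hsub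
  have c2 : ContinuousOn (circleInt fun r θ => polarVal f r θ ^ 2) (Icc 0 ρ) :=
    (continuousOn_circleInt (continuousOn_uncurry_sq hF)).mono hsub
  have c3 := (continuousOn_circleInt hA).mono hsub
  have c4 := (continuousOn_circleInt (continuousOn_polarEnergy hf)).mono hsub
  have hpc : ContinuousOn besselRatio (Icc 0 ρ) :=
    continuousOn_besselRatio.mono (Icc_subset_Icc le_rfl hρ1.le)
  -- N r is the squared distance, on the circle of radius r, of f from its angular mean. It vanishes
  -- at the centre, and at ρ the boundary term `besselRatio ρ * N ρ` is nonnegative and can be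
  -- dropped.
  set N : ℝ → ℝ := fun r => circleInt (fun r θ => polarVal f r θ ^ 2) r
    - circleInt (polarVal f) r ^ 2 / (2 * π) with hN
  have hNc : ContinuousOn N (Icc 0 ρ) := by fun_prop
  have hN0 : N 0 = 0 := by
    simp only [hN, circleInt, polarVal, zero_smul, intervalIntegral.integral_const, smul_eq_mul,
      sub_zero]
    field_simp
    ring
  have hNnonneg : 0 ≤ N ρ := by
    have hρI : ρ ∈ Ioo (-1) 1 := hsub ⟨hρ.le, le_rfl⟩
    have hFρ := continuous_slice hF hρI
    have e := integral_sq_expand hFρ hFρ 1 0 (circleInt (polarVal f) ρ / (2 * π))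
    have h : 0 ≤ ∫ θ in 0..(2 * π), (1 * polarVal f ρ θ - 0 * polarVal f ρ θ
        - circleInt (polarVal f) ρ / (2 * π)) ^ 2 :=
      intervalIntegral.integral_nonneg (by positivity) fun _ _ => sq_nonneg _
    rw [e] at h
    have e1 : ∫ θ in 0..(2 * π), polarVal f ρ θ = circleInt (polarVal f) ρ := rfl
    have e2 : ∫ θ in 0..(2 * π), polarVal f ρ θ ^ 2
      = circleInt (fun r θ => polarVal f r θ ^ 2) ρ := rfl
    rw [e1, e2] at h
    have e3 : 2 * π * (circleInt (polarVal f) ρ / (2 * π)) ^ 2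
      = circleInt (polarVal f) ρ ^ 2 / (2 * π) := by field_simp
    have e4 : 2 * 1 * (circleInt (polarVal f) ρ / (2 * π)) * circleInt (polarVal f) ρ
      = 2 * (circleInt (polarVal f) ρ ^ 2 / (2 * π)) := by ring
    rw [e3, e4] at h
    simp only [hN]
    linarith
  have key := intervalIntegral.sub_le_integral_of_hasDeriv_right_of_le hρ.le
    (g := fun r => besselRatio r * N r)
    (g' := fun r => (1 - sigmaBessel * r ^ 2 - besselRatio r ^ 2) / r * N r
      + besselRatio r * (2 * (circleInt (fun r θ => polarVal f r θ * polarRad f r θ) r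
        - circleInt (polarVal f) r * circleInt (polarRad f) r / (2 * π))))
    (φ := fun r => r * circleInt (polarEnergy f) r
      - r * (circleInt (polarRad f) r ^ 2 / (2 * π)) - sigmaBessel * (r * N r))
    (by fun_prop) ?_ (by
      apply ContinuousOn.integrableOn_Icc
      fun_prop) ?_
  · have huIcc : uIcc 0 ρ = Icc 0 ρ := uIcc_of_le hρ.le
    have i1 : IntervalIntegrable (fun r => r * circleInt (polarEnergy f) r) volume 0 ρ := by
      apply ContinuousOn.intervalIntegrable
      rw [huIcc]
      fun_prop
    have i2 : IntervalIntegrable (fun r => r * (circleInt (polarRad f) r ^ 2 / (2 * π)))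
        volume 0 ρ := by
      apply ContinuousOn.intervalIntegrable
      rw [huIcc]
      fun_prop
    have i3 : IntervalIntegrable (fun r => sigmaBessel * (r * N r)) volume 0 ρ := by
      apply ContinuousOn.intervalIntegrable
      rw [huIcc]
      fun_prop
    rw [intervalIntegral.integral_sub (i1.sub i2) i3, intervalIntegral.integral_sub i1 i2,
      intervalIntegral.integral_const_mul, hN0, mul_zero, sub_zero] at key
    have hpos := mul_nonneg (besselRatio_nonneg ⟨hρ.le, hρ1.le⟩) hNnonneg
    unfold polarInt
    linarith
  · intro r hr
    have hr' := hsub (Ioo_subset_Icc_self hr)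
    have h1 := (hasDerivAt_besselRatio ⟨hr.1, (hr.2.trans hρ1).le⟩).mul
      ((hasDerivAt_circleInt_polarVal_sq hf hr').sub
        (((hasDerivAt_circleInt_polarVal hf hr').pow 2).div_const (2 * π)))
    refine (h1.congr_deriv ?_).hasDerivWithinAt
    simp only [hN, Pi.sub_apply, Pi.pow_apply, Nat.cast_ofNat]
    ring
  · intro r hr
    have hr' := hsub (Ioo_subset_Icc_self hr)
    have hFr := continuous_slice hF hr'
    have hAr := continuous_slice hA hr'
    set a := circleInt (polarVal f) r with ha
    set b := circleInt (polarRad f) r with hb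
    set x := circleInt (fun r θ => polarVal f r θ * polarRad f r θ) r with hx
    set A2 := circleInt (fun r θ => polarRad f r θ ^ 2) r with hA2
    set F2 := circleInt (fun r θ => polarVal f r θ ^ 2) r with hF2
    have h1 : 0 ≤ r ^ 2 * (A2 - b ^ 2 / (2 * π)) + besselRatio r ^ 2 * N r
        - 2 * r * besselRatio r * (x - a * b / (2 * π)) := by
      -- The angular mean of r ∂_r f - p f, with p = `besselRatio r`. Subtracting it replaces f and
      -- its radial derivative by their deviations from the angular means.
      set k := (r * b - besselRatio r * a) / (2 * π) with hk
      have e := integral_sq_expand hFr hAr r (besselRatio r) k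
      have h : 0 ≤ ∫ θ in 0..(2 * π), (r * polarRad f r θ - besselRatio r * polarVal f r θ
          - k) ^ 2 :=
        intervalIntegral.integral_nonneg (by positivity) fun _ _ => sq_nonneg _
      rw [e] at h
      change 0 ≤ r ^ 2 * A2 + besselRatio r ^ 2 * F2 + 2 * π * k ^ 2
        - 2 * r * besselRatio r * x - 2 * r * k * b + 2 * besselRatio r * k * a at h
      have e2 : r ^ 2 * (A2 - b ^ 2 / (2 * π)) + besselRatio r ^ 2 * N r
          - 2 * r * besselRatio r * (x - a * b / (2 * π))
          = r ^ 2 * A2 + besselRatio r ^ 2 * F2 + 2 * π * k ^ 2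
        - 2 * r * besselRatio r * x - 2 * r * k * b + 2 * besselRatio r * k * a := by
        simp only [hN, ← ha, ← hF2, hk]
        field_simp
        ring
      rw [e2]
      exact h
    have h2 := radial_riccati_step (σ := sigmaBessel) hr.1 h1 (angular_bound hf hr')
    rw [circleInt_polarEnergy hf hr']
    refine h2.trans (le_of_eq ?_)
    ring

/-- The Poincaré inequality on a disc of radius `ρ < 1`. -/
lemma polar_poincare {f : Plane → ℝ} (hf : ContDiffOn ℝ 1 f disc) {ρ : ℝ} (hρ : 0 < ρ)
    (hρ1 : ρ < 1) :
    sigmaBessel * (polarInt (fun r θ => polarVal f r θ ^ 2) ρ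
        - polarInt (polarVal f) ρ ^ 2 / (π * ρ ^ 2)) ≤ polarInt (polarEnergy f) ρ := by
  have hp := pi_pos
  have hσ := sigmaBessel_pos
  have hsub : Icc 0 ρ ⊆ Ioo (-1) 1 := fun r hr => ⟨by linarith [hr.1], hr.2.trans_lt hρ1⟩
  have huIcc : uIcc 0 ρ = Icc 0 ρ := uIcc_of_le hρ.le
  have hF := continuousOn_polarVal hf.continuousOn
  have hA := continuousOn_polarRad hf
  have c1 := (continuousOn_circleInt hF).mono hsub
  have c2 : ContinuousOn (circleInt fun r θ => polarVal f r θ ^ 2) (Icc 0 ρ) :=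
    (continuousOn_circleInt (continuousOn_uncurry_sq hF)).mono hsub
  have hang := angular_part_bound hf hρ hρ1
  set S := polarInt (polarVal f) ρ with hS
  set c := S / (π * ρ ^ 2) with hc
  have i : ∀ {g : ℝ → ℝ}, ContinuousOn g (Icc 0 ρ) → IntervalIntegrable g volume 0 ρ := by
    intro g hg
    apply ContinuousOn.intervalIntegrable
    rwa [huIcc]
  have hid : ∫ r in 0..ρ, r = ρ ^ 2 / 2 := by simp
  -- The radial part is the angular mean recentred by the disc mean c. Its energy is exactly the
  -- term subtracted in `angular_part_bound`, so the two bounds add up without loss.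
  have hrad := radial_bound hρ hρ1
    (w := fun r => circleInt (polarVal f) r / (2 * π) - c)
    (w' := fun r => circleInt (polarRad f) r / (2 * π))
    (fun r hr => ((hasDerivAt_circleInt_polarVal hf hr).div_const _).sub_const c)
    ((continuousOn_circleInt hA).div_const _) (by
      have e : ∀ r, r * (circleInt (polarVal f) r / (2 * π) - c)
        = 1 / (2 * π) * (r * circleInt (polarVal f) r) - c * r := fun r => by ring
      simp_rw [e]
      rw [intervalIntegral.integral_sub (i (by fun_prop)) (i (by fun_prop)),
        intervalIntegral.integral_const_mul, intervalIntegral.integral_const_mul, hid]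
      change 1 / (2 * π) * S - _ = 0
      rw [hc]
      field_simp
      ring)
  have e1 : ∫ r in 0..ρ, r * (circleInt (polarVal f) r / (2 * π) - c) ^ 2
      = 1 / (2 * π) * (∫ r in 0..ρ, r * (circleInt (polarVal f) r ^ 2 / (2 * π)))
        - S ^ 2 / (π * ρ ^ 2) / (2 * π) := by
    have e : ∀ r, r * (circleInt (polarVal f) r / (2 * π) - c) ^ 2
        = 1 / (2 * π) * (r * (circleInt (polarVal f) r ^ 2 / (2 * π)))
          - c / π * (r * circleInt (polarVal f) r) + c ^ 2 * r := fun r => by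
      field_simp
      ring
    simp_rw [e]
    rw [intervalIntegral.integral_add (i (by fun_prop)) (i (by fun_prop)),
      intervalIntegral.integral_sub (i (by fun_prop)) (i (by fun_prop)),
      intervalIntegral.integral_const_mul, intervalIntegral.integral_const_mul,
      intervalIntegral.integral_const_mul, hid]
    change _ - c / π * S + _ = _
    rw [hc]
    field_simp
    ring
  have e2 : ∫ r in 0..ρ, r * (circleInt (polarRad f) r / (2 * π)) ^ 2
      = 1 / (2 * π) * ∫ r in 0..ρ, r * (circleInt (polarRad f) r ^ 2 / (2 * π)) := by
    rw [← intervalIntegral.integral_const_mul]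
    congr 1
    ext r
    ring
  have e3 : ∫ r in 0..ρ, r * (circleInt (fun r θ => polarVal f r θ ^ 2) r
        - circleInt (polarVal f) r ^ 2 / (2 * π))
      = polarInt (fun r θ => polarVal f r θ ^ 2) ρ
        - ∫ r in 0..ρ, r * (circleInt (polarVal f) r ^ 2 / (2 * π)) := by
    rw [polarInt, ← intervalIntegral.integral_sub (i (by fun_prop)) (i (by fun_prop))]
    congr 1
    ext r
    ring
  rw [e1, e2] at hrad
  rw [e3] at hang
  have h2 := mul_le_mul_of_nonneg_left hrad (by positivity : 0 ≤ 2 * π)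
  have e4 : ∀ X : ℝ, 2 * π * (1 / (2 * π) * X) = X := fun X => by field_simp
  have e5 : ∀ X Y : ℝ, 2 * π * (sigmaBessel * (1 / (2 * π) * X - Y / (2 * π)))
      = sigmaBessel * (X - Y) := fun X Y => by field_simp
  rw [e4, e5] at h2
  linarith

/-- The mean over the circle of radius `ρ` compared with the mean over the disc. -/
lemma polar_mean_sub_mean_sq_le {f : Plane → ℝ} (hf : ContDiffOn ℝ 1 f disc) {ρ : ℝ} (hρ : 0 < ρ)
    (hρ1 : ρ < 1) :
    (circleInt (polarVal f) ρ / (2 * π) - polarInt (polarVal f) ρ / (π * ρ ^ 2)) ^ 2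
      ≤ polarInt (polarEnergy f) ρ / (8 * π) := by
  have hp := pi_pos
  have hsub : Icc 0 ρ ⊆ Ioo (-1) 1 := fun r hr => ⟨by linarith [hr.1], hr.2.trans_lt hρ1⟩
  have hF := continuousOn_polarVal hf.continuousOn
  have hA := continuousOn_polarRad hf
  have hrF : ContinuousOn (fun r => r * circleInt (polarVal f) r) (Ioo (-1) 1) :=
    continuousOn_id.mul (continuousOn_circleInt hF)
  have c1 := (continuousOn_circleInt hF).mono hsub
  have c4 := (continuousOn_circleInt (continuousOn_polarEnergy hf)).mono hsub
  have hprim : ContinuousOn (fun t => ∫ r in 0..t, r * circleInt (polarVal f) r) (Icc 0 ρ) :=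
    fun r hr => (hasDerivAt_primitive_zero hrF (hsub hr)).continuousAt.continuousWithinAt
  set Y := circleInt (polarVal f) ρ / (2 * π) - polarInt (polarVal f) ρ / (π * ρ ^ 2) with hY
  -- The test field is c r in the radial direction, of constant divergence 2c. This c maximizes
  -- 2cρ²Y - c²ρ⁴/4.
  set c := 4 * Y / ρ ^ 2 with hc
  have key := intervalIntegral.sub_le_integral_of_hasDeriv_right_of_le hρ.le
    (g := fun t => 2 * c * (t ^ 2 * (circleInt (polarVal f) t / (2 * π)))
      - 2 * c / π * ∫ r in 0..t, r * circleInt (polarVal f) r)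
    (g' := fun r => 2 * c * r ^ 2 * (circleInt (polarRad f) r / (2 * π)))
    (φ := fun r => 1 / (2 * π) * (r * circleInt (polarEnergy f) r) + c ^ 2 * r ^ 3)
    (by fun_prop) ?_ (by
      apply ContinuousOn.integrableOn_Icc
      fun_prop) ?_
  · rw [intervalIntegral.integral_add, intervalIntegral.integral_const_mul,
      intervalIntegral.integral_const_mul, integral_pow] at key
    · simp only [intervalIntegral.integral_same] at key
      change 2 * c * (ρ ^ 2 * (circleInt (polarVal f) ρ / (2 * π)))
        - 2 * c / π * polarInt (polarVal f) ρ - _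
        ≤ 1 / (2 * π) * polarInt (polarEnergy f) ρ + _ at key
      have e1 : 2 * c * (ρ ^ 2 * (circleInt (polarVal f) ρ / (2 * π)))
        - 2 * c / π * polarInt (polarVal f) ρ = 2 * c * ρ ^ 2 * Y := by
        rw [hY]
        field_simp
      have e2 : 2 * c * ρ ^ 2 * Y = 8 * Y ^ 2 := by
        rw [hc]
        field_simp
        ring
      have e3 : c ^ 2 * ρ ^ 4 = 16 * Y ^ 2 := by
        rw [hc]
        field_simp
        ring
      rw [e1, e2] at key
      norm_num at key
      have e4 : c ^ 2 * (ρ ^ 4 / 4) = 4 * Y ^ 2 := by linarith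
      rw [e4] at key
      have e5 : polarInt (polarEnergy f) ρ / (8 * π)
        = (π⁻¹ * 2⁻¹ * polarInt (polarEnergy f) ρ) / 4 := by
        field_simp
        ring
      rw [e5]
      linarith
    · apply ContinuousOn.intervalIntegrable
      rw [uIcc_of_le hρ.le]
      fun_prop
    · apply Continuous.intervalIntegrable
      fun_prop
  · intro r hr
    have hr' := hsub (Ioo_subset_Icc_self hr)
    have h1 := ((((hasDerivAt_pow 2 r).mul
      ((hasDerivAt_circleInt_polarVal hf hr').div_const (2 * π))).const_mul (2 * c)).sub
      ((hasDerivAt_primitive_zero hrF hr').const_mul (2 * c / π)))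
    refine (h1.congr_deriv ?_).hasDerivWithinAt
    field_simp
    ring
  · intro r hr
    have hr' := hsub (Ioo_subset_Icc_self hr)
    have hr0 := hr.1
    have h1 : (circleInt (polarRad f) r / (2 * π)) ^ 2
        ≤ 1 / (2 * π) * circleInt (polarEnergy f) r := by
      have h2 := circleInt_polarRad_sq_le hf hr'
      have h3 := circleInt_sq_nonneg (polarAng f) r
      rw [circleInt_polarEnergy hf hr']
      have e : (circleInt (polarRad f) r / (2 * π)) ^ 2
        = 1 / (2 * π) * (circleInt (polarRad f) r ^ 2 / (2 * π)) := by ring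
      rw [e]
      gcongr
      linarith
    have h2 := mul_le_mul_of_nonneg_left h1 hr0.le
    have h3 : 0 ≤ r * (circleInt (polarRad f) r / (2 * π) - c * r) ^ 2 := by positivity
    nlinarith

/-! ### Passage to the boundary -/

lemma continuousOn_polarInt {K : ℝ → ℝ → ℝ}
    (hK : ContinuousOn (Function.uncurry K) (Icc 0 1 ×ˢ univ)) :
    ContinuousOn (polarInt K) (Icc 0 1) :=
  continuousOn_primitive zero_le_one (continuousOn_id.mul (continuousOn_circleInt hK))

lemma tendsto_one_of_continuousOn {g : ℝ → ℝ} (hg : ContinuousOn g (Icc 0 1)) :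
    Filter.Tendsto g (nhdsWithin 1 (Ioo 0 1)) (nhds (g 1)) :=
  ((hg 1 ⟨zero_le_one, le_rfl⟩).mono Ioo_subset_Icc_self)

lemma neBot_nhdsWithin_one : (nhdsWithin (1 : ℝ) (Ioo 0 1)).NeBot := by
  rw [← mem_closure_iff_nhdsWithin_neBot, closure_Ioo zero_ne_one]
  exact ⟨zero_le_one, le_rfl⟩

/-- The gradient need not extend continuously to the circle, so the energies for ρ < 1 are only
bounded by D. The integrals of f and f² pass to ρ = 1 because f is continuous on the closed disc. -/
lemma disc_poincare_of_le {f : Plane → ℝ} (hf : ContDiffOn ℝ 1 f disc)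
    (hc : ContinuousOn f closedDisc) {D : ℝ}
    (hD : ∀ ρ ∈ Ioo (0 : ℝ) 1, polarInt (polarEnergy f) ρ ≤ D) :
    polarInt (fun r θ => polarVal f r θ ^ 2) 1 - polarInt (polarVal f) 1 ^ 2 / π
      ≤ D / sigmaBessel := by
  have hp := pi_pos
  have hF := continuousOn_polarVal_closed hc
  have := neBot_nhdsWithin_one
  have h1 := tendsto_one_of_continuousOn (continuousOn_polarInt hF)
  have h2 : Filter.Tendsto (polarInt fun r θ => polarVal f r θ ^ 2) _ _ :=
    tendsto_one_of_continuousOn (continuousOn_polarInt (continuousOn_uncurry_sq hF))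
  have h3 : Filter.Tendsto (fun ρ : ℝ => π * ρ ^ 2) (nhdsWithin 1 (Ioo 0 1))
      (nhds (π * 1 ^ 2)) :=
    ((by fun_prop : Continuous fun ρ : ℝ => π * ρ ^ 2).tendsto 1).mono_left nhdsWithin_le_nhds
  have h4 := h2.sub ((h1.pow 2).div h3 (by positivity))
  rw [one_pow, mul_one] at h4
  refine le_of_tendsto h4 ?_
  filter_upwards [self_mem_nhdsWithin] with ρ hρ
  rw [le_div_iff₀ sigmaBessel_pos, mul_comm]
  exact (polar_poincare hf hρ.1 hρ.2).trans (hD ρ hρ)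

lemma disc_mean_sub_mean_sq_le_of_le {f : Plane → ℝ} (hf : ContDiffOn ℝ 1 f disc)
    (hc : ContinuousOn f closedDisc) {D : ℝ}
    (hD : ∀ ρ ∈ Ioo (0 : ℝ) 1, polarInt (polarEnergy f) ρ ≤ D) :
    (circleInt (polarVal f) 1 / (2 * π) - polarInt (polarVal f) 1 / π) ^ 2 ≤ D / (8 * π) := by
  have hp := pi_pos
  have hF := continuousOn_polarVal_closed hc
  have := neBot_nhdsWithin_one
  have h1 := tendsto_one_of_continuousOn (continuousOn_polarInt hF)
  have h2 := tendsto_one_of_continuousOn (continuousOn_circleInt hF)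
  have h3 : Filter.Tendsto (fun ρ : ℝ => π * ρ ^ 2) (nhdsWithin 1 (Ioo 0 1))
      (nhds (π * 1 ^ 2)) :=
    ((by fun_prop : Continuous fun ρ : ℝ => π * ρ ^ 2).tendsto 1).mono_left nhdsWithin_le_nhds
  have h4 := ((h2.div_const (2 * π)).sub (h1.div h3 (by positivity))).pow 2
  rw [one_pow, mul_one] at h4
  refine le_of_tendsto h4 ?_
  filter_upwards [self_mem_nhdsWithin] with ρ hρ
  refine (polar_mean_sub_mean_sq_le hf hρ.1 hρ.2).trans ?_
  gcongr
  exact hD ρ hρ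

/-! ### Green's formula and the smallest Neumann eigenvalue -/

/-- The second derivative of `u` at the point with polar coordinates `r`, `θ`, in the directions
`v θ` and `v θ`. -/
def polarHess (u : Plane → ℝ) (v : ℝ → Plane) (r θ : ℝ) : ℝ :=
  fderiv ℝ (fderiv ℝ u) (r • polarDir θ) (v θ) (v θ)

lemma contDiffOn_fderiv_disc {u : Plane → ℝ} (hu : ContDiffOn ℝ 2 u disc) :
    ContDiffOn ℝ 1 (fderiv ℝ u) disc := hu.fderiv_of_isOpen isOpen_disc (by norm_num)

lemma hasFDerivAt_fderiv_of_mem_disc {u : Plane → ℝ} (hu : ContDiffOn ℝ 2 u disc) {x : Plane}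
    (hx : x ∈ disc) : HasFDerivAt (fderiv ℝ u) (fderiv ℝ (fderiv ℝ u) x) x :=
  (((contDiffOn_fderiv_disc hu).differentiableOn (by simp)).differentiableAt
    (isOpen_disc.mem_nhds hx)).hasFDerivAt

lemma hasDerivAt_polarRad_rad {u : Plane → ℝ} (hu : ContDiffOn ℝ 2 u disc) {r : ℝ}
    (hr : r ∈ Ioo (-1) 1) (θ : ℝ) :
    HasDerivAt (fun r => polarRad u r θ) (polarHess u polarDir r θ) r := by
  have h1 : HasDerivAt (fun r : ℝ => r • polarDir θ) (polarDir θ) r := by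
    simpa using (hasDerivAt_id r).smul_const (polarDir θ)
  have h2 := (hasFDerivAt_fderiv_of_mem_disc hu (smul_polarDir_mem_disc hr θ)).comp_hasDerivAt r h1
  refine (h2.clm_apply (hasDerivAt_const r (polarDir θ))).congr_deriv ?_
  simp [polarHess]

lemma hasDerivAt_polarAng_ang {u : Plane → ℝ} (hu : ContDiffOn ℝ 2 u disc) {r : ℝ}
    (hr : r ∈ Ioo (-1) 1) (θ : ℝ) :
    HasDerivAt (polarAng u r) (r * polarHess u polarTan r θ - polarRad u r θ) θ := by
  have h1 := (hasDerivAt_polarDir θ).const_smul r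
  have h2 := (hasFDerivAt_fderiv_of_mem_disc hu (smul_polarDir_mem_disc hr θ)).comp_hasDerivAt θ h1
  refine (h2.clm_apply (hasDerivAt_polarTan θ)).congr_deriv ?_
  simp [polarHess, polarRad, sub_eq_add_neg]

lemma continuousOn_polarHess {u : Plane → ℝ} (hu : ContDiffOn ℝ 2 u disc) {v : ℝ → Plane}
    (hv : Continuous v) :
    ContinuousOn (Function.uncurry (polarHess u v)) (Ioo (-1) 1 ×ˢ univ) := by
  have h := ((contDiffOn_fderiv_disc hu).continuousOn_fderiv_of_isOpen isOpen_disc (by simp)).comp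
    continuous_polar.continuousOn mapsTo_polar
  have hv' : ContinuousOn (fun p : ℝ × ℝ => v p.2) (Ioo (-1) 1 ×ˢ univ) :=
    (hv.comp continuous_snd).continuousOn
  exact (h.clm_apply hv').clm_apply hv'

lemma polarHess_add (u : Plane → ℝ) (r θ : ℝ) :
    polarHess u polarDir r θ + polarHess u polarTan r θ
      = Laplacian.laplacian u (r • polarDir θ) := by
  rw [laplacian_eq_sum_fderiv (polarBasis θ), polarBasis_zero, polarBasis_one]
  rfl

/-- Green's formula, differentiated with respect to the radius. -/
lemma hasDerivAt_flux {u φ : Plane → ℝ} {μ : ℝ} (hu : ContDiffOn ℝ 2 u disc)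
    (hφ : ContDiffOn ℝ 1 φ disc) (hΔ : ∀ x ∈ disc, Laplacian.laplacian u x = -μ * u x) {r : ℝ}
    (hr : r ∈ Ioo (-1) 1) :
    HasDerivAt (fun r => r * circleInt (fun r θ => polarVal φ r θ * polarRad u r θ) r)
      (r * circleInt (fun r θ => polarRad φ r θ * polarRad u r θ
          + polarAng φ r θ * polarAng u r θ) r
        - μ * (r * circleInt (fun r θ => polarVal φ r θ * polarVal u r θ) r)) r := by
  have hu1 : ContDiffOn ℝ 1 u disc := hu.of_le (by norm_num)
  have cF := continuousOn_polarVal hφ.continuousOn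
  have cA := continuousOn_polarRad hφ
  have cT := continuousOn_polarAng hφ
  have cu := continuousOn_polarVal hu.continuousOn
  have cAu := continuousOn_polarRad hu1
  have cTu := continuousOn_polarAng hu1
  have cH := continuousOn_polarHess hu continuous_polarDir
  have cK := continuousOn_polarHess hu continuous_polarTan
  have h1 := hasDerivAt_parametric (K := fun r θ => polarVal φ r θ * polarRad u r θ)
    (K' := fun r θ => polarRad φ r θ * polarRad u r θ + polarVal φ r θ * polarHess u polarDir r θ)
    (fun r hr θ => (hasDerivAt_polarVal_rad hφ hr θ).mul (hasDerivAt_polarRad_rad hu hr θ))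
    (cF.mul cAu) ((cA.mul cAu).add (cF.mul cH)) (2 * π) hr
  have h2 := (hasDerivAt_id r).mul h1
  refine h2.congr_deriv ?_
  have sF := continuous_slice cF hr
  have sA := continuous_slice cA hr
  have sT := continuous_slice cT hr
  have su := continuous_slice cu hr
  have sAu := continuous_slice cAu hr
  have sTu := continuous_slice cTu hr
  have sH := continuous_slice cH hr
  have sK := continuous_slice cK hr
  have i : ∀ {g : ℝ → ℝ}, Continuous g → IntervalIntegrable g volume 0 (2 * π) :=
    fun hg => hg.intervalIntegrable _ _
  -- The integrand is the θ-derivative of φ times the angular derivative of u, so its integral over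
  -- the full circle vanishes. This trades the second angular derivative of u for the product of
  -- first derivatives.
  have h3 : ∫ θ in 0..(2 * π), (r * polarAng φ r θ * polarAng u r θ
      + polarVal φ r θ * (r * polarHess u polarTan r θ - polarRad u r θ)) = 0 := by
    rw [intervalIntegral.integral_eq_sub_of_hasDerivAt
      (f := fun θ => polarVal φ r θ * polarAng u r θ)
      (fun θ _ => (hasDerivAt_polarVal_ang hφ hr θ).mul (hasDerivAt_polarAng_ang hu hr θ))
      (i (by fun_prop))]
    simp [polarVal, polarAng, polarDir_zero_eq, polarTan_zero_eq]
  have e : ∀ θ, polarVal φ r θ * polarVal u r θ * μ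
      = -(polarVal φ r θ * (polarHess u polarDir r θ + polarHess u polarTan r θ)) := fun θ => by
    rw [polarHess_add, hΔ _ (smul_polarDir_mem_disc hr θ), polarVal, polarVal]
    ring
  simp only [circleInt, id, one_mul]
  rw [← sub_eq_zero]
  have e2 : (∫ θ in 0..(2 * π), polarVal φ r θ * polarRad u r θ)
      + r * (∫ θ in 0..(2 * π), (polarRad φ r θ * polarRad u r θ
        + polarVal φ r θ * polarHess u polarDir r θ))
      - (r * (∫ θ in 0..(2 * π), (polarRad φ r θ * polarRad u r θ
          + polarAng φ r θ * polarAng u r θ))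
        - μ * (r * ∫ θ in 0..(2 * π), polarVal φ r θ * polarVal u r θ))
      = -∫ θ in 0..(2 * π), (r * polarAng φ r θ * polarAng u r θ
      + polarVal φ r θ * (r * polarHess u polarTan r θ - polarRad u r θ)) := by
    have e3 : μ * (r * ∫ θ in 0..(2 * π), polarVal φ r θ * polarVal u r θ)
      = r * ∫ θ in 0..(2 * π),
        -(polarVal φ r θ * (polarHess u polarDir r θ + polarHess u polarTan r θ)) := by
      simp_rw [← e]
      rw [intervalIntegral.integral_mul_const]
      ring
    rw [e3, ← intervalIntegral.integral_const_mul, ← intervalIntegral.integral_const_mul,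
      ← intervalIntegral.integral_const_mul, ← intervalIntegral.integral_add (i (by fun_prop))
        (i (by fun_prop)), ← intervalIntegral.integral_sub (i (by fun_prop)) (i (by fun_prop)),
      ← intervalIntegral.integral_sub (i (by fun_prop)) (i (by fun_prop)),
      ← intervalIntegral.integral_neg]
    congr 1
    ext θ
    ring
  rw [e2, h3, neg_zero]

lemma green_polar {u φ : Plane → ℝ} {μ : ℝ} (hu : ContDiffOn ℝ 2 u disc)
    (hφ : ContDiffOn ℝ 1 φ disc) (hΔ : ∀ x ∈ disc, Laplacian.laplacian u x = -μ * u x) {ρ : ℝ}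
    (hρ : ρ ∈ Ioo (0 : ℝ) 1) :
    ρ * circleInt (fun r θ => polarVal φ r θ * polarRad u r θ) ρ
      = polarInt (fun r θ => polarRad φ r θ * polarRad u r θ
          + polarAng φ r θ * polarAng u r θ) ρ
        - μ * polarInt (fun r θ => polarVal φ r θ * polarVal u r θ) ρ := by
  have hu1 : ContDiffOn ℝ 1 u disc := hu.of_le (by norm_num)
  have hsub : uIcc 0 ρ ⊆ Ioo (-1) 1 := by
    rw [uIcc_of_le hρ.1.le]
    exact fun r hr => ⟨by linarith [hr.1], hr.2.trans_lt hρ.2⟩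
  have c1 : ContinuousOn (circleInt fun r θ => polarRad φ r θ * polarRad u r θ
      + polarAng φ r θ * polarAng u r θ) (Ioo (-1) 1) :=
    continuousOn_circleInt (((continuousOn_polarRad hφ).mul (continuousOn_polarRad hu1)).add
      ((continuousOn_polarAng hφ).mul (continuousOn_polarAng hu1)))
  have c2 : ContinuousOn (circleInt fun r θ => polarVal φ r θ * polarVal u r θ) (Ioo (-1) 1) :=
    continuousOn_circleInt ((continuousOn_polarVal hφ.continuousOn).mul
      (continuousOn_polarVal hu.continuousOn))
  have i1 : IntervalIntegrable (fun r => r * circleInt (fun r θ => polarRad φ r θ * polarRad u r θ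
      + polarAng φ r θ * polarAng u r θ) r) volume 0 ρ :=
    (ContinuousOn.mono (by fun_prop) hsub).intervalIntegrable
  have i2 : IntervalIntegrable (fun r => μ * (r * circleInt
      (fun r θ => polarVal φ r θ * polarVal u r θ) r)) volume 0 ρ :=
    (ContinuousOn.mono (by fun_prop) hsub).intervalIntegrable
  have h := intervalIntegral.integral_eq_sub_of_hasDerivAt
    (fun r hr => hasDerivAt_flux hu hφ hΔ (hsub hr)) (i1.sub i2)
  rw [intervalIntegral.integral_sub i1 i2, intervalIntegral.integral_const_mul, zero_mul,
    sub_zero] at h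
  exact h.symm

lemma uniqueDiffOn_closedDisc : UniqueDiffOn ℝ closedDisc :=
  uniqueDiffOn_convex (convex_closedBall _ _) (by
    rw [closedDisc.eq_1, interior_closedBall _ one_ne_zero]
    exact ⟨0, by simp⟩)

/-- The flux through the circle of radius `ρ` tends to `0` for a Neumann function. -/
lemma tendsto_neumann_flux {u φ : Plane → ℝ} (hu : ContDiffOn ℝ 2 u closedDisc)
    (hφ : ContinuousOn φ closedDisc) (hν : ∀ x ∈ circle, fderivWithin ℝ u closedDisc x x = 0) :
    Filter.Tendsto (fun ρ => ρ * circleInt (fun r θ => polarVal φ r θ * polarRad u r θ) ρ)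
      (nhdsWithin 1 (Ioo 0 1)) (nhds 0) := by
  -- W agrees with the flux density for r < 1 but is continuous up to r = 1, where the Neumann
  -- condition makes it vanish.
  set W : ℝ → ℝ → ℝ := fun r θ =>
    polarVal φ r θ * fderivWithin ℝ u closedDisc (r • polarDir θ) (polarDir θ) with hW
  have hWc : ContinuousOn (Function.uncurry W) (Icc 0 1 ×ˢ univ) := by
    refine (continuousOn_polarVal_closed hφ).mul ?_
    exact ((hu.continuousOn_fderivWithin uniqueDiffOn_closedDisc (by simp)).comp
      continuous_polar.continuousOn mapsTo_polar_closed).clm_apply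
      (continuous_polarDir.comp continuous_snd).continuousOn
  have h1 := tendsto_one_of_continuousOn (continuousOn_id.mul (continuousOn_circleInt hWc))
  have hW1 : circleInt W 1 = 0 := by
    have : ∀ θ, W 1 θ = 0 := fun θ => by
      have h := hν (polarDir θ) (by simp [circle, norm_polarDir])
      simp only [hW, one_smul, h, mul_zero]
    simp [circleInt, this]
  simp only [Pi.mul_apply, hW1, mul_zero] at h1
  refine h1.congr' ?_
  filter_upwards [self_mem_nhdsWithin] with ρ hρ
  have e : ∀ θ, W ρ θ = polarVal φ ρ θ * polarRad u ρ θ := fun θ => by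
    have hmem : closedDisc ∈ nhds (ρ • polarDir θ) :=
      Filter.mem_of_superset (isOpen_disc.mem_nhds (smul_polarDir_mem_disc
        ⟨by linarith [hρ.1], hρ.2⟩ θ)) Metric.ball_subset_closedBall
    simp only [hW, polarRad, fderivWithin_of_mem_nhds hmem]
  simp [circleInt, e]

lemma exists_polar (x : Plane) : ∃ θ ∈ Icc 0 (2 * π), ‖x‖ • polarDir θ = x := by
  have hp := pi_pos
  set z : ℂ := ⟨x 0, x 1⟩ with hz
  have hnorm : ‖z‖ = ‖x‖ := by
    rw [Complex.norm_eq_sqrt_sq_add_sq, EuclideanSpace.norm_eq]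
    simp [hz, Fin.sum_univ_two]
  have hc : ‖x‖ * cos (Complex.arg z) = x 0 := by
    rw [← hnorm, Complex.norm_mul_cos_arg]
  have hs : ‖x‖ * sin (Complex.arg z) = x 1 := by
    rw [← hnorm, Complex.norm_mul_sin_arg]
  have key : ∀ θ, cos θ = cos (Complex.arg z) → sin θ = sin (Complex.arg z) →
      ‖x‖ • polarDir θ = x := by
    intro θ h1 h2
    ext i
    fin_cases i
    · simpa [polarDir, h1] using hc
    · simpa [polarDir, h2] using hs
  have hlo := Complex.neg_pi_lt_arg z
  have hhi := Complex.arg_le_pi z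
  rcases le_total 0 (Complex.arg z) with h | h
  · exact ⟨_, ⟨h, by linarith⟩, key _ rfl rfl⟩
  · exact ⟨Complex.arg z + 2 * π, ⟨by linarith, by linarith⟩,
      key _ (cos_add_two_pi _) (sin_add_two_pi _)⟩

lemma polarInt_sq_pos {u : Plane → ℝ} (hc : ContinuousOn u closedDisc)
    (h : ∃ x ∈ disc, u x ≠ 0) : 0 < polarInt (fun r θ => polarVal u r θ ^ 2) 1 := by
  have hp := pi_pos
  have hcF : ContinuousOn (Function.uncurry fun r θ => polarVal u r θ ^ 2) (Icc 0 1 ×ˢ univ) :=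
    continuousOn_uncurry_sq (continuousOn_polarVal_closed hc)
  obtain ⟨x, hx, hux⟩ := h
  have hx1 : ‖x‖ < 1 := by simpa [disc] using hx
  -- The weight r vanishes at the centre, so a point with u ≠ 0 away from the origin is needed.
  obtain ⟨y, hy1, hy0, huy⟩ : ∃ y, ‖y‖ < 1 ∧ y ≠ 0 ∧ u y ≠ 0 := by
    rcases eq_or_ne x 0 with rfl | hx0
    · have hmem : closedDisc ∈ nhds (0 : Plane) := Metric.closedBall_mem_nhds _ one_pos
      have h1 : ∀ᶠ y in nhds (0 : Plane), u y ≠ 0 :=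
        (hc.continuousAt hmem).eventually_ne hux
      have h2 : ∀ᶠ y in nhds (0 : Plane), ‖y‖ < 1 := by
        filter_upwards [Metric.ball_mem_nhds (0 : Plane) one_pos] with y hy
        simpa using hy
      have h3 := (h1.and h2).filter_mono (nhdsWithin_le_nhds (s := {(0 : Plane)}ᶜ))
      obtain ⟨y, ⟨h4, h5⟩, h6⟩ := (h3.and self_mem_nhdsWithin).exists
      exact ⟨y, h5, h6, h4⟩
    · exact ⟨x, hx1, hx0, hux⟩
  obtain ⟨θ, hθ, hyθ⟩ := exists_polar y
  have hyI : ‖y‖ ∈ Icc (0 : ℝ) 1 := ⟨norm_nonneg y, hy1.le⟩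
  have hpos : 0 < circleInt (fun r θ => polarVal u r θ ^ 2) ‖y‖ := by
    refine intervalIntegral.integral_pos (by positivity)
      (continuous_slice hcF hyI).continuousOn (fun _ _ => sq_nonneg _) ⟨θ, hθ, ?_⟩
    change 0 < u (‖y‖ • polarDir θ) ^ 2
    rw [hyθ]
    positivity
  refine intervalIntegral.integral_pos zero_lt_one
    (continuousOn_id.mul (continuousOn_circleInt hcF)) (fun r hr => ?_) ⟨‖y‖, hyI, ?_⟩
  · exact mul_nonneg hr.1.le (circleInt_sq_nonneg (polarVal u) r)
  · exact mul_pos (norm_pos_iff.2 hy0) hpos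

/-- Green's formula tested with 1 gives mean zero, because μ ≠ 0; tested with u it shows that the
energy tends to μ ∫ u². The Poincaré inequality then reads σ ∫ u² ≤ μ ∫ u² in the limit ρ → 1. -/
lemma sigmaBessel_le_of_isNeumannEigenvalue {μ : ℝ} (hμ : 0 < μ) (h : IsNeumannEigenvalue μ) :
    sigmaBessel ≤ μ := by
  have hp := pi_pos
  obtain ⟨u, hu, hne, hΔ, hν⟩ := h
  have hud : ContDiffOn ℝ 2 u disc := hu.mono Metric.ball_subset_closedBall
  have hu1 : ContDiffOn ℝ 1 u disc := hud.of_le (by norm_num)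
  have hF := continuousOn_polarVal_closed hu.continuousOn
  have := neBot_nhdsWithin_one
  have t1 := tendsto_one_of_continuousOn (continuousOn_polarInt hF)
  have t2 : Filter.Tendsto (polarInt fun r θ => polarVal u r θ ^ 2) _ _ :=
    tendsto_one_of_continuousOn (continuousOn_polarInt (continuousOn_uncurry_sq hF))
  have hmean : polarInt (polarVal u) 1 = 0 := by
    have h1 := tendsto_neumann_flux hu (continuousOn_const (c := (1 : ℝ))) hν
    have h2 := (t1.const_mul (-μ))
    have h3 : Filter.Tendsto (fun ρ => -μ * polarInt (polarVal u) ρ)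
        (nhdsWithin 1 (Ioo 0 1)) (nhds 0) := by
      refine h1.congr' ?_
      filter_upwards [self_mem_nhdsWithin] with ρ hρ
      have h4 := green_polar hud (contDiffOn_const (c := (1 : ℝ))) hΔ hρ
      rw [h4]
      have e1 : polarInt (fun r θ => polarRad (fun _ => (1 : ℝ)) r θ * polarRad u r θ
          + polarAng (fun _ => (1 : ℝ)) r θ * polarAng u r θ) ρ = 0 := by
        simp [polarInt, circleInt, polarRad, polarAng]
      have e2 : (fun r θ => polarVal (fun _ => (1 : ℝ)) r θ * polarVal u r θ) = polarVal u := by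
        ext r θ
        simp [polarVal]
      rw [e1, e2]
      ring
    have h5 := tendsto_nhds_unique h2 h3
    simpa [hμ.ne'] using h5
  have henergy : Filter.Tendsto (polarInt (polarEnergy u)) (nhdsWithin 1 (Ioo 0 1))
      (nhds (μ * polarInt (fun r θ => polarVal u r θ ^ 2) 1)) := by
    have h1 := (tendsto_neumann_flux hu hu.continuousOn hν).add (t2.const_mul μ)
    rw [zero_add] at h1
    refine h1.congr' ?_
    filter_upwards [self_mem_nhdsWithin] with ρ hρ
    rw [green_polar hud hu1 hΔ hρ]
    simp only [← sq]
    change polarInt (polarEnergy u) ρ - _ + _ = _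
    ring
  have t3 : Filter.Tendsto (fun ρ : ℝ => π * ρ ^ 2) (nhdsWithin 1 (Ioo 0 1))
      (nhds (π * 1 ^ 2)) :=
    ((by fun_prop : Continuous fun ρ : ℝ => π * ρ ^ 2).tendsto 1).mono_left nhdsWithin_le_nhds
  have t4 := (t2.sub ((t1.pow 2).div t3 (by positivity))).const_mul sigmaBessel
  have hle := le_of_tendsto_of_tendsto t4 henergy (by
    filter_upwards [self_mem_nhdsWithin] with ρ hρ
    exact polar_poincare hu1 hρ.1 hρ.2)
  rw [hmean] at hle
  norm_num at hle
  exact le_of_mul_le_mul_right hle (polarInt_sq_pos hu.continuousOn hne)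

lemma isLeast_sigmaBessel : IsLeast {μ : ℝ | 0 < μ ∧ IsNeumannEigenvalue μ} sigmaBessel :=
  ⟨⟨sigmaBessel_pos, isNeumannEigenvalue_sigmaBessel⟩,
    fun _ hμ => sigmaBessel_le_of_isNeumannEigenvalue hμ.1 hμ.2⟩

lemma sigmaDisc_eq : sigmaDisc = sigmaBessel := isLeast_sigmaBessel.csInf_eq

/-! ### The measure on the circle -/

lemma isometry_rotation (φ : ℝ) :
    Isometry fun x : Plane => cos φ • x + sin φ • circleTangent x := by
  refine Isometry.of_dist_eq fun x y => ?_
  rw [EuclideanSpace.dist_eq, EuclideanSpace.dist_eq]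
  congr 1
  simp only [Fin.sum_univ_two, Real.dist_eq, sq_abs, circleTangent, PiLp.add_apply,
    PiLp.smul_apply, smul_eq_mul, Matrix.cons_val_zero, Matrix.cons_val_one]
  have h := sin_sq_add_cos_sq φ
  linear_combination ((x 0 - y 0) ^ 2 + (x 1 - y 1) ^ 2) * h

lemma rotation_polarDir (φ θ : ℝ) :
    cos φ • polarDir θ + sin φ • circleTangent (polarDir θ) = polarDir (φ + θ) := by
  ext i
  fin_cases i
  · simp [polarDir, circleTangent, cos_add]
    ring
  · simp [polarDir, circleTangent, sin_add]
    ring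

lemma measurePreserving_rotation (φ : ℝ) :
    MeasurePreserving (fun x : Plane => cos φ • x + sin φ • circleTangent x)
      (Measure.hausdorffMeasure 1) (Measure.hausdorffMeasure 1) := by
  refine ⟨(isometry_rotation φ).continuous.measurable, ?_⟩
  rw [(isometry_rotation φ).map_hausdorffMeasure (Or.inl zero_le_one)]
  have : range (fun x : Plane => cos φ • x + sin φ • circleTangent x) = univ := by
    refine range_eq_univ.2 fun y => ?_
    obtain ⟨θ, -, hθ⟩ := exists_polar y
    refine ⟨‖y‖ • polarDir (θ - φ), ?_⟩
    have h := rotation_polarDir φ (θ - φ)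
    rw [add_sub_cancel] at h
    have e : circleTangent (‖y‖ • polarDir (θ - φ)) = ‖y‖ • circleTangent (polarDir (θ - φ)) := by
      ext i
      fin_cases i <;> simp [circleTangent]
    simp only [e]
    rw [smul_comm, smul_comm (sin φ), ← smul_add, h, hθ]
  rw [this, Measure.restrict_univ]

lemma exists_polarDir_eq {x : Plane} (hx : x ∈ circle) : ∃ θ ∈ Icc 0 (2 * π), polarDir θ = x := by
  obtain ⟨θ, hθ, h⟩ := exists_polar x
  have hx1 : ‖x‖ = 1 := by simpa [circle] using hx
  exact ⟨θ, hθ, by simpa [hx1] using h⟩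

lemma polarDir_mem_circle (θ : ℝ) : polarDir θ ∈ circle := by simp [circle, norm_polarDir]

lemma measurableSet_circle : MeasurableSet circle := Metric.isClosed_sphere.measurableSet

/-- Finiteness and positivity are all that is needed. Rotation invariance determines the normalized
measure, so the Hausdorff length of the circle is never computed. -/
lemma hausdorffMeasure_circle_ne_top : Measure.hausdorffMeasure 1 circle ≠ ⊤ := by
  have hlip : LipschitzWith 1 polarDir := by
    refine lipschitzWith_of_nnnorm_deriv_le
      (fun θ => (hasDerivAt_polarDir θ).differentiableAt) fun θ => ?_
    rw [(hasDerivAt_polarDir θ).deriv, ← NNReal.coe_le_coe, coe_nnnorm, norm_polarTan]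
    rfl
  have h1 := hlip.hausdorffMeasure_image_le zero_le_one (Icc 0 (2 * π))
  have h2 : circle ⊆ polarDir '' Icc 0 (2 * π) := fun x hx => exists_polarDir_eq hx
  refine ((measure_mono h2).trans h1).trans_lt ?_ |>.ne
  rw [hausdorffMeasure_real, volume_Icc]
  simpa using ENNReal.mul_lt_top ENNReal.ofNat_lt_top ENNReal.ofReal_lt_top

lemma hausdorffMeasure_circle_ne_zero : Measure.hausdorffMeasure 1 circle ≠ 0 := by
  have hlip : LipschitzWith 1 fun x : Plane => x 0 := by
    refine LipschitzWith.of_dist_le_mul fun x y => ?_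
    rw [NNReal.coe_one, one_mul, dist_eq_norm, dist_eq_norm]
    exact PiLp.norm_apply_le (x - y) 0
  have h1 := hlip.hausdorffMeasure_image_le zero_le_one circle
  have h2 : Icc (-1) 1 ⊆ (fun x : Plane => x 0) '' circle := fun c hc =>
    ⟨polarDir (arccos c), polarDir_mem_circle _, by simpa [polarDir] using cos_arccos hc.1 hc.2⟩
  have h3 := (measure_mono h2).trans h1
  rw [hausdorffMeasure_real] at h3
  intro h0
  rw [h0] at h3
  norm_num at h3

lemma lintegral_periodic_shift {h : ℝ → ℝ≥0∞} (hp : Function.Periodic h (2 * π)) (c : ℝ) :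
    ∫⁻ t in Ioc 0 (2 * π), h (t + c) = ∫⁻ t in Ioc 0 (2 * π), h t := by
  have : Fact (0 < 2 * π) := ⟨two_pi_pos⟩
  have h1 := AddCircle.lintegral_preimage (2 * π) 0 hp.lift
  have h2 := AddCircle.lintegral_preimage (2 * π) 0 fun b => hp.lift (b + (c : AddCircle (2 * π)))
  rw [lintegral_add_right_eq_self] at h2
  rw [zero_add] at h1 h2
  exact h2.trans h1.symm

lemma periodic_polarDir : Function.Periodic polarDir (2 * π) := fun θ => by
  simp [polarDir]

/-- Arc length on the circle, up to normalization the only rotation invariant measure. -/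
lemma circleMeasure_eq : circleMeasure
    = ENNReal.ofReal (1 / (2 * π)) • (volume.restrict (Ioc 0 (2 * π))).map polarDir := by
  have hp := two_pi_pos
  set ν : Measure Plane := (Measure.hausdorffMeasure 1).restrict circle with hν
  have hνu : ν univ = Measure.hausdorffMeasure 1 circle := by
    rw [hν, Measure.restrict_apply_univ]
  have : IsFiniteMeasure ν := ⟨by rw [hνu]; exact hausdorffMeasure_circle_ne_top.lt_top⟩
  have hinv : ∀ φ, MeasurePreserving (fun x : Plane => cos φ • x + sin φ • circleTangent x) ν ν := by
    intro φ
    have h := (measurePreserving_rotation φ).restrict_preimage measurableSet_circle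
    have hpre : (fun x : Plane => cos φ • x + sin φ • circleTangent x) ⁻¹' circle = circle := by
      ext x
      have h0 := (isometry_rotation φ).dist_eq x 0
      have e : circleTangent 0 = 0 := by
        ext i
        fin_cases i <;> simp [circleTangent]
      simp only [smul_zero, e, add_zero] at h0
      simp only [circle, mem_preimage, Metric.mem_sphere, h0]
    rwa [hpre] at h
  have hcont : Continuous fun p : ℝ × Plane => cos p.1 • p.2 + sin p.1 • circleTangent p.2 := by
    have : Continuous circleTangent := by
      unfold circleTangent
      fun_prop
    fun_prop
  ext s hs
  set g : Plane → ℝ≥0∞ := s.indicator 1 with hg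
  have hgm : Measurable g := measurable_one.indicator hs
  have hgν : ∫⁻ x, g x ∂ν = ν s := by rw [hg, lintegral_indicator_one hs]
  have hmap : ∫⁻ t in Ioc 0 (2 * π), g (polarDir t)
      = (volume.restrict (Ioc 0 (2 * π))).map polarDir s := by
    rw [← lintegral_map hgm continuous_polarDir.measurable, hg, lintegral_indicator_one hs]
  -- The average of g over rotated points is computed twice: by invariance of ν it is 2π ν(s), and
  -- by Tonelli and periodicity it is the arc length measure of s times the total mass of ν.
  have h1 : ∫⁻ φ in Ioc 0 (2 * π), ∫⁻ x, g (cos φ • x + sin φ • circleTangent x) ∂ν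
      = ENNReal.ofReal (2 * π) * ν s := by
    simp_rw [fun φ => (hinv φ).lintegral_comp hgm, hgν]
    rw [lintegral_const, Measure.restrict_apply_univ, volume_Ioc, sub_zero, mul_comm]
  have h2 : ∫⁻ φ in Ioc 0 (2 * π), ∫⁻ x, g (cos φ • x + sin φ • circleTangent x) ∂ν
      = (∫⁻ t in Ioc 0 (2 * π), g (polarDir t)) * ν univ := by
    have hm : AEMeasurable (Function.uncurry fun (φ : ℝ) (x : Plane) =>
        g (cos φ • x + sin φ • circleTangent x)) ((volume.restrict (Ioc 0 (2 * π))).prod ν) :=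
      (hgm.comp hcont.measurable).aemeasurable
    rw [lintegral_lintegral_swap hm, ← lintegral_const]
    refine setLIntegral_congr_fun measurableSet_circle fun x hx => ?_
    obtain ⟨θ, -, rfl⟩ := exists_polarDir_eq hx
    simp_rw [rotation_polarDir]
    exact lintegral_periodic_shift (h := fun t => g (polarDir t))
      (fun t => by simp only [periodic_polarDir t]) θ
  rw [h1, hmap, hνu] at h2
  rw [circleMeasure, ProbabilityTheory.cond, Measure.smul_apply, Measure.smul_apply, smul_eq_mul,
    smul_eq_mul, ← hν]
  have hc0 : ENNReal.ofReal (2 * π) ≠ 0 := by simpa using hp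
  have e1 : ENNReal.ofReal (1 / (2 * π)) = (ENNReal.ofReal (2 * π))⁻¹ := by
    rw [one_div, ENNReal.ofReal_inv_of_pos hp]
  rw [e1]
  have e2 : ν s = (ENNReal.ofReal (2 * π))⁻¹ * (ENNReal.ofReal (2 * π) * ν s) := by
    rw [← mul_assoc, ENNReal.inv_mul_cancel hc0 ENNReal.ofReal_ne_top, one_mul]
  rw [e2, h2, mul_left_comm, mul_comm (Measure.map _ _ _)]
  congr 1
  rw [← mul_assoc, ENNReal.inv_mul_cancel hausdorffMeasure_circle_ne_zero
    hausdorffMeasure_circle_ne_top, one_mul]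

/-! ### The measure on the needle -/

/-- The parametrization of the needle by arc length. -/
def needleMap (t : ℝ) : Plane := !₂[1 + t, 0]

lemma isometry_needleMap : Isometry needleMap := by
  refine Isometry.of_dist_eq fun s t => ?_
  rw [EuclideanSpace.dist_eq]
  simp [Fin.sum_univ_two, needleMap, Real.dist_eq, sqrt_sq_eq_abs]

lemma measurableEmbedding_needleMap : MeasurableEmbedding needleMap :=
  isometry_needleMap.isClosedEmbedding.measurableEmbedding

lemma needle_eq_image (L : ℝ) : needle L = needleMap '' Icc 0 L := by
  ext x
  constructor
  · rintro ⟨h1, h2, h3⟩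
    refine ⟨x 0 - 1, ⟨by linarith, by linarith⟩, ?_⟩
    ext i
    fin_cases i
    · simp [needleMap]
    · simp [needleMap, h3]
  · rintro ⟨t, ht, rfl⟩
    refine ⟨?_, ?_, ?_⟩
    · simpa [needleMap] using ht.1
    · simp only [needleMap, PiLp.toLp_apply, Matrix.cons_val_zero]
      linarith [ht.2]
    · simp [needleMap]

lemma measurableSet_needle (L : ℝ) : MeasurableSet (needle L) := by
  rw [needle_eq_image]
  exact (isCompact_Icc.image isometry_needleMap.continuous).measurableSet

lemma needleMeasure_eq {L : ℝ} (hL : 0 < L) : needleMeasure L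
    = ENNReal.ofReal (1 / L) • (volume.restrict (Ioc 0 L)).map needleMap := by
  have hmap := isometry_needleMap.map_hausdorffMeasure (d := 1) (Or.inl zero_le_one)
  rw [hausdorffMeasure_real] at hmap
  have hpre : needleMap ⁻¹' needle L = Icc 0 L := by
    rw [needle_eq_image, preimage_image_eq _ isometry_needleMap.injective]
  have hsub : needle L ⊆ range needleMap := by
    rw [needle_eq_image]
    exact image_subset_range _ _
  have hrestrict : (Measure.hausdorffMeasure 1).restrict (needle L)
      = (volume.restrict (Ioc 0 L)).map needleMap := by
    rw [restrict_Ioc_eq_restrict_Icc, ← hpre,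
      ← Measure.restrict_map measurableEmbedding_needleMap.measurable (measurableSet_needle L), hmap,
      Measure.restrict_restrict (measurableSet_needle L), inter_eq_left.2 hsub]
  have hmass : Measure.hausdorffMeasure 1 (needle L) = ENNReal.ofReal L := by
    rw [← Measure.restrict_apply_univ, hrestrict,
      Measure.map_apply measurableEmbedding_needleMap.measurable MeasurableSet.univ]
    simp
  rw [needleMeasure, ProbabilityTheory.cond, hmass, hrestrict, one_div,
    ENNReal.ofReal_inv_of_pos hL]

/-- The measure on the circle with its needle is normalized arc length. -/
lemma sigmaMeasure_eq {L : ℝ} (hL : 0 < L) : sigmaMeasure L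
    = ENNReal.ofReal (1 / (2 * π + L)) • ((volume.restrict (Ioc 0 (2 * π))).map polarDir
      + (volume.restrict (Ioc 0 L)).map needleMap) := by
  have hp := pi_pos
  rw [sigmaMeasure, circleMeasure_eq, needleMeasure_eq hL, smul_smul, smul_smul,
    ← ENNReal.ofReal_mul (by positivity), ← ENNReal.ofReal_mul (by positivity), smul_add]
  congr 3 <;> field_simp

/-! ### The measure on the disc -/

lemma discMeasure_eq : discMeasure = ENNReal.ofReal (1 / π) • volume.restrict disc := by
  have h : (volume : Measure Plane) disc = ENNReal.ofReal π := by
    rw [disc, EuclideanSpace.volume_ball_fin_two]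
    simp
  rw [discMeasure, ProbabilityTheory.cond, h, one_div, ENNReal.ofReal_inv_of_pos pi_pos]

/-- Integration in polar coordinates. -/
lemma setIntegral_ball_eq_polarInt {φ : Plane → ℝ} {ρ : ℝ} (hρ : 0 < ρ)
    (hφ : ContinuousOn φ (Metric.closedBall 0 ρ)) :
    ∫ x in Metric.ball 0 ρ, φ x = polarInt (polarVal φ) ρ := by
  set e : Plane ≃ᵐ ℝ × ℝ :=
    (MeasurableEquiv.toLp 2 (Fin 2 → ℝ)).symm.trans MeasurableEquiv.finTwoArrow with he
  have hmp : MeasurePreserving e volume volume :=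
    (volume_preserving_finTwoArrow ℝ).comp
      (EuclideanSpace.volume_preserving_symm_measurableEquiv_toLp (Fin 2))
  set G : Plane → ℝ := (Metric.ball 0 ρ).indicator φ with hG
  have hsymm : ∀ r θ : ℝ, e.symm (polarCoord.symm (r, θ)) = r • polarDir θ := by
    intro r θ
    rw [polarCoord_symm_apply]
    ext i
    fin_cases i <;> simp [he, polarDir, MeasurableEquiv.finTwoArrow]
  have hcont : ContinuousOn (fun p : ℝ × ℝ => p.1 * φ (p.1 • polarDir p.2))
      (Icc 0 ρ ×ˢ Icc (-π) π) := by
    refine continuousOn_fst.mul (hφ.comp continuous_polar.continuousOn fun p hp => ?_)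
    rw [mem_closedBall_zero_iff, norm_smul, norm_polarDir, mul_one, Real.norm_of_nonneg hp.1.1]
    exact hp.1.2
  have hint : IntegrableOn (fun p : ℝ × ℝ => p.1 * φ (p.1 • polarDir p.2))
      (Ioo 0 ρ ×ˢ Ioo (-π) π) (volume.prod volume) :=
    (hcont.integrableOn_compact (isCompact_Icc.prod isCompact_Icc)).mono_set
      (prod_mono Ioo_subset_Icc_self Ioo_subset_Icc_self)
  calc ∫ x in Metric.ball 0 ρ, φ x = ∫ x, G x := (integral_indicator measurableSet_ball).symm
    _ = ∫ p, G (e.symm p) := by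
      rw [← hmp.integral_comp e.measurableEmbedding]
      simp
    _ = ∫ p in polarCoord.target, p.1 • G (e.symm (polarCoord.symm p)) :=
      (integral_comp_polarCoord_symm _).symm
    _ = ∫ p in Ioi (0 : ℝ) ×ˢ Ioo (-π) π, (Ioo 0 ρ ×ˢ Ioo (-π) π).indicator
          (fun p : ℝ × ℝ => p.1 * φ (p.1 • polarDir p.2)) p := by
      rw [polarCoord_target]
      refine setIntegral_congr_fun (measurableSet_Ioi.prod measurableSet_Ioo) fun p hp => ?_
      have hp1 : 0 < p.1 := hp.1
      have hmem : p.1 • polarDir p.2 ∈ Metric.ball (0 : Plane) ρ ↔ p ∈ Ioo 0 ρ ×ˢ Ioo (-π) π := by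
        rw [mem_ball_zero_iff, norm_smul, norm_polarDir, mul_one, Real.norm_of_nonneg hp1.le]
        exact ⟨fun h => ⟨⟨hp1, h⟩, hp.2⟩, fun h => h.1.2⟩
      simp only [smul_eq_mul, hsymm p.1 p.2, hG]
      by_cases h : p ∈ Ioo 0 ρ ×ˢ Ioo (-π) π
      · rw [indicator_of_mem h, indicator_of_mem (hmem.2 h)]
      · rw [indicator_of_notMem h, indicator_of_notMem fun h' => h (hmem.1 h'), mul_zero]
    _ = ∫ p in Ioo 0 ρ ×ˢ Ioo (-π) π, p.1 * φ (p.1 • polarDir p.2) := by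
      rw [setIntegral_indicator (measurableSet_Ioo.prod measurableSet_Ioo)]
      congr 2
      exact inter_eq_right.2 (prod_mono Ioo_subset_Ioi_self subset_rfl)
    _ = ∫ r in Ioo 0 ρ, ∫ θ in Ioo (-π) π, r * φ (r • polarDir θ) := setIntegral_prod _ hint
    _ = polarInt (polarVal φ) ρ := by
      rw [polarInt, intervalIntegral.integral_of_le hρ.le, integral_Ioc_eq_integral_Ioo]
      refine setIntegral_congr_fun measurableSet_Ioo fun r _ => ?_
      rw [integral_const_mul, ← integral_Ioc_eq_integral_Ioo,
        ← intervalIntegral.integral_of_le (by linarith [pi_pos])]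
      congr 1
      -- `polarCoord` uses the angles (-π, π); periodicity moves the integral to (0, 2π).
      have hper : Function.Periodic (fun θ => φ (r • polarDir θ)) (2 * π) := fun θ => by
        simp only [periodic_polarDir θ]
      have h := hper.intervalIntegral_add_eq (-π) 0
      rw [zero_add, show -π + 2 * π = π by ring] at h
      exact h

/-! ### Functions of the domain on the parts of the set -/

lemma norm_attach : ‖attach‖ = 1 := by simp [attach, EuclideanSpace.norm_eq]

lemma disc_subset (L : ℝ) : disc ⊆ fullSet L \ {attach} := by
  refine fun x hx => ⟨Or.inl (Metric.ball_subset_closedBall hx), ?_⟩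
  rintro rfl
  have : ‖attach‖ < 1 := by simpa [disc] using hx
  rw [norm_attach] at this
  exact lt_irrefl _ this

lemma circle_subset_fullSet (L : ℝ) : circle ⊆ fullSet L := fun _ hx =>
  Or.inl (Metric.sphere_subset_closedBall hx)

lemma needleMap_mem_fullSet {L t : ℝ} (ht : t ∈ Icc 0 L) : needleMap t ∈ fullSet L :=
  Or.inr (by rw [needle_eq_image]; exact mem_image_of_mem _ ht)

lemma polarDir_ne_attach {t : ℝ} (ht : t ∈ Ioo 0 (2 * π)) : polarDir t ≠ attach := by
  intro h
  have h1 : cos t = 1 := by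
    have := congrArg (fun x : Plane => x 0) h
    simpa [polarDir, attach] using this
  have h2 := (cos_eq_one_iff_of_lt_of_lt (by linarith [ht.1, pi_pos]) ht.2).1 h1
  exact ht.1.ne' h2

lemma needleMap_ne_attach {t : ℝ} (ht : 0 < t) : needleMap t ≠ attach := by
  intro h
  have h1 : 1 + t = 1 := by
    have := congrArg (fun x : Plane => x 0) h
    simpa [needleMap, attach] using this
  linarith

lemma contDiff_needleMap : ContDiff ℝ 1 needleMap := by
  have : needleMap = fun t : ℝ => (!₂[1, 0] : Plane) + t • (!₂[1, 0] : Plane) := by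
    ext t i
    fin_cases i <;> simp [needleMap]
  rw [this]
  fun_prop

lemma hasDerivAt_circle_restriction {L : ℝ} {f : Plane → ℝ} (hf : f ∈ domain L) {t : ℝ}
    (ht : t ∈ Ioo 0 (2 * π)) :
    HasDerivAt (fun t => f (polarDir t)) (deriv (fun t => f (polarDir t)) t) t := by
  have h : ContDiffOn ℝ 1 (fun t => f (polarDir t)) (Ioo 0 (2 * π)) :=
    hf.2.1.comp contDiff_polarDir.contDiffOn fun s hs =>
      ⟨circle_subset_fullSet L (polarDir_mem_circle s), polarDir_ne_attach hs⟩
  exact ((h.differentiableOn (by simp)).differentiableAt (isOpen_Ioo.mem_nhds ht)).hasDerivAt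

lemma hasDerivAt_needle_restriction {L : ℝ} {f : Plane → ℝ} (hf : f ∈ domain L) {t : ℝ}
    (ht : t ∈ Ioo 0 L) :
    HasDerivAt (fun t => f (needleMap t)) (deriv (fun t => f (needleMap t)) t) t := by
  have h : ContDiffOn ℝ 1 (fun t => f (needleMap t)) (Ioo 0 L) :=
    hf.2.1.comp contDiff_needleMap.contDiffOn fun s hs =>
      ⟨needleMap_mem_fullSet (Ioo_subset_Icc_self hs), needleMap_ne_attach hs.1⟩
  exact ((h.differentiableOn (by simp)).differentiableAt (isOpen_Ioo.mem_nhds ht)).hasDerivAt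

lemma continuous_circle_restriction {L : ℝ} {g : Plane → ℝ} (hg : ContinuousOn g (fullSet L)) :
    Continuous fun t => g (polarDir t) :=
  hg.comp_continuous continuous_polarDir fun t => circle_subset_fullSet L (polarDir_mem_circle t)

lemma continuousOn_needle_restriction {L : ℝ} {g : Plane → ℝ} (hg : ContinuousOn g (fullSet L)) :
    ContinuousOn (fun t => g (needleMap t)) (Icc 0 L) :=
  hg.comp contDiff_needleMap.continuous.continuousOn fun _ ht => needleMap_mem_fullSet ht

/-! ### The energy in arc length and in polar coordinates. -/

lemma enorm_tangentialGradient_polarDir (f : Plane → ℝ) (t : ℝ) :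
    ‖tangentialGradient f (polarDir t)‖ₑ = ‖deriv (fun t => f (polarDir t)) t‖ₑ := by
  have h1 : ∀ s : ℝ, cos s • polarDir t + sin s • circleTangent (polarDir t) = polarDir (s + t) :=
    fun s => rotation_polarDir s t
  have h2 : circleTangent (polarDir t) = polarTan t := by
    ext i
    fin_cases i <;> simp [circleTangent, polarDir, polarTan]
  have h3 : ‖polarTan t‖ₑ = 1 := by rw [← ofReal_norm, norm_polarTan, ENNReal.ofReal_one]
  rw [tangentialGradient, if_pos (polarDir_mem_circle t)]
  simp_rw [h1]
  rw [deriv_comp_add_const (fun t => f (polarDir t)) t 0, zero_add, h2, enorm_smul, h3, mul_one]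

lemma enorm_tangentialGradient_needleMap (f : Plane → ℝ) {t : ℝ} (ht : 0 < t) :
    ‖tangentialGradient f (needleMap t)‖ₑ = ‖deriv (fun t => f (needleMap t)) t‖ₑ := by
  have h0 : needleMap t ∉ circle := by
    intro h
    have h1 : ‖needleMap t‖ = 1 := by simpa [circle] using h
    have h2 : ‖needleMap t‖ ^ 2 = (1 + t) ^ 2 := by
      simp [needleMap, EuclideanSpace.norm_sq_eq, Fin.sum_univ_two]
    rw [h1] at h2
    nlinarith
  have h1 : ∀ s : ℝ, needleMap t + s • (!₂[1, 0] : Plane) = needleMap (s + t) := fun s => by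
    ext i
    fin_cases i
    · simp [needleMap]
      ring
    · simp [needleMap]
  have h3 : ‖(!₂[1, 0] : Plane)‖ₑ = 1 := by
    rw [← ofReal_norm]
    simp [EuclideanSpace.norm_eq]
  rw [tangentialGradient, if_neg h0]
  simp_rw [h1]
  rw [deriv_comp_add_const (fun t => f (needleMap t)) t 0, zero_add, enorm_smul, h3, mul_one]

/-- A measurable choice of the angle in `(0, 2π]`. -/
def angle (x : Plane) : ℝ := Complex.arg (-⟨x 0, x 1⟩) + π

lemma measurable_angle : Measurable angle := by
  have h : Measurable fun x : Plane => (-⟨x 0, x 1⟩ : ℂ) := by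
    have e : (fun x : Plane => (-⟨x 0, x 1⟩ : ℂ)) = fun x => -((x 0 : ℂ) + x 1 * Complex.I) := by
      ext x
      rw [Complex.mk_eq_add_mul_I]
    rw [e]
    fun_prop
  exact (Complex.measurable_arg.comp h).add_const π

lemma angle_polarDir {t : ℝ} (ht : t ∈ Ioc 0 (2 * π)) : angle (polarDir t) = t := by
  have h : (-⟨polarDir t 0, polarDir t 1⟩ : ℂ)
      = Complex.cos ((t - π : ℝ) : ℂ) + Complex.sin ((t - π : ℝ) : ℂ) * Complex.I := by
    rw [← Complex.ofReal_cos, ← Complex.ofReal_sin, cos_sub_pi, sin_sub_pi]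
    apply Complex.ext <;> simp [polarDir, Complex.cos_ofReal_re, Complex.sin_ofReal_re]
  rw [angle, h, Complex.arg_cos_add_sin_mul_I ⟨by linarith [ht.1], by linarith [ht.2]⟩]
  ring

/-- For arbitrary f, measurability of `tangentialGradient f` is not at hand. On the circle its norm
is replaced almost everywhere by that of a one-dimensional `deriv`, which is always measurable,
composed with the measurable `angle`. -/
lemma lintegral_tangentialGradient {L : ℝ} (hL : 0 < L) (f : Plane → ℝ) :
    ∫⁻ x, ‖tangentialGradient f x‖ₑ ^ 2 ∂(sigmaMeasure L)
      = ENNReal.ofReal (1 / (2 * π + L))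
        * ((∫⁻ t in Ioc 0 (2 * π), ‖deriv (fun t => f (polarDir t)) t‖ₑ ^ 2)
          + ∫⁻ t in Ioc 0 L, ‖deriv (fun t => f (needleMap t)) t‖ₑ ^ 2) := by
  rw [sigmaMeasure_eq hL, lintegral_smul_measure, lintegral_add_measure, smul_eq_mul,
    measurableEmbedding_needleMap.lintegral_map]
  congr 2
  · have hmem : ∀ᵐ x ∂(volume.restrict (Ioc 0 (2 * π))).map polarDir, polarDir (angle x) = x := by
      have hm : MeasurableSet {x | polarDir (angle x) = x} :=
        measurableSet_eq_fun (continuous_polarDir.measurable.comp measurable_angle) measurable_id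
      rw [ae_map_iff continuous_polarDir.aemeasurable hm]
      filter_upwards [ae_restrict_mem measurableSet_Ioc] with t ht
      rw [angle_polarDir ht]
    have h1 : ∫⁻ x, ‖tangentialGradient f x‖ₑ ^ 2 ∂(volume.restrict (Ioc 0 (2 * π))).map polarDir
        = ∫⁻ x, ‖deriv (fun t => f (polarDir t)) (angle x)‖ₑ ^ 2
          ∂(volume.restrict (Ioc 0 (2 * π))).map polarDir := by
      refine lintegral_congr_ae ?_
      filter_upwards [hmem] with x hx
      rw [← enorm_tangentialGradient_polarDir, hx]
    have hm : Measurable fun x => ‖deriv (fun t => f (polarDir t)) (angle x)‖ₑ ^ 2 :=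
      (((measurable_deriv _).comp measurable_angle).enorm).pow_const 2
    rw [h1, lintegral_map hm continuous_polarDir.measurable]
    refine setLIntegral_congr_fun measurableSet_Ioc fun t ht => ?_
    simp only [angle_polarDir ht]
  · refine setLIntegral_congr_fun measurableSet_Ioc fun t ht => ?_
    simp only [enorm_tangentialGradient_needleMap f ht.1]

lemma enorm_sq_eq_ofReal (a : ℝ) : ‖a‖ₑ ^ 2 = ENNReal.ofReal (a ^ 2) := by
  rw [Real.enorm_eq_ofReal_abs, ← ENNReal.ofReal_pow (abs_nonneg a), sq_abs]

lemma integrable_sq_of_lintegral {b : ℝ} (hb : 0 ≤ b) {h : ℝ → ℝ} (hm : Measurable h)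
    (hfin : ∫⁻ t in Ioc 0 b, ‖h t‖ₑ ^ 2 ≠ ⊤) :
    IntegrableOn (fun t => h t ^ 2) (Icc 0 b) ∧
      ENNReal.ofReal (∫ t in 0..b, h t ^ 2) = ∫⁻ t in Ioc 0 b, ‖h t‖ₑ ^ 2 := by
  simp_rw [enorm_sq_eq_ofReal] at hfin ⊢
  have hi : IntegrableOn (fun t => h t ^ 2) (Ioc 0 b) := by
    refine ⟨(hm.pow_const 2).aestronglyMeasurable, ?_⟩
    rw [hasFiniteIntegral_iff_ofReal (Filter.Eventually.of_forall fun t => sq_nonneg _)]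
    exact hfin.lt_top
  refine ⟨(integrableOn_Icc_iff_integrableOn_Ioc (by simp)).2 hi, ?_⟩
  rw [intervalIntegral.integral_of_le hb]
  exact ofReal_integral_eq_lintegral_ofReal hi (Filter.Eventually.of_forall fun t => sq_nonneg _)

/-- Finite energy on the circle with its needle. -/
lemma exists_lassoPair {L : ℝ} (hL : 0 < L) {f : Plane → ℝ} (hf : f ∈ domain L) {y : ℝ}
    (hy0 : 0 ≤ y)
    (hy : ∫⁻ x, ‖tangentialGradient f x‖ₑ ^ 2 ∂(sigmaMeasure L) = ENNReal.ofReal y) :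
    IsLassoPair L (fun t => f (polarDir t)) (deriv fun t => f (polarDir t))
        (fun t => f (needleMap t)) (deriv fun t => f (needleMap t)) ∧
      (∫ t in 0..(2 * π), deriv (fun t => f (polarDir t)) t ^ 2)
        + (∫ t in 0..L, deriv (fun t => f (needleMap t)) t ^ 2) = (2 * π + L) * y := by
  have hp := pi_pos
  have hK : 0 < 2 * π + L := by positivity
  rw [lintegral_tangentialGradient hL] at hy
  set X := ∫⁻ t in Ioc 0 (2 * π), ‖deriv (fun t => f (polarDir t)) t‖ₑ ^ 2 with hX
  set Y := ∫⁻ t in Ioc 0 L, ‖deriv (fun t => f (needleMap t)) t‖ₑ ^ 2 with hY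
  have hsum : X + Y = ENNReal.ofReal ((2 * π + L) * y) := by
    rw [ENNReal.ofReal_mul hK.le, ← hy, ← mul_assoc, ← ENNReal.ofReal_mul hK.le,
      mul_one_div_cancel hK.ne', ENNReal.ofReal_one, one_mul]
  have hfin : X + Y ≠ ⊤ := by rw [hsum]; exact ENNReal.ofReal_ne_top
  obtain ⟨i1, e1⟩ := integrable_sq_of_lintegral (by positivity)
    (measurable_deriv fun t => f (polarDir t)) (ENNReal.add_ne_top.1 hfin).1
  obtain ⟨i2, e2⟩ := integrable_sq_of_lintegral hL.le
    (measurable_deriv fun t => f (needleMap t)) (ENNReal.add_ne_top.1 hfin).2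
  refine ⟨⟨measurable_deriv _, (continuous_circle_restriction hf.1).continuousOn,
    fun t ht => hasDerivAt_circle_restriction hf ht, i1, continuousOn_needle_restriction hf.1,
    fun t ht => hasDerivAt_needle_restriction hf ht, i2, by rw [polarDir_zero_eq], ?_⟩, ?_⟩
  · congr 1
    ext i
    fin_cases i <;> simp [polarDir, needleMap]
  · have n1 : 0 ≤ ∫ t in 0..(2 * π), deriv (fun t => f (polarDir t)) t ^ 2 :=
      intervalIntegral.integral_nonneg (by positivity) fun _ _ => sq_nonneg _
    have n2 : 0 ≤ ∫ t in 0..L, deriv (fun t => f (needleMap t)) t ^ 2 :=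
      intervalIntegral.integral_nonneg hL.le fun _ _ => sq_nonneg _
    rw [← hX] at e1
    rw [← hY] at e2
    rw [← e1, ← e2, ← ENNReal.ofReal_add n1 n2] at hsum
    exact (ENNReal.ofReal_eq_ofReal_iff (by positivity) (by positivity)).1 hsum

/-- Finite energy on the disc. -/
lemma polarInt_polarEnergy_le {f : Plane → ℝ} (hf : ContDiffOn ℝ 1 f disc) {x : ℝ} (hx0 : 0 ≤ x)
    (hx : ∫⁻ z, ‖gradient f z‖ₑ ^ 2 ∂discMeasure = ENNReal.ofReal x) {ρ : ℝ}
    (hρ : ρ ∈ Ioo (0 : ℝ) 1) : polarInt (polarEnergy f) ρ ≤ π * x := by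
  have hp := pi_pos
  have hE : polarEnergy f = polarVal fun z => ‖gradient f z‖ ^ 2 := by
    ext r θ
    have h := (polarBasis θ).sum_sq_norm_inner_right (gradient f (r • polarDir θ))
    rw [Fin.sum_univ_two, polarBasis_zero, polarBasis_one, real_inner_comm,
      real_inner_comm (gradient f (r • polarDir θ)) (polarTan θ), inner_gradient_left,
      inner_gradient_left, Real.norm_eq_abs, Real.norm_eq_abs, sq_abs, sq_abs] at h
    exact h
  have hsub : Metric.closedBall (0 : Plane) ρ ⊆ disc := Metric.closedBall_subset_ball hρ.2
  have hc : ContinuousOn (fun z => ‖gradient f z‖ ^ 2) (Metric.closedBall 0 ρ) := by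
    have h1 : (fun z => ‖gradient f z‖ ^ 2) = fun z => ‖fderiv ℝ f z‖ ^ 2 := by
      ext z
      rw [gradient, LinearIsometryEquiv.norm_map]
    rw [h1]
    exact (((hf.continuousOn_fderiv_of_isOpen isOpen_disc (by simp)).mono hsub).norm).pow 2
  have hi : IntegrableOn (fun z => ‖gradient f z‖ ^ 2) (Metric.ball 0 ρ) :=
    (hc.integrableOn_compact (isCompact_closedBall _ _)).mono_set Metric.ball_subset_closedBall
  rw [hE, ← setIntegral_ball_eq_polarInt hρ.1 hc]
  rw [discMeasure_eq, lintegral_smul_measure, smul_eq_mul] at hx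
  have h1 : ∫⁻ z in disc, ‖gradient f z‖ₑ ^ 2 = ENNReal.ofReal (π * x) := by
    rw [ENNReal.ofReal_mul hp.le, ← hx, ← mul_assoc, ← ENNReal.ofReal_mul hp.le,
      mul_one_div_cancel hp.ne', ENNReal.ofReal_one, one_mul]
  have h2 : ENNReal.ofReal (∫ z in Metric.ball 0 ρ, ‖gradient f z‖ ^ 2)
      ≤ ENNReal.ofReal (π * x) := by
    rw [ofReal_integral_eq_lintegral_ofReal hi (Filter.Eventually.of_forall fun z => sq_nonneg _),
      ← h1]
    have e : ∀ z, ENNReal.ofReal (‖gradient f z‖ ^ 2) = ‖gradient f z‖ₑ ^ 2 := fun z => by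
      rw [← ofReal_norm, ENNReal.ofReal_pow (norm_nonneg _)]
    simp_rw [e]
    exact lintegral_mono_set (Metric.ball_subset_ball hρ.2.le)
  exact (ENNReal.ofReal_le_ofReal_iff (by positivity)).1 h2

/-! ### Integrals of continuous functions -/

lemma integral_discMeasure {g : Plane → ℝ} (hg : ContinuousOn g closedDisc) :
    Integrable g discMeasure ∧ ∫ x, g x ∂discMeasure = polarInt (polarVal g) 1 / π := by
  have hi : IntegrableOn g disc :=
    (hg.integrableOn_compact (isCompact_closedBall _ _)).mono_set Metric.ball_subset_closedBall
  rw [discMeasure_eq]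
  refine ⟨hi.smul_measure ENNReal.ofReal_ne_top, ?_⟩
  rw [integral_smul_measure, ENNReal.toReal_ofReal (by positivity), disc,
    setIntegral_ball_eq_polarInt one_pos hg, smul_eq_mul]
  ring

lemma integral_sigmaMeasure {L : ℝ} (hL : 0 < L) {g : Plane → ℝ}
    (hg : ContinuousOn g (fullSet L)) :
    Integrable g (sigmaMeasure L) ∧ ∫ x, g x ∂(sigmaMeasure L)
      = ((∫ t in 0..(2 * π), g (polarDir t)) + ∫ t in 0..L, g (needleMap t)) / (2 * π + L) := by
  have hp := pi_pos
  have hm1 : AEStronglyMeasurable g ((volume.restrict (Ioc 0 (2 * π))).map polarDir) := by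
    have hmem : ∀ᵐ x ∂(volume.restrict (Ioc 0 (2 * π))).map polarDir, x ∈ circle := by
      rw [ae_map_iff (p := fun x => x ∈ circle) continuous_polarDir.aemeasurable
        measurableSet_circle]
      exact Filter.Eventually.of_forall polarDir_mem_circle
    rw [← Measure.restrict_eq_self_of_ae_mem hmem]
    exact (hg.mono (circle_subset_fullSet L)).aestronglyMeasurable measurableSet_circle
  have i1 : Integrable g ((volume.restrict (Ioc 0 (2 * π))).map polarDir) := by
    rw [integrable_map_measure hm1 continuous_polarDir.aemeasurable]
    exact (continuous_circle_restriction hg).integrableOn_Ioc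
  have i2 : Integrable g ((volume.restrict (Ioc 0 L)).map needleMap) := by
    rw [measurableEmbedding_needleMap.integrable_map_iff]
    exact (continuousOn_needle_restriction hg).integrableOn_Icc.mono_set Ioc_subset_Icc_self
  rw [sigmaMeasure_eq hL]
  refine ⟨(i1.add_measure i2).smul_measure ENNReal.ofReal_ne_top, ?_⟩
  rw [integral_smul_measure, integral_add_measure i1 i2,
    integral_map continuous_polarDir.aemeasurable hm1, measurableEmbedding_needleMap.integral_map,
    ENNReal.toReal_ofReal (by positivity), intervalIntegral.integral_of_le (by positivity),
    intervalIntegral.integral_of_le hL.le, smul_eq_mul]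
  ring

lemma integral_mixedMeasure {L α : ℝ} (hα : 0 ≤ α) (hα1 : α ≤ 1) {g : Plane → ℝ}
    (h1 : Integrable g discMeasure) (h2 : Integrable g (sigmaMeasure L)) :
    Integrable g (mixedMeasure L α) ∧ ∫ x, g x ∂(mixedMeasure L α)
      = α * (∫ x, g x ∂discMeasure) + (1 - α) * ∫ x, g x ∂(sigmaMeasure L) := by
  have i1 := h1.smul_measure (ENNReal.ofReal_ne_top (r := α))
  have i2 := h2.smul_measure (ENNReal.ofReal_ne_top (r := 1 - α))
  rw [mixedMeasure]
  refine ⟨i1.add_measure i2, ?_⟩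
  rw [integral_add_measure i1 i2, integral_smul_measure, integral_smul_measure,
    ENNReal.toReal_ofReal hα, ENNReal.toReal_ofReal (by linarith), smul_eq_mul, smul_eq_mul]

lemma isProbabilityMeasure_mixedMeasure {L α : ℝ} (hL : 0 < L) (hα : 0 ≤ α) (hα1 : α ≤ 1) :
    IsProbabilityMeasure (mixedMeasure L α) := by
  have hp := pi_pos
  have h1 : discMeasure univ = 1 := by
    rw [discMeasure_eq, Measure.smul_apply, Measure.restrict_apply_univ, disc,
      EuclideanSpace.volume_ball_fin_two, smul_eq_mul, ENNReal.ofReal_one, one_pow, one_mul,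
      ← ENNReal.ofReal_mul (by positivity), one_div_mul_cancel hp.ne', ENNReal.ofReal_one]
  have h2 : sigmaMeasure L univ = 1 := by
    rw [sigmaMeasure_eq hL, Measure.smul_apply, Measure.add_apply,
      Measure.map_apply continuous_polarDir.measurable MeasurableSet.univ,
      Measure.map_apply measurableEmbedding_needleMap.measurable MeasurableSet.univ,
      preimage_univ, preimage_univ, Measure.restrict_apply_univ, Measure.restrict_apply_univ,
      volume_Ioc, volume_Ioc, sub_zero, sub_zero, smul_eq_mul,
      ← ENNReal.ofReal_add (by positivity) hL.le, ← ENNReal.ofReal_mul (by positivity),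
      one_div_mul_cancel (by positivity), ENNReal.ofReal_one]
  refine ⟨?_⟩
  rw [mixedMeasure, Measure.add_apply, Measure.smul_apply, Measure.smul_apply, h1, h2, smul_eq_mul,
    smul_eq_mul, mul_one, mul_one, ← ENNReal.ofReal_add hα (by linarith), add_sub_cancel,
    ENNReal.ofReal_one]

/-! ### The Poincaré constant -/

/-- The law of total variance for a mixture of two probability measures; continuity of f on the
closed disc with needle makes all integrals finite. -/
lemma evariance_mixedMeasure {L α : ℝ} (hL : 0 < L) (hα : 0 ≤ α) (hα1 : α ≤ 1) {f : Plane → ℝ}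
    (hf : ContinuousOn f (fullSet L)) :
    evariance f (mixedMeasure L α) = ENNReal.ofReal
      (α * ((∫ x, f x ^ 2 ∂discMeasure) - (∫ x, f x ∂discMeasure) ^ 2)
        + (1 - α) * ((∫ x, f x ^ 2 ∂(sigmaMeasure L)) - (∫ x, f x ∂(sigmaMeasure L)) ^ 2)
        + α * (1 - α) * ((∫ x, f x ∂discMeasure) - ∫ x, f x ∂(sigmaMeasure L)) ^ 2) := by
  have := isProbabilityMeasure_mixedMeasure hL hα hα1
  have hd : ContinuousOn f closedDisc := hf.mono subset_union_left
  obtain ⟨i1, e1⟩ := integral_mixedMeasure hα hα1 (integral_discMeasure hd).1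
    (integral_sigmaMeasure hL hf).1
  obtain ⟨i2, e2⟩ := integral_mixedMeasure hα hα1 (integral_discMeasure (hd.pow 2)).1
    (integral_sigmaMeasure hL (hf.pow 2)).1
  have hmem : MemLp f 2 (mixedMeasure L α) :=
    (memLp_two_iff_integrable_sq i1.aestronglyMeasurable).2 i2
  rw [← ofReal_variance hmem, variance_eq_sub hmem, e2, e1]
  congr 1
  simp only [Pi.pow_apply]
  ring

lemma disc_variance_le {L : ℝ} {f : Plane → ℝ} (hf : f ∈ domain L) {x : ℝ} (hx0 : 0 ≤ x)
    (hx : ∫⁻ z, ‖gradient f z‖ₑ ^ 2 ∂discMeasure = ENNReal.ofReal x) :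
    (∫ z, f z ^ 2 ∂discMeasure) - (∫ z, f z ∂discMeasure) ^ 2 ≤ 1 / sigmaBessel * x := by
  have hp := pi_pos
  have hσ := sigmaBessel_pos
  have hd : ContinuousOn f closedDisc := hf.1.mono subset_union_left
  have h1 : ContDiffOn ℝ 1 f disc := hf.2.1.mono (disc_subset L)
  have h := disc_poincare_of_le h1 hd fun ρ hρ => polarInt_polarEnergy_le h1 hx0 hx hρ
  have e2 : ∫ z, f z ^ 2 ∂discMeasure = polarInt (fun r θ => polarVal f r θ ^ 2) 1 / π :=
    (integral_discMeasure (hd.pow 2)).2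
  rw [e2, (integral_discMeasure hd).2]
  have h2 := div_le_div_of_nonneg_right h hp.le
  have e3 : π * x / sigmaBessel / π = 1 / sigmaBessel * x := by field_simp
  rw [e3] at h2
  refine le_trans (le_of_eq ?_) h2
  field_simp

lemma sigma_variance_le {L : ℝ} (hL : 0 < L) {f : Plane → ℝ} (hf : f ∈ domain L) {y : ℝ}
    (hy0 : 0 ≤ y)
    (hy : ∫⁻ x, ‖tangentialGradient f x‖ₑ ^ 2 ∂(sigmaMeasure L) = ENNReal.ofReal y) :
    (∫ z, f z ^ 2 ∂(sigmaMeasure L)) - (∫ z, f z ∂(sigmaMeasure L)) ^ 2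
      ≤ 1 / gammaNeedle L * y := by
  have hp := pi_pos
  have hK : 0 < 2 * π + L := by positivity
  obtain ⟨hl, hI⟩ := exists_lassoPair hL hf hy0 hy
  have h := hl.poincare hL
  have hγ := (isLeast_gammaNeedle hL).1.1
  rw [hI] at h
  have e2 : ∫ z, f z ^ 2 ∂(sigmaMeasure L) = ((∫ t in 0..(2 * π), f (polarDir t) ^ 2)
      + ∫ t in 0..L, f (needleMap t) ^ 2) / (2 * π + L) :=
    (integral_sigmaMeasure hL (hf.1.pow 2)).2
  rw [e2, (integral_sigmaMeasure hL hf.1).2]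
  have h2 := div_le_div_of_nonneg_right h hK.le
  have e3 : 1 / gammaNeedle L * ((2 * π + L) * y) / (2 * π + L) = 1 / gammaNeedle L * y := by
    field_simp
  rw [e3] at h2
  refine le_trans (le_of_eq ?_) h2
  field_simp

/-- The circle is the piece common to disc and graph. With u the circle mean minus the disc mean, v
the circle mean minus the needle mean and k = L/(2π+L), the difference is -u + kv. -/
lemma mean_sub_mean_sq_le {L : ℝ} (hL : 0 < L) {f : Plane → ℝ} (hf : f ∈ domain L) {x y : ℝ}
    (hx0 : 0 ≤ x) (hx : ∫⁻ z, ‖gradient f z‖ₑ ^ 2 ∂discMeasure = ENNReal.ofReal x) (hy0 : 0 ≤ y)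
    (hy : ∫⁻ x, ‖tangentialGradient f x‖ₑ ^ 2 ∂(sigmaMeasure L) = ENNReal.ofReal y) :
    ((∫ z, f z ∂discMeasure) - ∫ z, f z ∂(sigmaMeasure L)) ^ 2
      ≤ 3 / 8 * x + L ^ 2 * (π + L) / (2 * π + L) * y := by
  have hp := pi_pos
  have hK : 0 < 2 * π + L := by positivity
  have hd : ContinuousOn f closedDisc := hf.1.mono subset_union_left
  have h1 : ContDiffOn ℝ 1 f disc := hf.2.1.mono (disc_subset L)
  obtain ⟨hl, hI⟩ := exists_lassoPair hL hf hy0 hy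
  have hD := disc_mean_sub_mean_sq_le_of_le h1 hd fun ρ hρ => polarInt_polarEnergy_le h1 hx0 hx hρ
  have hS := hl.mean_sub_mean_sq_le hL
  rw [hI] at hS
  rw [(integral_discMeasure hd).2, (integral_sigmaMeasure hL hf.1).2]
  have ec : circleInt (polarVal f) 1 = ∫ t in 0..(2 * π), f (polarDir t) := by
    simp [circleInt, polarVal]
  rw [ec] at hD
  set C := ∫ t in 0..(2 * π), f (polarDir t) with hC
  set N := ∫ t in 0..L, f (needleMap t) with hN
  set a := polarInt (polarVal f) 1 / π with ha
  have e1 : π * x / (8 * π) = x / 8 := by field_simp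
  rw [e1] at hD
  have e2 : a - (C + N) / (2 * π + L)
      = -(C / (2 * π) - a) + L / (2 * π + L) * (C / (2 * π) - N / L) := by
    field_simp
    ring
  rw [e2]
  set u := C / (2 * π) - a with hu
  set v := C / (2 * π) - N / L with hv
  set k := L / (2 * π + L) with hk
  -- Young's inequality with weights 3 and 3/2, where 1/3 + 2/3 = 1; the slack is (2u + kv)²/2. The
  -- weight 3 turns the disc bound x/8 into 3x/8 and still leaves room in the coefficient of y.
  have h3 : (-u + k * v) ^ 2 ≤ 3 * u ^ 2 + 3 / 2 * (k ^ 2 * v ^ 2) := by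
    nlinarith [sq_nonneg (2 * u + k * v)]
  have h4 : k ^ 2 * v ^ 2 ≤ k ^ 2 * ((π / 6 + L / 3) * ((2 * π + L) * y)) := by gcongr
  have e5 : 3 / 2 * (k ^ 2 * ((π / 6 + L / 3) * ((2 * π + L) * y)))
      = L ^ 2 * (π / 4 + L / 2) / (2 * π + L) * y := by
    rw [hk]
    field_simp
    ring
  have h6 : L ^ 2 * (π / 4 + L / 2) / (2 * π + L) * y ≤ L ^ 2 * (π + L) / (2 * π + L) * y := by
    gcongr <;> linarith
  linarith

/-- Since 0 * ⊤ = 0 in `ℝ≥0∞`, a weight a = 0 leaves E possibly infinite. Then x = 0 stands in for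
it and nothing is claimed about E. -/
lemma exists_real_energy {a : ℝ} (ha : 0 ≤ a) {E : ℝ≥0∞} (h : ENNReal.ofReal a * E ≠ ⊤) :
    ∃ x, 0 ≤ x ∧ ENNReal.ofReal a * E = ENNReal.ofReal (a * x) ∧
      (a ≠ 0 → E = ENNReal.ofReal x) := by
  rcases ha.eq_or_lt with rfl | ha
  · exact ⟨0, le_rfl, by simp, fun h => absurd rfl h⟩
  · have hE : E ≠ ⊤ := by
      rintro rfl
      exact h (ENNReal.mul_top (by simpa using ha))
    refine ⟨E.toReal, ENNReal.toReal_nonneg, ?_, fun _ => (ENNReal.ofReal_toReal hE).symm⟩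
    rw [ENNReal.ofReal_mul ha.le, ENNReal.ofReal_toReal hE]

lemma energy_eq (L : ℝ) {β : ℝ} (hβ : 0 < β) (α : ℝ) (f : Plane → ℝ) :
    energy L β α f = ENNReal.ofReal α * (∫⁻ x, ‖gradient f x‖ₑ ^ 2 ∂discMeasure)
      + ENNReal.ofReal β * (ENNReal.ofReal (1 - α)
        * ∫⁻ x, ‖tangentialGradient f x‖ₑ ^ 2 ∂(sigmaMeasure L)) := by
  have e : ∀ x, ‖√β • tangentialGradient f x‖ₑ ^ 2
      = ENNReal.ofReal β * ‖tangentialGradient f x‖ₑ ^ 2 := fun x => by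
    rw [enorm_smul, mul_pow, enorm_sq_eq_ofReal, sq_sqrt hβ.le]
  rw [energy]
  simp_rw [e]
  rw [lintegral_const_mul' _ _ ENNReal.ofReal_ne_top]
  ring

/-- The coefficient of αx is 1/σ + k(1-α) and that of β(1-α)y is 1/(βγ) + αK/β; each is at most the
maximum. An inequality whose weight vanishes is never used, which covers α = 0 and α = 1. -/
lemma mixed_variance_bound {α β σ γ K k a b d x y : ℝ} (hβ : 0 < β) (hα : 0 ≤ α) (hα1 : α ≤ 1)
    (hx : 0 ≤ x) (hy : 0 ≤ y) (h1 : α ≠ 0 → a ≤ 1 / σ * x) (h2 : 1 - α ≠ 0 → b ≤ 1 / γ * y)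
    (h3 : α ≠ 0 → 1 - α ≠ 0 → d ≤ k * x + K * y) :
    α * a + (1 - α) * b + α * (1 - α) * d
      ≤ max (1 / σ + k * (1 - α)) (1 / (β * γ) + α * (K / β))
        * (α * x + β * ((1 - α) * y)) := by
  have hα' : 0 ≤ 1 - α := by linarith
  set M := max (1 / σ + k * (1 - α)) (1 / (β * γ) + α * (K / β)) with hM
  have g1 : α * a ≤ α * (1 / σ * x) := by
    rcases eq_or_ne α 0 with h | h
    · simp [h]
    · exact mul_le_mul_of_nonneg_left (h1 h) hα
  have g2 : (1 - α) * b ≤ (1 - α) * (1 / γ * y) := by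
    rcases eq_or_ne (1 - α) 0 with h | h
    · simp [h]
    · exact mul_le_mul_of_nonneg_left (h2 h) hα'
  have g3 : α * (1 - α) * d ≤ α * (1 - α) * (k * x + K * y) := by
    rcases eq_or_ne α 0 with h | h
    · simp [h]
    rcases eq_or_ne (1 - α) 0 with h' | h'
    · simp [h']
    · exact mul_le_mul_of_nonneg_left (h3 h h') (mul_nonneg hα hα')
  have m1 : (1 / σ + k * (1 - α)) * (α * x) ≤ M * (α * x) :=
    mul_le_mul_of_nonneg_right (le_max_left _ _) (mul_nonneg hα hx)
  have m2 : (1 / (β * γ) + α * (K / β)) * (β * ((1 - α) * y)) ≤ M * (β * ((1 - α) * y)) :=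
    mul_le_mul_of_nonneg_right (le_max_right _ _) (by positivity)
  have e : (1 / (β * γ) + α * (K / β)) * (β * ((1 - α) * y))
      = (1 - α) * (1 / γ * y) + α * (1 - α) * (K * y) := by
    rw [one_div, mul_inv]
    field_simp
  rw [e] at m2
  linarith

lemma poincareConstant_le {L β α : ℝ} (hL : 0 < L) (hβ : 0 < β) (hα : 0 ≤ α) (hα1 : α ≤ 1) :
    poincareConstant L β α ≤ ENNReal.ofReal
      (max (1 / sigmaBessel + 3 / 8 * (1 - α))
        (1 / (β * gammaNeedle L) + α * (L ^ 2 * (π + L) / (β * (2 * π + L))))) := by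
  have hp := pi_pos
  refine iSup₂_le fun f hf => ?_
  obtain ⟨hfd, -⟩ := hf
  rcases eq_or_ne (energy L β α f) ⊤ with htop | hfin
  -- In `ℝ≥0∞` division by ⊤ gives 0, so functions of infinite energy do not affect the supremum.
  · simp [htop]
  refine ENNReal.div_le_of_le_mul ?_
  rw [energy_eq L hβ] at hfin ⊢
  obtain ⟨hfin1, hfin2⟩ := ENNReal.add_ne_top.1 hfin
  have hβ0 : ENNReal.ofReal β ≠ 0 := by simpa using hβ
  have hfin3 : ENNReal.ofReal (1 - α)
      * ∫⁻ x, ‖tangentialGradient f x‖ₑ ^ 2 ∂(sigmaMeasure L) ≠ ⊤ := by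
    intro h
    rw [h, ENNReal.mul_top hβ0] at hfin2
    exact hfin2 rfl
  obtain ⟨x, hx0, hx, hx'⟩ := exists_real_energy hα hfin1
  obtain ⟨y, hy0, hy, hy'⟩ := exists_real_energy (sub_nonneg.2 hα1) hfin3
  have hα' : 0 ≤ 1 - α := by linarith
  rw [hx, hy, ← ENNReal.ofReal_mul hβ.le, ← ENNReal.ofReal_add (by positivity) (by positivity),
    ← ENNReal.ofReal_mul' (by positivity), evariance_mixedMeasure hL hα hα1 hfd.1]
  refine ENNReal.ofReal_le_ofReal ?_
  have e : L ^ 2 * (π + L) / (β * (2 * π + L)) = L ^ 2 * (π + L) / (2 * π + L) / β := by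
    field_simp
  rw [e]
  exact mixed_variance_bound hβ hα hα1 hx0 hy0 (fun h => disc_variance_le hfd hx0 (hx' h))
    (fun h => sigma_variance_le hL hfd hy0 (hy' h))
    (fun h h' => mean_sub_mean_sq_le hL hfd hx0 (hx' h) hy0 (hy' h'))

end BallNeedle

end

theorem proposition3p8 :
    -- the smallest positive Neumann eigenvalue of the disc exists and is `sigmaDisc`
    IsLeast {μ : ℝ | 0 < μ ∧ BallNeedle.IsNeumannEigenvalue μ} BallNeedle.sigmaDisc ∧
    -- the smallest positive solution of the equation exists, is `gammaNeedle L`, and is `≤ 1`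
    (∀ L : ℝ, 0 < L →
      IsLeast {γ : ℝ | 0 < γ ∧ BallNeedle.NeedleEquation L γ} (BallNeedle.gammaNeedle L) ∧
      BallNeedle.gammaNeedle L ≤ 1) ∧
    -- the value for `L = 2π`, and its numerical value to four decimals
    BallNeedle.gammaNeedle (2 * π) = (arccos (-1 / 3) / (2 * π)) ^ 2 ∧
    |BallNeedle.gammaNeedle (2 * π) - 0.0925| < 0.00005 ∧
    -- the bound for the Poincaré constant
    ∀ L β α : ℝ, 0 < L → 0 < β → 0 ≤ α → α ≤ 1 →
      BallNeedle.poincareConstant L β α ≤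
        ENNReal.ofReal
          (max (1 / BallNeedle.sigmaDisc + 3 / 8 * (1 - α))
            (1 / (β * BallNeedle.gammaNeedle L)
              + α * (L ^ 2 * (π + L) / (β * (2 * π + L))))) := by
  refine ⟨?_, fun L hL => ⟨BallNeedle.isLeast_gammaNeedle hL, BallNeedle.gammaNeedle_le_one hL⟩,
    BallNeedle.gammaNeedle_two_pi, BallNeedle.gammaNeedle_two_pi_approx,
    fun L β α hL hβ hα hα1 => ?_⟩
  · rw [BallNeedle.sigmaDisc_eq]
    exact BallNeedle.isLeast_sigmaBessel
  · rw [BallNeedle.sigmaDisc_eq]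
    exact BallNeedle.poincareConstant_le hL hβ hα hα1
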